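/- Let $d\ge 1$ be a real number and let $\mu$ be the symmetric Jacobi measure $d\mu(x)=C_d(1-x^2)^{\frac d2-1}dx$ on $E=[-1,1]$ ($C_d$ normalizing $\mu$ to a probability measure). Let $(P_t)_{t\ge0}$ be the Markov semigroup, symmetric in $L^2(\mu)$, with generator $Lf=(1-x^2)f''-d\,x f'$; for $t>0$ its kernel with respect to $\mu$ is $p_t(x,y)=\sum_{k\ge0}e^{-k(k+d-1)t}J_k(x)J_k(y)$, where $J_k$ is the Jacobi polynomial of degree $k$ normalized in $L^2(\mu)$, $-LJ_k=k(k+d-1)J_k$. For a probability measure $\nu$ on $E$ and $t>0$, $P_t^*\nu$ is the measure with density $y\mapsto\int_E p_t(x,y)\,d\nu(x)$ with respect to $\mu$. Let $W_2$ be the quadratic Kantorovich distance on $E$ for the distance $\rho(x,y)=|\arccos x-\arccos y|$. Let $X_1,X_2,\dots$ be independent random variables with law $\mu$, $\mu^n=\frac1n\sum_{i=1}^n\delta_{X_i}$, $\mu^{n,t}=P_t^*\mu^n$, $r^n=\sqrt n(\mu^n-\mu)$ and $r^{n,t}(y)=\int_E(p_t(x,y)-1)\,dr^n(x)$. **Theorem.**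 There is a constant $C>0$, depending only on $d$, such that for all $n\ge1$ and all $t\in(0,1)$, $$\mathbb E\big[W_2^2(\mu^n,\mu^{n,t})\big]\le C\Big(\mathbb P\big(A_{1/2,n}^c\big)+\frac{\sqrt t}{n}\Big),\qquad A_{1/2,n}=\Big\{\sup_{y\in[-1,1]}\frac{|r^{n,t}(y)|}{\sqrt n}\le\frac12\Big\}.$$ **Corollary.** If $t=t(n)\to0$ as $n\to\infty$ and, for some $c>0$ and $\gamma\in(0,\frac2d)$, $t(n)\ge c\,n^{-\gamma}$ for all large $n$, then $$\lim_{n\to\infty}n\,\mathbb E\big[W_2^2(\mu^n,\mu^{n,t(n)})\big]=0.$$ -/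

import Mathlib

open MeasureTheory ProbabilityTheory Filter Topology
open scoped ENNReal

noncomputable section

namespace JacobiModel

/-! ### The state space, the intrinsic distance and the Jacobi measure -/

/-- The state space `E = [-1, 1]` of the Jacobi model. -/
abbrev E : Type := Set.Icc (-1 : ℝ) 1

/-- The intrinsic distance `ρ(x, y) = |arccos x - arccos y|` on `[-1, 1]`. -/
def rho (x y : E) : ℝ := |Real.arccos x - Real.arccos y|

/-- The normalization constant `C_d = (∫_{-1}^{1} (1 - x^2)^{d/2 - 1} dx)⁻¹`. -/
def normConst (d : ℝ) : ℝ := (∫ x in (-1 : ℝ)..1, (1 - x ^ 2) ^ (d / 2 - 1))⁻¹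

/-- The symmetric Jacobi measure `dμ(x) = C_d (1 - x^2)^{d/2 - 1} dx` on `[-1, 1]`. -/
def jacobiMeasure (d : ℝ) : Measure E :=
  (Measure.comap ((↑) : E → ℝ) volume).withDensity
    fun x => ENNReal.ofReal (normConst d * (1 - (x : ℝ) ^ 2) ^ (d / 2 - 1))

/-! ### The Jacobi operator, its eigenvalues and its polynomial eigenfunctions -/

/-- The symmetric Jacobi operator `L f = (1 - x^2) f'' - d x f'`. -/
def jacobiOperator (d : ℝ) (f : ℝ → ℝ) (x : ℝ) : ℝ :=
  (1 - x ^ 2) * deriv (deriv f) x - d * x * deriv f x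

/-- The eigenvalues `λ_k = k (k + d - 1)` of `-L`. -/
def eigenvalue (d : ℝ) (k : ℕ) : ℝ := k * (k + d - 1)

/-- The coefficients `(-k)_j (k+d-1)_j / ((d/2)_j j!)`, where `(a)_j = a (a+1) ⋯ (a+j-1)`. -/
def jacobiCoeff (d : ℝ) (k j : ℕ) : ℝ :=
  (ascPochhammer ℝ j).eval (-(k : ℝ)) * (ascPochhammer ℝ j).eval (k + d - 1) /
    ((ascPochhammer ℝ j).eval (d / 2) * (j.factorial : ℝ))

/-- The Jacobi (ultraspherical) polynomial of degree `k` for the weight `(1 - x^2)^{d/2 - 1}`,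
with value `1` at `x = 1`: the classical formula `₂F₁(-k, k + d - 1; d/2; (1 - x)/2)`. -/
def jacobiPoly (d : ℝ) (k : ℕ) : Polynomial ℝ :=
  ∑ j ∈ Finset.range (k + 1),
    Polynomial.C (jacobiCoeff d k j) * (Polynomial.C (1 / 2 : ℝ) * (1 - Polynomial.X)) ^ j

/-- The eigenfunctions `J_k` of `-L`: the Jacobi polynomials normalized in `L²(μ)`. -/
def J (d : ℝ) (k : ℕ) (x : E) : ℝ :=
  (jacobiPoly d k).eval (x : ℝ) /
    Real.sqrt (∫ z : E, ((jacobiPoly d k).eval (z : ℝ)) ^ 2 ∂(jacobiMeasure d))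

theorem jacobiCoeff_succ {d : ℝ} (hd : 0 < d) (k j : ℕ) :
    ((j : ℝ) + 1) * (j + d / 2) * jacobiCoeff d k (j + 1) =
      ((j : ℝ) - k) * (j + k + d - 1) * jacobiCoeff d k j := by
  have h1 : (ascPochhammer ℝ j).eval (d / 2) ≠ 0 := (ascPochhammer_pos j _ (by positivity)).ne'
  have h2 : (d / 2 + j : ℝ) ≠ 0 := by positivity
  have h3 : (j.factorial : ℝ) ≠ 0 := by positivity
  have h4 : (j + 1 : ℝ) ≠ 0 := by positivity
  simp only [jacobiCoeff, ascPochhammer_succ_eval, Nat.factorial_succ, Nat.cast_mul,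
    Nat.cast_add, Nat.cast_one]
  field_simp
  ring

theorem jacobiCoeff_last (d : ℝ) (k : ℕ) : jacobiCoeff d k (k + 1) = 0 := by
  simp [jacobiCoeff, ascPochhammer_succ_eval]

/-- `J_k` is up to normalization the polynomial `jacobiPoly d k`, and `-L J_k = λ_k J_k`. -/
theorem jacobiOperator_jacobiPoly {d : ℝ} (hd : 0 < d) (k : ℕ) (x : ℝ) :
    jacobiOperator d (fun y => (jacobiPoly d k).eval y) x =
      -(eigenvalue d k * (jacobiPoly d k).eval x) := by
  have key : ∀ N : ℕ, ∀ p : Polynomial ℝ,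
      p = ∑ j ∈ Finset.range N, Polynomial.C (jacobiCoeff d k j) *
        (Polynomial.C (1 / 2 : ℝ) * (1 - Polynomial.X)) ^ j →
      (1 - x ^ 2) * p.derivative.derivative.eval x - d * x * p.derivative.eval x +
        eigenvalue d k * p.eval x =
      -(N * ((N : ℝ) - 1 + d / 2) * jacobiCoeff d k N * (1 / 2 * (1 - x)) ^ (N - 1)) := by
    intro N
    induction N with
    | zero => rintro p rfl; simp
    | succ N ih =>
      rintro p rfl
      rw [Finset.sum_range_succ]
      have h := ih _ rfl
      have hs := jacobiCoeff_succ hd k N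
      simp only [Polynomial.derivative_add, Polynomial.eval_add] at h ⊢
      generalize (∑ j ∈ Finset.range N, Polynomial.C (jacobiCoeff d k j) *
        (Polynomial.C (1 / 2 : ℝ) * (1 - Polynomial.X)) ^ j) = q at h
      rcases N with _ | _ | N
      all_goals
        simp [eigenvalue, Polynomial.derivative_mul, Polynomial.derivative_pow] at h hs ⊢
      · linear_combination h + hs
      · linear_combination h + hs * (1 / 2 * (1 - x))
      · obtain ⟨w, rfl⟩ : ∃ w : ℝ, x = 1 - 2 * w := ⟨(1 - x) / 2, by ring⟩
        have e : (2⁻¹ : ℝ) * (1 - (1 - 2 * w)) = w := by ring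
        rw [e] at h ⊢
        linear_combination h + hs * w ^ (N + 2)
  have h := key (k + 1) _ rfl
  rw [jacobiCoeff_last] at h
  rw [jacobiOperator]
  simp only [Polynomial.deriv]
  have h' : (deriv fun y => (jacobiPoly d k).eval y) =
      fun y => (jacobiPoly d k).derivative.eval y := by
    funext y; simp
  rw [h', Polynomial.deriv]
  change (1 - x ^ 2) * (jacobiPoly d k).derivative.derivative.eval x -
    d * x * (jacobiPoly d k).derivative.eval x + eigenvalue d k * (jacobiPoly d k).eval x = _ at h
  linear_combination h

/-! ### The Jacobi semigroup -/

/-- The heat kernel `p_t(x, y) = ∑_k e^{-λ_k t} J_k(x) J_k(y)` (`t > 0`) of the semigroup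
`P_t = e^{tL}`, with respect to `μ`. -/
def heatKernel (d t : ℝ) (x y : E) : ℝ :=
  ∑' k : ℕ, Real.exp (-(eigenvalue d k * t)) * J d k x * J d k y

/-- The dual semigroup `P_t^*` (`t > 0`) acting on measures: `P_t^* ν` has density
`y ↦ ∫ p_t(x, y) dν(x)` with respect to `μ`. -/
def heatFlow (d t : ℝ) (ν : Measure E) : Measure E :=
  (jacobiMeasure d).withDensity fun y => ENNReal.ofReal (∫ x, heatKernel d t x y ∂ν)

/-! ### The Kantorovich distance -/

/-- The quadratic Kantorovich distance for the intrinsic distance `rho`: the infimum over all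
couplings `π` of `ν₁` and `ν₂` of `(∫ ρ² dπ)^{1/2}`. -/
def W2 (ν₁ ν₂ : Measure E) : ℝ≥0∞ :=
  ⨅ (π : Measure (E × E)) (_ : π.map Prod.fst = ν₁ ∧ π.map Prod.snd = ν₂),
    (∫⁻ z, ENNReal.ofReal (rho z.1 z.2 ^ 2) ∂π) ^ (1 / 2 : ℝ)

/-! ### Empirical measures and density fluctuations -/

/-- The empirical measure `μ^n = (1/n) ∑_{i<n} δ_{x_i}` of the first `n` points. -/
def empirical (n : ℕ) (x : ℕ → E) : Measure E :=
  (n : ℝ≥0∞)⁻¹ • ∑ i ∈ Finset.range n, Measure.dirac (x i)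

/-- The fluctuation density `r^{n,t}(y) = ∫ (p_t(·, y) - 1) dr^n`, where
`r^n = √n (μ^n - μ)` is a signed measure. -/
def fluctuation (d t : ℝ) (n : ℕ) (x : ℕ → E) (y : E) : ℝ :=
  Real.sqrt n * ((∫ z, (heatKernel d t z y - 1) ∂(empirical n x)) -
    ∫ z, (heatKernel d t z y - 1) ∂(jacobiMeasure d))

/-- The event `A_{1/2,n}` that `sup_y |r^{n,t}(y)| / √n ≤ 1/2`, for a random sequence `X`. -/
def eventA {Ω : Type*} (d t : ℝ) (n : ℕ) (X : ℕ → Ω → E) : Set Ω :=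
  {ω | ⨆ y : E, ENNReal.ofReal (|fluctuation d t n (fun i => X i ω) y| / Real.sqrt n) ≤ 1 / 2}

/-- `X_0, X_1, …` are independent random variables on `(Ω, P)` with common distribution the
symmetric Jacobi measure of dimension `d`. -/
structure IsSample {Ω : Type*} [MeasurableSpace Ω] (P : Measure Ω) (d : ℝ) (X : ℕ → Ω → E) :
    Prop where
  measurable : ∀ i, Measurable (X i)
  map_eq : ∀ i, P.map (X i) = jacobiMeasure d
  indep : iIndepFun X P

/-- The expected regularization cost `𝔼[W₂²(μ^n, μ^{n,t})]` with `μ^{n,t} = P_t^* μ^n`. -/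
def expectedCost {Ω : Type*} [MeasurableSpace Ω] (P : Measure Ω) (d t : ℝ) (n : ℕ)
    (X : ℕ → Ω → E) : ℝ≥0∞ :=
  ∫⁻ ω, W2 (empirical n fun i => X i ω) (heatFlow d t (empirical n fun i => X i ω)) ^ 2 ∂P

end JacobiModel

end

/-!
# Regularization by the heat flow of empirical measures in the symmetric Jacobi model

**The cost of regularization.** The state space is an interval, so the optimal coupling is
monotone. Let `κ = P_t^* μ^n`, `ν = μ^n`, and let `F`, `G` be their distribution functions. Writing
`ρ(s, T s)²` as an integral over the segment travelled, and noting that `|F - G|(a)` is the mass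
which crosses `a`, one bounds the transport cost by
`2 ∫ ρ(a, T a) |F - G|(a) (1 - a²)^{-1/2} da`. On the event `A` the density of `κ` is at least
`1/2`, so `μ ≤ 2κ`, and Young's inequality absorbs the cost:
`W₂² ≤ 8 ∫ (F - G)² / σ da` with `σ = C_d (1 - a²)^{d/2}` (`W2_sq_le_lintegral`); this is a weighted
`H⁻¹` bound. Off `A`, the diameter bound `W₂ ≤ π` is enough.

The difference `F - G` at `a` is up to sign the average over the sample of the centred function
`(1 - P_t) 1_{[-1, a]}`, so by independence its second moment is `1/n` times a squared norm in
`L²(μ)`. Parseval's identity (`hasSum_sq_integral_mul_J`) computes this norm; the eigenvalue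
equation, integrated once, gives the coefficients `∫_{-1}^a J_k dμ = -σ(a) J_k'(a) / λ_k`, and
`∫ (1 - a²) J_k'² dμ = λ_k`. Hence the expectation of the `H⁻¹` norm is a constant times
`n⁻¹ ∑_k (1 - e^{-λ_k t})² / λ_k`, which is at most a constant times `√t / n` since `λ_k` is
comparable to `k²` (`lintegral_smoothingError_le`, `expectedCost_le`).

**The kernel.** Three properties of `p_t` are needed.
* `p_t ≥ 0` (`heatKernel_nonneg_ae`): the resolvent `(1 - εL)⁻¹` preserves positivity of polynomials
  because `L p ≥ 0` at a minimum of `p`, and `e^{tL}` is a limit of powers of resolvents.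
* `p_t ≤ C t^{-d/2}` (`exists_heatTrace_le`): let `q_k` be the Jacobi polynomials with value `1`
  at `1`. The energy `λ_k q_k² + (1 - x²) q_k'²` is largest at the endpoints (`energy_le`), so
  `|q_k| ≤ 1` and `q_k` is `√λ_k`-Lipschitz for `ρ`. A reproducing kernel therefore keeps half of its
  maximum on a ball of radius comparable to the inverse of the frequency, which bounds
  `∑_{λ_k ≤ s} ‖q_k‖⁻²` by a constant times `s^{d/2}` (`exists_sum_inv_normSq_le`).
* `p_t` is Lipschitz for `ρ` with a constant polynomial in `1/t` (`abs_heatKernel_sub_le`).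

**The probability of `Aᶜ`.** For fixed `y` the variables `p_t(X_i, y) - 1` are centred, of size and
variance at most a constant times `t^{-d/2}`, so Bernstein's inequality gives deviation
probabilities `exp (-c n t^{d/2})`. A union bound over a net of cardinality polynomial in `1/t`,
with the Lipschitz bound, yields `P(Aᶜ) ≤ C t^{-1-d/2} exp (-n t^{d/2} / C)`
(`exists_measureReal_compl_eventA_le`). If `t ≥ c n^{-γ}` with `γ < 2/d`, then `n t^{d/2}` is at least
a positive power of `n`, and `n P(Aᶜ) → 0`.
-/

noncomputable section

namespace JacobiModel

/-! ### The Jacobi measure as a weighted Lebesgue measure -/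

/-- The density `C_d (1 - x²)^{d/2 - 1}` of the Jacobi measure. -/
def density (d x : ℝ) : ℝ := normConst d * (1 - x ^ 2) ^ (d / 2 - 1)

/-- The density `C_d (1 - x²)^{d/2}` of the carré du champ: the Dirichlet form of the semigroup is
`∫ f' g' energyDensity`. -/
def energyDensity (d x : ℝ) : ℝ := normConst d * (1 - x ^ 2) ^ (d / 2)

variable {d : ℝ}

lemma one_sub_sq_nonneg {x : ℝ} (hx : x ∈ Set.Icc (-1 : ℝ) 1) : 0 ≤ 1 - x ^ 2 := by
  nlinarith [hx.1, hx.2]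

lemma one_sub_sq_pos {x : ℝ} (hx : x ∈ Set.Ioo (-1 : ℝ) 1) : 0 < 1 - x ^ 2 := by
  nlinarith [hx.1, hx.2]

lemma intervalIntegrable_rpow [Fact (1 ≤ d)] :
    IntervalIntegrable (fun x : ℝ => (1 - x ^ 2) ^ (d / 2 - 1)) volume (-1) 1 := by
  have h := Polynomial.Chebyshev.intervalIntegrable_sqrt_one_sub_sq_inv
  have hd : 1 ≤ d := Fact.out
  rw [intervalIntegrable_iff_integrableOn_Ioo_of_le (by norm_num)] at h ⊢
  refine Integrable.mono' h (Measurable.aestronglyMeasurable (by fun_prop)) ?_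
  filter_upwards [ae_restrict_mem measurableSet_Ioo] with x hx
  have h1 := one_sub_sq_pos hx
  rw [Real.norm_of_nonneg (Real.rpow_nonneg h1.le _), Real.sqrt_inv, Real.sqrt_eq_rpow,
    ← Real.rpow_neg h1.le]
  exact Real.rpow_le_rpow_of_exponent_ge h1 (by nlinarith [sq_nonneg x]) (by linarith)

lemma integral_rpow_pos [Fact (1 ≤ d)] : 0 < ∫ x in (-1 : ℝ)..1, (1 - x ^ 2) ^ (d / 2 - 1) :=
  intervalIntegral.intervalIntegral_pos_of_pos_on intervalIntegrable_rpow
    (fun _ hx => Real.rpow_pos_of_pos (one_sub_sq_pos hx) _) (by norm_num)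

lemma normConst_pos [Fact (1 ≤ d)] : 0 < normConst d := inv_pos.2 integral_rpow_pos

lemma measurable_density (d : ℝ) : Measurable (density d) := by unfold density; fun_prop

lemma intervalIntegrable_density [Fact (1 ≤ d)] : IntervalIntegrable (density d) volume (-1) 1 :=
  intervalIntegrable_rpow.const_mul _

lemma density_nonneg [Fact (1 ≤ d)] {x : ℝ} (hx : x ∈ Set.Icc (-1 : ℝ) 1) : 0 ≤ density d x :=
  mul_nonneg normConst_pos.le (Real.rpow_nonneg (one_sub_sq_nonneg hx) _)

lemma density_pos [Fact (1 ≤ d)] {x : ℝ} (hx : x ∈ Set.Ioo (-1 : ℝ) 1) : 0 < density d x :=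
  mul_pos normConst_pos (Real.rpow_pos_of_pos (one_sub_sq_pos hx) _)

lemma energyDensity_pos [Fact (1 ≤ d)] {x : ℝ} (hx : x ∈ Set.Ioo (-1 : ℝ) 1) :
    0 < energyDensity d x :=
  mul_pos normConst_pos (Real.rpow_pos_of_pos (one_sub_sq_pos hx) _)

lemma continuous_energyDensity [Fact (1 ≤ d)] : Continuous (energyDensity d) := by
  have hd : 1 ≤ d := Fact.out
  unfold energyDensity
  exact continuous_const.mul ((by fun_prop : Continuous fun x : ℝ => 1 - x ^ 2).rpow_const
    fun x => Or.inr (by linarith))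

lemma energyDensity_neg_one [Fact (1 ≤ d)] : energyDensity d (-1) = 0 := by
  have hd : 1 ≤ d := Fact.out
  simp [energyDensity, Real.zero_rpow (by linarith : d / 2 ≠ 0)]

lemma energyDensity_one [Fact (1 ≤ d)] : energyDensity d 1 = 0 := by
  have hd : 1 ≤ d := Fact.out
  simp [energyDensity, Real.zero_rpow (by linarith : d / 2 ≠ 0)]

lemma one_sub_sq_mul_density {x : ℝ} (hx : x ∈ Set.Ioo (-1 : ℝ) 1) :
    (1 - x ^ 2) * density d x = energyDensity d x := by
  have h := one_sub_sq_pos hx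
  simp only [density, energyDensity, Real.rpow_sub_one h.ne' (d / 2)]
  field_simp

lemma hasDerivAt_energyDensity {x : ℝ} (hx : x ∈ Set.Ioo (-1 : ℝ) 1) :
    HasDerivAt (energyDensity d) (-(d * x * density d x)) x := by
  have h := one_sub_sq_pos hx
  have h1 : HasDerivAt (fun x : ℝ => 1 - x ^ 2) (-(2 * x)) x := by
    simpa using (hasDerivAt_pow 2 x).const_sub 1
  have h2 := (h1.rpow_const (p := d / 2) (Or.inl h.ne')).const_mul (normConst d)
  refine h2.congr_deriv ?_
  simp only [density]
  ring

lemma lintegral_comap_coe (f : ℝ → ℝ≥0∞) :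
    ∫⁻ z : E, f z ∂(Measure.comap ((↑) : E → ℝ) volume) = ∫⁻ x in Set.Icc (-1 : ℝ) 1, f x :=
  lintegral_subtype_comap measurableSet_Icc f

lemma integral_jacobiMeasure [Fact (1 ≤ d)] (f : ℝ → ℝ) :
    ∫ z : E, f z ∂(jacobiMeasure d) = ∫ x in (-1 : ℝ)..1, f x * density d x := by
  have hm : Measurable fun x : E => ENNReal.ofReal (density d x) :=
    ((measurable_density d).comp measurable_subtype_coe).ennreal_ofReal
  change ∫ z : E, f z ∂((Measure.comap ((↑) : E → ℝ) volume).withDensity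
    fun x => ENNReal.ofReal (density d x)) = _
  rw [integral_withDensity_eq_integral_toReal_smul hm (by simp),
    intervalIntegral.integral_of_le (by norm_num), ← integral_Icc_eq_integral_Ioc,
    ← integral_subtype_comap measurableSet_Icc]
  refine integral_congr_ae (ae_of_all _ fun z => ?_)
  simp [ENNReal.toReal_ofReal (density_nonneg z.2), mul_comm]

lemma setIntegral_Iic_jacobiMeasure [Fact (1 ≤ d)] (f : ℝ → ℝ) (x : E) :
    ∫ z in Set.Iic x, f z ∂(jacobiMeasure d) = ∫ y in (-1 : ℝ)..x, f y * density d y := by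
  rw [← integral_indicator measurableSet_Iic]
  have h := integral_jacobiMeasure (d := d) (Set.indicator {y | y ≤ (x : ℝ)} f)
  have h2 : ∀ z : E, Set.indicator {y | y ≤ (x : ℝ)} f z = Set.indicator (Set.Iic x)
      (fun z : E => f z) z := fun z => by simp [Set.indicator]
  simp only [h2] at h
  rw [h, ← intervalIntegral.integral_indicator (a₂ := (x : ℝ)) x.2]
  congr 1
  ext y
  by_cases hy : y ≤ (x : ℝ) <;> simp [Set.indicator, hy]

instance isProbabilityMeasure_jacobiMeasure [Fact (1 ≤ d)] :
    IsProbabilityMeasure (jacobiMeasure d) := by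
  constructor
  change ((Measure.comap ((↑) : E → ℝ) volume).withDensity
    fun x => ENNReal.ofReal (density d x)) Set.univ = 1
  have hle : (-1 : ℝ) ≤ 1 := by norm_num
  rw [withDensity_apply _ MeasurableSet.univ, Measure.restrict_univ,
    lintegral_comap_coe (fun x => ENNReal.ofReal (density d x)),
    ← ofReal_integral_eq_lintegral_ofReal, integral_Icc_eq_integral_Ioc,
    ← intervalIntegral.integral_of_le hle]
  · have : ∫ x in (-1 : ℝ)..1, density d x = 1 := by
      simp only [density, intervalIntegral.integral_const_mul]
      rw [normConst, inv_mul_cancel₀ integral_rpow_pos.ne']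
    simp [this]
  · exact (intervalIntegrable_iff_integrableOn_Icc_of_le hle).1 intervalIntegrable_density
  · filter_upwards [ae_restrict_mem measurableSet_Icc] with x hx using density_nonneg hx

instance noAtoms_comap : NullSingletonClass (Measure.comap ((↑) : E → ℝ) volume) := by
  constructor
  intro x
  rw [(MeasurableEmbedding.subtype_coe measurableSet_Icc).comap_apply]
  simp

lemma jacobiMeasure_absolutelyContinuous :
    jacobiMeasure d ≪ Measure.comap ((↑) : E → ℝ) volume :=
  withDensity_absolutelyContinuous _ _

instance noAtoms_jacobiMeasure (d : ℝ) : NullSingletonClass (jacobiMeasure d) :=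
  ⟨fun _ => jacobiMeasure_absolutelyContinuous (measure_singleton _)⟩

lemma integrable_of_continuous {ν : Measure E} [IsFiniteMeasure ν] {f : E → ℝ}
    (hf : Continuous f) : Integrable f ν :=
  hf.integrable_of_hasCompactSupport (HasCompactSupport.of_compactSpace f)

/-! ### Integration by parts -/

/-- The Jacobi operator on polynomials. -/
def polyOperator (d : ℝ) (p : Polynomial ℝ) : Polynomial ℝ :=
  (1 - Polynomial.X ^ 2) * p.derivative.derivative -
    Polynomial.C d * Polynomial.X * p.derivative

lemma eval_polyOperator (p : Polynomial ℝ) (x : ℝ) : (polyOperator d p).eval x =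
    (1 - x ^ 2) * p.derivative.derivative.eval x - d * x * p.derivative.eval x := by
  simp [polyOperator]

lemma intervalIntegrable_mul_density [Fact (1 ≤ d)] {f : ℝ → ℝ} (hf : Continuous f) {x : ℝ}
    (hx : x ∈ Set.Icc (-1 : ℝ) 1) :
    IntervalIntegrable (fun y => f y * density d y) volume (-1) x := by
  refine (intervalIntegrable_density.continuousOn_mul hf.continuousOn).mono_set ?_
  rw [Set.uIcc_of_le hx.1, Set.uIcc_of_le (by norm_num)]
  exact Set.Icc_subset_Icc_right hx.2

/-- Integration by parts on `[-1, x]`; the boundary term at `-1` vanishes. -/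
lemma integral_polyOperator_mul [Fact (1 ≤ d)] (p q : Polynomial ℝ) {x : ℝ}
    (hx : x ∈ Set.Icc (-1 : ℝ) 1) :
    (∫ y in (-1 : ℝ)..x, ((polyOperator d p).eval y * q.eval y) * density d y) +
      ∫ y in (-1 : ℝ)..x, ((1 - y ^ 2) * (p.derivative.eval y * q.derivative.eval y)) *
        density d y = energyDensity d x * (p.derivative.eval x * q.eval x) := by
  rw [← intervalIntegral.integral_add (intervalIntegrable_mul_density (by fun_prop) hx)
    (intervalIntegrable_mul_density (by fun_prop) hx)]
  rw [intervalIntegral.integral_eq_sub_of_hasDerivAt_of_le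
    (f := fun y => energyDensity d y * (p.derivative.eval y * q.eval y)) hx.1
    (Continuous.continuousOn (continuous_energyDensity.mul (by fun_prop))) _
    ((intervalIntegrable_mul_density (by fun_prop) hx).add
      (intervalIntegrable_mul_density (by fun_prop) hx))]
  · simp [energyDensity_neg_one]
  · intro y hy
    have hy' : y ∈ Set.Ioo (-1 : ℝ) 1 := ⟨hy.1, hy.2.trans_le hx.2⟩
    refine ((hasDerivAt_energyDensity hy').mul
      ((p.derivative.hasDerivAt y).mul (q.hasDerivAt y))).congr_deriv ?_
    rw [eval_polyOperator, ← one_sub_sq_mul_density hy']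
    simp only [Pi.mul_apply]
    ring

/-! ### Balls at the endpoint -/

/-- Balls of the intrinsic distance centred at `1` have the volume growth of dimension `d`. -/
lemma exists_le_measure_ball [Fact (1 ≤ d)] : ∃ c : ℝ, 0 < c ∧ ∀ r : ℝ, 0 < r → r ≤ 1 →
    c * r ^ d ≤ (jacobiMeasure d).real {z : E | Real.arccos z ≤ r} := by
  have hd : 1 ≤ d := Fact.out
  refine ⟨normConst d / d * (2 / Real.pi) ^ d, by have := normConst_pos (d := d); positivity, ?_⟩
  intro r hr hr1
  have hpi := Real.pi_gt_three
  have ha0 : 0 ≤ Real.cos r := Real.cos_nonneg_of_neg_pi_div_two_le_of_le (by linarith)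
    (by linarith)
  have ha1 := Real.cos_le_one r
  set a : E := ⟨Real.cos r, by linarith, ha1⟩ with ha
  have hS : {z : E | Real.arccos z ≤ r} = (Set.Iio a)ᶜ := by
    ext z
    simp only [Set.mem_ofPred_eq, Set.mem_compl_iff, Set.mem_Iio, not_lt, ha, ← Subtype.coe_le_coe]
    constructor
    · intro h
      have := Real.cos_le_cos_of_nonneg_of_le_pi (Real.arccos_nonneg z) (by linarith) h
      rwa [Real.cos_arccos z.2.1 z.2.2] at this
    · intro h
      have := Real.arccos_le_arccos h
      rwa [Real.arccos_cos hr.le (by linarith)] at this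
  have hI : (jacobiMeasure d).real (Set.Iio a) ≤ ∫ y in (-1 : ℝ)..a, density d y := by
    refine (measureReal_mono Set.Iio_subset_Iic_self).trans ?_
    have h := setIntegral_Iic_jacobiMeasure (d := d) (fun _ => 1) a
    simp only [integral_const, measureReal_restrict_apply_univ, smul_eq_mul, mul_one, one_mul] at h
    exact h.le
  have h1 : (∫ y in (-1 : ℝ)..1, density d y) = 1 := by
    have h := integral_jacobiMeasure (d := d) (fun _ => 1)
    simpa using h.symm
  have hsub : IntervalIntegrable (density d) volume (-1) a := by
    simpa using intervalIntegrable_mul_density (d := d) (f := fun _ => 1) continuous_const a.2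
  have hsub' : IntervalIntegrable (density d) volume a 1 :=
    hsub.symm.trans intervalIntegrable_density
  have hadd := intervalIntegral.integral_add_adjacent_intervals hsub hsub'
  have hftc : ∫ y in (a : ℝ)..1, -(d * y * density d y) = 0 - energyDensity d a := by
    rw [intervalIntegral.integral_eq_sub_of_hasDerivAt_of_le (f := energyDensity d) ha1
      continuous_energyDensity.continuousOn, energyDensity_one]
    · exact fun y hy => hasDerivAt_energyDensity ⟨by linarith [hy.1, a.2.1], hy.2⟩
    · exact (hsub'.continuousOn_mul (Continuous.continuousOn (by fun_prop))).neg
  have hle : (∫ y in (a : ℝ)..1, d * y * density d y) ≤ ∫ y in (a : ℝ)..1, d * density d y := by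
    refine intervalIntegral.integral_mono_on ha1
      (hsub'.continuousOn_mul (Continuous.continuousOn (by fun_prop))) (hsub'.const_mul d) ?_
    intro y hy
    have h := density_nonneg (d := d) (x := y) ⟨by linarith [hy.1, a.2.1], hy.2⟩
    have : d * density d y * (1 - y) ≥ 0 := mul_nonneg (mul_nonneg (by linarith) h)
      (by linarith [hy.2])
    linarith
  rw [intervalIntegral.integral_neg] at hftc
  rw [intervalIntegral.integral_const_mul] at hle
  have hsin : (2 / Real.pi * r) ^ d ≤ (1 - Real.cos r ^ 2) ^ (d / 2) := by
    have h2 : 1 - Real.cos r ^ 2 = Real.sin r ^ 2 := by rw [Real.sin_sq]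
    have h3 : 2 / Real.pi * r ≤ Real.sin r := Real.mul_le_sin hr.le (by linarith)
    rw [h2, ← Real.rpow_natCast, ← Real.rpow_mul (le_trans (by positivity) h3)]
    norm_num
    rw [mul_div_cancel₀ _ (by norm_num : (2 : ℝ) ≠ 0)]
    exact Real.rpow_le_rpow (by positivity) h3 (by linarith)
  rw [hS, probReal_compl_eq_one_sub measurableSet_Iio]
  have hfin : energyDensity d a ≤ d * (1 - (jacobiMeasure d).real (Set.Iio a)) := by
    nlinarith
  have hkey : normConst d * (2 / Real.pi * r) ^ d ≤ energyDensity d a :=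
    mul_le_mul_of_nonneg_left hsin normConst_pos.le
  rw [mul_assoc, ← Real.mul_rpow (by positivity) hr.le, div_mul_eq_mul_div,
    div_le_iff₀ (by linarith)]
  linarith

/-! ### The Jacobi polynomials: degree, eigenvalue equation, orthogonality -/

lemma eigenvalue_nonneg [Fact (1 ≤ d)] (k : ℕ) : 0 ≤ eigenvalue d k := by
  have hd : 1 ≤ d := Fact.out
  exact mul_nonneg k.cast_nonneg (by linarith [(k.cast_nonneg : (0 : ℝ) ≤ k)])

lemma sq_le_eigenvalue [Fact (1 ≤ d)] (k : ℕ) : (k : ℝ) ^ 2 ≤ eigenvalue d k := by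
  have hd : 1 ≤ d := Fact.out
  unfold eigenvalue
  nlinarith [(k.cast_nonneg : (0 : ℝ) ≤ k)]

lemma eigenvalue_le [Fact (1 ≤ d)] (k : ℕ) : eigenvalue d k ≤ d * (k : ℝ) ^ 2 := by
  have hd : 1 ≤ d := Fact.out
  unfold eigenvalue
  rcases Nat.eq_zero_or_pos k with rfl | hk
  · simp
  · have : (1 : ℝ) ≤ k := by exact_mod_cast hk
    nlinarith [mul_nonneg (sub_nonneg.2 hd) (sub_nonneg.2 this)]

lemma eigenvalue_strictMono [Fact (1 ≤ d)] : StrictMono (eigenvalue d) := by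
  have hd : 1 ≤ d := Fact.out
  refine strictMono_nat_of_lt_succ fun k => ?_
  unfold eigenvalue
  push_cast
  nlinarith [(k.cast_nonneg : (0 : ℝ) ≤ k)]

lemma eigenvalue_zero : eigenvalue d 0 = 0 := by simp [eigenvalue]

lemma eigenvalue_pos [Fact (1 ≤ d)] {k : ℕ} (hk : k ≠ 0) : 0 < eigenvalue d k := by
  rw [← eigenvalue_zero (d := d)]
  exact eigenvalue_strictMono (Nat.pos_of_ne_zero hk)

lemma jacobiPoly_eval_one (k : ℕ) : (jacobiPoly d k).eval 1 = 1 := by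
  simp only [jacobiPoly, Polynomial.eval_finsetSum, Polynomial.eval_mul, Polynomial.eval_C,
    Polynomial.eval_pow, Polynomial.eval_sub, Polynomial.eval_one, Polynomial.eval_X, sub_self,
    mul_zero]
  rw [Finset.sum_eq_single 0]
  · simp [jacobiCoeff]
  · intro j _ hj
    simp [hj]
  · simp

lemma jacobiPoly_zero : jacobiPoly d 0 = 1 := by simp [jacobiPoly, jacobiCoeff]

lemma jacobiCoeff_self_ne_zero [Fact (1 ≤ d)] (k : ℕ) : jacobiCoeff d k k ≠ 0 := by
  have hd : 1 ≤ d := Fact.out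
  have h1 : (ascPochhammer ℝ k).eval (d / 2) ≠ 0 := (ascPochhammer_pos k _ (by positivity)).ne'
  have h2 : (ascPochhammer ℝ k).eval (-(k : ℝ)) ≠ 0 := by
    rw [Ne, ascPochhammer_eval_eq_zero_iff]
    rintro ⟨j, hj, h⟩
    have : (j : ℝ) = k := by linarith
    exact hj.ne (by exact_mod_cast this)
  have h3 : (ascPochhammer ℝ k).eval (k + d - 1) ≠ 0 := by
    rcases Nat.eq_zero_or_pos k with rfl | hk
    · simp
    · have : (1 : ℝ) ≤ k := by exact_mod_cast hk
      exact (ascPochhammer_pos k _ (by linarith)).ne'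
  have h4 : (k.factorial : ℝ) ≠ 0 := by positivity
  exact div_ne_zero (mul_ne_zero h2 h3) (mul_ne_zero h1 h4)

lemma degree_half_one_sub_X : (Polynomial.C (1 / 2 : ℝ) * (1 - Polynomial.X)).degree = 1 := by
  have : Polynomial.C (1 / 2 : ℝ) * (1 - Polynomial.X) =
      Polynomial.C (-1 / 2 : ℝ) * Polynomial.X + Polynomial.C (1 / 2 : ℝ) := by
    rw [show (-1 / 2 : ℝ) = -(1 / 2) by ring, Polynomial.C_neg]
    ring
  rw [this, Polynomial.degree_linear (by norm_num)]

lemma degree_jacobiPoly [Fact (1 ≤ d)] (k : ℕ) : (jacobiPoly d k).degree = k := by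
  have hdeg : ∀ j : ℕ, (Polynomial.C (jacobiCoeff d k j) *
      (Polynomial.C (1 / 2 : ℝ) * (1 - Polynomial.X)) ^ j).degree ≤ (j : WithBot ℕ) := fun j => by
    refine (Polynomial.degree_mul_le _ _).trans ?_
    refine (add_le_add_left Polynomial.degree_C_le _).trans ?_
    rw [Polynomial.degree_pow, degree_half_one_sub_X]
    simp
  rw [jacobiPoly, Finset.sum_range_succ, Polynomial.degree_add_eq_right_of_degree_lt]
  · rw [Polynomial.degree_C_mul (jacobiCoeff_self_ne_zero k), Polynomial.degree_pow,
      degree_half_one_sub_X]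
    simp
  · rw [Polynomial.degree_C_mul (jacobiCoeff_self_ne_zero k), Polynomial.degree_pow,
      degree_half_one_sub_X]
    refine (Polynomial.degree_sum_le _ _).trans_lt ?_
    rw [Finset.sup_lt_iff (by simp)]
    intro j hj
    refine (hdeg j).trans_lt ?_
    simpa using hj

/-- The Jacobi polynomials span all polynomials. -/
lemma span_jacobiPoly [Fact (1 ≤ d)] :
    Submodule.span ℝ (Set.range (jacobiPoly d)) = ⊤ := by
  let S : Polynomial.Sequence ℝ := ⟨jacobiPoly d, degree_jacobiPoly⟩
  exact S.span fun i => isUnit_iff_ne_zero.2 (Polynomial.leadingCoeff_ne_zero.2 (S.ne_zero i))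

lemma polyOperator_jacobiPoly [Fact (1 ≤ d)] (k : ℕ) :
    polyOperator d (jacobiPoly d k) = Polynomial.C (-eigenvalue d k) * jacobiPoly d k := by
  have hd : 1 ≤ d := Fact.out
  refine Polynomial.funext fun x => ?_
  have h := jacobiOperator_jacobiPoly (by linarith : 0 < d) k x
  rw [eval_polyOperator]
  have h' : (deriv fun y => (jacobiPoly d k).eval y) =
      fun y => (jacobiPoly d k).derivative.eval y := by
    funext y; simp
  rw [jacobiOperator, h', Polynomial.deriv] at h
  rw [h]
  simp

lemma integral_polyOperator_mul_eq [Fact (1 ≤ d)] (p q : Polynomial ℝ) :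
    ∫ z : E, (polyOperator d p).eval (z : ℝ) * q.eval (z : ℝ) ∂(jacobiMeasure d) =
      -∫ z : E, (1 - (z : ℝ) ^ 2) * (p.derivative.eval (z : ℝ) * q.derivative.eval (z : ℝ))
        ∂(jacobiMeasure d) := by
  rw [integral_jacobiMeasure (fun y => (polyOperator d p).eval y * q.eval y),
    integral_jacobiMeasure (fun y => (1 - y ^ 2) * (p.derivative.eval y * q.derivative.eval y))]
  have h := integral_polyOperator_mul (d := d) p q (x := 1) (by simp)
  rw [energyDensity_one] at h
  linarith

lemma integral_polyOperator_symm [Fact (1 ≤ d)] (p q : Polynomial ℝ) :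
    ∫ z : E, (polyOperator d p).eval (z : ℝ) * q.eval (z : ℝ) ∂(jacobiMeasure d) =
      ∫ z : E, p.eval (z : ℝ) * (polyOperator d q).eval (z : ℝ) ∂(jacobiMeasure d) := by
  rw [integral_polyOperator_mul_eq]
  have h := integral_polyOperator_mul_eq (d := d) q p
  simp only [mul_comm] at h ⊢
  exact h.symm

lemma integrable_poly [Fact (1 ≤ d)] (p : Polynomial ℝ) :
    Integrable (fun z : E => p.eval (z : ℝ)) (jacobiMeasure d) :=
  integrable_of_continuous (by fun_prop)

/-- Eigenpolynomials for different eigenvalues are orthogonal. -/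
lemma integral_mul_eq_zero_of_eigen [Fact (1 ≤ d)] {p q : Polynomial ℝ} {a b : ℝ} (hab : a ≠ b)
    (hp : polyOperator d p = Polynomial.C a * p) (hq : polyOperator d q = Polynomial.C b * q) :
    ∫ z : E, p.eval (z : ℝ) * q.eval (z : ℝ) ∂(jacobiMeasure d) = 0 := by
  have h := integral_polyOperator_symm (d := d) p q
  simp only [hp, hq, Polynomial.eval_mul, Polynomial.eval_C, mul_assoc, mul_left_comm _ b] at h
  rw [integral_const_mul, integral_const_mul] at h
  by_contra hne
  exact hab (mul_right_cancel₀ hne h)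

lemma integral_jacobiPoly_mul_of_ne [Fact (1 ≤ d)] {j k : ℕ} (hjk : j ≠ k) :
    ∫ z : E, (jacobiPoly d j).eval (z : ℝ) * (jacobiPoly d k).eval (z : ℝ) ∂(jacobiMeasure d) = 0 :=
  integral_mul_eq_zero_of_eigen
    (fun h => hjk (eigenvalue_strictMono.injective (neg_injective h)))
    (polyOperator_jacobiPoly j) (polyOperator_jacobiPoly k)

lemma integral_sq_poly_pos [Fact (1 ≤ d)] {p : Polynomial ℝ} (hp : p ≠ 0) :
    0 < ∫ z : E, p.eval (z : ℝ) ^ 2 ∂(jacobiMeasure d) := by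
  have hint : Integrable (fun z : E => p.eval (z : ℝ) ^ 2) (jacobiMeasure d) :=
    integrable_of_continuous ((p.continuous.comp continuous_subtype_val).pow 2)
  rw [integral_pos_iff_support_of_nonneg (fun z => sq_nonneg _) hint]
  have hfin : {z : E | p.eval (z : ℝ) = 0}.Finite := by
    refine Set.Finite.of_finite_image (f := fun z : E => (z : ℝ)) ?_
      (Subtype.val_injective.injOn)
    refine (p.rootSet_finite ℝ).subset ?_
    rintro _ ⟨z, hz, rfl⟩
    rw [Polynomial.mem_rootSet]
    exact ⟨hp, by simpa using hz⟩
  have h0 : jacobiMeasure d {z : E | p.eval (z : ℝ) = 0} = 0 := hfin.measure_zero _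
  have hs : Function.support (fun z : E => p.eval (z : ℝ) ^ 2) =
      {z : E | p.eval (z : ℝ) = 0}ᶜ := by
    ext z; simp
  rw [hs, (prob_compl_eq_one_iff hfin.measurableSet).2 h0]
  exact one_pos

/-- The squared `L²(μ)`-norm of `jacobiPoly d k`. -/
def normSq (d : ℝ) (k : ℕ) : ℝ := ∫ z : E, (jacobiPoly d k).eval (z : ℝ) ^ 2 ∂(jacobiMeasure d)

lemma jacobiPoly_ne_zero [Fact (1 ≤ d)] (k : ℕ) : jacobiPoly d k ≠ 0 := by
  intro h
  have := jacobiPoly_eval_one (d := d) k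
  simp [h] at this

lemma normSq_pos [Fact (1 ≤ d)] (k : ℕ) : 0 < normSq d k :=
  integral_sq_poly_pos (jacobiPoly_ne_zero k)

lemma normSq_zero [Fact (1 ≤ d)] : normSq d 0 = 1 := by
  simp [normSq, jacobiPoly_zero]

lemma integral_derivative_sq [Fact (1 ≤ d)] (k : ℕ) :
    ∫ z : E, (1 - (z : ℝ) ^ 2) * (jacobiPoly d k).derivative.eval (z : ℝ) ^ 2 ∂(jacobiMeasure d) =
      eigenvalue d k * normSq d k := by
  have h := integral_polyOperator_mul_eq (d := d) (jacobiPoly d k) (jacobiPoly d k)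
  simp only [polyOperator_jacobiPoly, Polynomial.eval_mul, Polynomial.eval_C, mul_assoc] at h
  rw [integral_const_mul] at h
  simp only [← sq] at h
  rw [normSq]
  linarith

/-- The primitive of `jacobiPoly d k` with respect to `μ`, from the eigenvalue equation. -/
lemma eigenvalue_mul_setIntegral_jacobiPoly [Fact (1 ≤ d)] (k : ℕ) (x : E) :
    eigenvalue d k * ∫ z in Set.Iic x, (jacobiPoly d k).eval (z : ℝ) ∂(jacobiMeasure d) =
      -(energyDensity d x * (jacobiPoly d k).derivative.eval (x : ℝ)) := by
  have h := integral_polyOperator_mul (d := d) (jacobiPoly d k) 1 x.2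
  rw [setIntegral_Iic_jacobiMeasure (fun y => (jacobiPoly d k).eval y)]
  simp only [polyOperator_jacobiPoly, Polynomial.eval_mul, Polynomial.eval_C, mul_assoc,
    Polynomial.eval_one, Polynomial.derivative_one, Polynomial.eval_zero, mul_zero, zero_mul,
    intervalIntegral.integral_zero, mul_one, add_zero] at h
  rw [intervalIntegral.integral_const_mul] at h
  linarith

/-! ### Uniform bounds for the Jacobi polynomials -/

lemma polyOperator_comp_neg (p : Polynomial ℝ) :
    polyOperator d (p.comp (-Polynomial.X)) = (polyOperator d p).comp (-Polynomial.X) := by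
  simp only [polyOperator, Polynomial.derivative_comp, Polynomial.derivative_neg,
    Polynomial.derivative_X, Polynomial.derivative_mul, Polynomial.derivative_one,
    Polynomial.sub_comp, Polynomial.mul_comp, Polynomial.pow_comp, Polynomial.X_comp,
    Polynomial.C_comp, Polynomial.one_comp, neg_zero, zero_mul]
  ring

/-- A polynomial with the eigenvalue of `jacobiPoly d k` is a multiple of it. -/
lemma eq_smul_jacobiPoly_of_eigen [Fact (1 ≤ d)] {p : Polynomial ℝ} {k : ℕ}
    (hp : polyOperator d p = Polynomial.C (-eigenvalue d k) * p) :
    ∃ c : ℝ, p = c • jacobiPoly d k := by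
  have hk := normSq_pos (d := d) k
  refine ⟨(∫ z : E, p.eval (z : ℝ) * (jacobiPoly d k).eval (z : ℝ) ∂(jacobiMeasure d)) /
    normSq d k, ?_⟩
  set c := (∫ z : E, p.eval (z : ℝ) * (jacobiPoly d k).eval (z : ℝ) ∂(jacobiMeasure d)) /
    normSq d k with hc
  set g := p - c • jacobiPoly d k with hg
  have hint : ∀ q r : Polynomial ℝ, Integrable (fun z : E => q.eval (z : ℝ) * r.eval (z : ℝ))
      (jacobiMeasure d) := fun q r => integrable_of_continuous (by fun_prop)
  have horth : ∀ j, ∫ z : E, g.eval (z : ℝ) * (jacobiPoly d j).eval (z : ℝ) ∂(jacobiMeasure d)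
      = 0 := by
    intro j
    simp only [hg, Polynomial.eval_sub, Polynomial.eval_smul, smul_eq_mul, sub_mul, mul_assoc]
    rw [integral_sub (hint _ _) ((hint _ _).const_mul c), integral_const_mul]
    rcases eq_or_ne j k with rfl | hjk
    · simp only [← sq]
      rw [← normSq, hc, div_mul_cancel₀ _ hk.ne', sub_self]
    · rw [integral_jacobiPoly_mul_of_ne hjk.symm, integral_mul_eq_zero_of_eigen _ hp
        (polyOperator_jacobiPoly j)]
      · simp
      · exact fun h => hjk (eigenvalue_strictMono.injective (neg_injective h)).symm
  have hall : ∀ r : Polynomial ℝ, ∫ z : E, g.eval (z : ℝ) * r.eval (z : ℝ) ∂(jacobiMeasure d)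
      = 0 := by
    intro r
    have hr : r ∈ Submodule.span ℝ (Set.range (jacobiPoly d)) := by
      rw [span_jacobiPoly]; trivial
    induction hr using Submodule.span_induction with
    | mem r hr => obtain ⟨j, rfl⟩ := hr; exact horth j
    | zero => simp
    | add r s _ _ hr hs =>
      simp only [Polynomial.eval_add, mul_add]
      rw [integral_add (hint _ _) (hint _ _), hr, hs, add_zero]
    | smul a r _ hr =>
      simp only [Polynomial.eval_smul, smul_eq_mul, mul_left_comm _ a]
      rw [integral_const_mul, hr, mul_zero]
  have hg0 : g = 0 := by
    by_contra hne
    have := integral_sq_poly_pos (d := d) hne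
    simp only [sq] at this
    exact this.ne' (hall g)
  exact sub_eq_zero.1 hg0

lemma sq_jacobiPoly_eval_neg_one [Fact (1 ≤ d)] (k : ℕ) :
    (jacobiPoly d k).eval (-1) ^ 2 = 1 := by
  obtain ⟨c, hc⟩ := eq_smul_jacobiPoly_of_eigen (d := d) (k := k)
    (p := (jacobiPoly d k).comp (-Polynomial.X)) (by
      rw [polyOperator_comp_neg, polyOperator_jacobiPoly, Polynomial.mul_comp, Polynomial.C_comp])
  have h1 := congrArg (Polynomial.eval 1) hc
  have h2 := congrArg (Polynomial.eval (-1)) hc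
  simp only [Polynomial.eval_comp, Polynomial.eval_neg, Polynomial.eval_X, Polynomial.eval_smul,
    jacobiPoly_eval_one, smul_eq_mul, mul_one, neg_neg] at h1 h2
  rw [h1] at h2 ⊢
  rw [sq, ← h2]

/-- The energy `λ_k q² + (1 - x²) q'²` of `q = jacobiPoly d k` is largest at the endpoints: by the
eigenvalue equation its derivative is `2 (d - 1) x q'²`. -/
lemma energy_le [Fact (1 ≤ d)] (k : ℕ) {x : ℝ} (hx : x ∈ Set.Icc (-1 : ℝ) 1) :
    eigenvalue d k * (jacobiPoly d k).eval x ^ 2 +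
      (1 - x ^ 2) * (jacobiPoly d k).derivative.eval x ^ 2 ≤ eigenvalue d k := by
  have hd : 1 ≤ d := Fact.out
  set q := jacobiPoly d k with hq
  set e : Polynomial ℝ := Polynomial.C (eigenvalue d k) * q ^ 2 +
    (1 - Polynomial.X ^ 2) * q.derivative ^ 2 with he
  have hev : ∀ y, e.eval y = eigenvalue d k * q.eval y ^ 2 +
      (1 - y ^ 2) * q.derivative.eval y ^ 2 := fun y => by simp [he]
  have hder : ∀ y, deriv (fun z => e.eval z) y = 2 * (d - 1) * y * q.derivative.eval y ^ 2 := by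
    intro y
    have h := congrArg (Polynomial.eval y) (polyOperator_jacobiPoly (d := d) k)
    rw [eval_polyOperator, ← hq] at h
    simp only [Polynomial.eval_mul, Polynomial.eval_C] at h
    rw [Polynomial.deriv]
    simp only [he, Polynomial.derivative_add, Polynomial.derivative_mul, Polynomial.derivative_C,
      Polynomial.derivative_pow, Polynomial.derivative_sub, Polynomial.derivative_one,
      Polynomial.derivative_X, Polynomial.eval_add, Polynomial.eval_mul, Polynomial.eval_sub,
      Polynomial.eval_pow, Polynomial.eval_C, Polynomial.eval_X, Polynomial.eval_zero,
      Polynomial.eval_one]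
    norm_num
    linear_combination 2 * q.derivative.eval y * h
  have hcont : Continuous fun z => e.eval z := by fun_prop
  have hdiff : Differentiable ℝ fun z => e.eval z := by fun_prop
  rw [← hev]
  rcases le_total 0 x with h0 | h0
  · have hmono : MonotoneOn (fun z => e.eval z) (Set.Icc 0 1) := by
      refine monotoneOn_of_deriv_nonneg (convex_Icc _ _) hcont.continuousOn
        hdiff.differentiableOn fun y hy => ?_
      rw [interior_Icc] at hy
      rw [hder]
      have := hy.1
      have := sub_nonneg.2 hd
      positivity
    have := hmono ⟨h0, hx.2⟩ (Set.right_mem_Icc.2 zero_le_one) hx.2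
    refine this.trans ?_
    simp only [hev, hq, jacobiPoly_eval_one]
    norm_num
  · have hanti : AntitoneOn (fun z => e.eval z) (Set.Icc (-1) 0) := by
      refine antitoneOn_of_deriv_nonpos (convex_Icc _ _) hcont.continuousOn
        hdiff.differentiableOn fun y hy => ?_
      rw [interior_Icc] at hy
      rw [hder]
      have h1 := hy.2
      have h2 := sub_nonneg.2 hd
      have : 0 ≤ 2 * (d - 1) * (-y) * q.derivative.eval y ^ 2 := by
        have : 0 ≤ -y := by linarith
        positivity
      linarith
    have := hanti (Set.left_mem_Icc.2 (by norm_num)) ⟨hx.1, h0⟩ hx.1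
    refine this.trans ?_
    simp only [hev, hq, sq_jacobiPoly_eval_neg_one]
    norm_num

lemma abs_jacobiPoly_le_one [Fact (1 ≤ d)] (k : ℕ) {x : ℝ} (hx : x ∈ Set.Icc (-1 : ℝ) 1) :
    |(jacobiPoly d k).eval x| ≤ 1 := by
  rcases Nat.eq_zero_or_pos k with rfl | hk
  · simp [jacobiPoly_zero]
  · have h := energy_le (d := d) k hx
    have hl := eigenvalue_pos (d := d) hk.ne'
    have h2 := mul_nonneg (one_sub_sq_nonneg hx)
      (sq_nonneg ((jacobiPoly d k).derivative.eval x))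
    rw [← sq_le_one_iff_abs_le_one]
    by_contra hc
    push Not at hc
    nlinarith

lemma one_sub_sq_mul_derivative_sq_le [Fact (1 ≤ d)] (k : ℕ) {x : ℝ}
    (hx : x ∈ Set.Icc (-1 : ℝ) 1) :
    (1 - x ^ 2) * (jacobiPoly d k).derivative.eval x ^ 2 ≤ eigenvalue d k := by
  have := energy_le (d := d) k hx
  have := mul_nonneg (eigenvalue_nonneg (d := d) k) (sq_nonneg ((jacobiPoly d k).eval x))
  linarith

/-- Jacobi polynomials are Lipschitz for the intrinsic distance. -/
lemma abs_jacobiPoly_sub_le [Fact (1 ≤ d)] (k : ℕ) (x y : E) :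
    |(jacobiPoly d k).eval (x : ℝ) - (jacobiPoly d k).eval (y : ℝ)| ≤
      √(eigenvalue d k) * rho x y := by
  have hder : ∀ θ : ℝ, HasDerivAt (fun θ => (jacobiPoly d k).eval (Real.cos θ))
      ((jacobiPoly d k).derivative.eval (Real.cos θ) * -Real.sin θ) θ := fun θ =>
    ((jacobiPoly d k).hasDerivAt _).comp θ (Real.hasDerivAt_cos θ)
  have hlip : LipschitzWith (Real.toNNReal √(eigenvalue d k))
      (fun θ => (jacobiPoly d k).eval (Real.cos θ)) := by
    refine lipschitzWith_of_nnnorm_deriv_le (fun θ => (hder θ).differentiableAt) fun θ => ?_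
    rw [(hder θ).deriv, ← NNReal.coe_le_coe, coe_nnnorm, Real.coe_toNNReal _ (Real.sqrt_nonneg _),
      Real.norm_eq_abs]
    refine Real.abs_le_sqrt ?_
    have := one_sub_sq_mul_derivative_sq_le (d := d) k
      (x := Real.cos θ) ⟨Real.neg_one_le_cos θ, Real.cos_le_one θ⟩
    rw [← Real.sin_sq] at this
    linarith
  have h := hlip.dist_le_mul (Real.arccos x) (Real.arccos y)
  rwa [Real.dist_eq, Real.dist_eq, Real.cos_arccos x.2.1 x.2.2, Real.cos_arccos y.2.1 y.2.2,
    Real.coe_toNNReal _ (Real.sqrt_nonneg _)] at h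

/-! ### The heat trace -/

lemma rho_nonneg (x y : E) : 0 ≤ rho x y := abs_nonneg _

/-- Christoffel function bound: the reproducing kernel `K = ∑_{k ∈ I} q_k / ‖q_k‖²` at the
endpoint `1` stays above half its maximum `S = K(1) = ‖K‖²` on the ball of radius `1 / (2√s)`, so
that `S ≥ (S / 2)² μ(ball)`. -/
lemma exists_sum_inv_normSq_le (d : ℝ) [Fact (1 ≤ d)] : ∃ C : ℝ, 0 < C ∧
    ∀ (s : ℝ) (I : Finset ℕ), 1 ≤ s →
    (∀ k ∈ I, eigenvalue d k ≤ s) → ∑ k ∈ I, (normSq d k)⁻¹ ≤ C * s ^ (d / 2) := by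
  obtain ⟨c, hc, hball⟩ := exists_le_measure_ball (d := d)
  refine ⟨4 / c * 2 ^ d, by positivity, fun s I hs hI => ?_⟩
  have hs0 : 0 < √s := Real.sqrt_pos.2 (by linarith)
  have hs1 : 1 ≤ √s := Real.one_le_sqrt.2 hs
  set S := ∑ k ∈ I, (normSq d k)⁻¹ with hS
  set K : Polynomial ℝ := ∑ k ∈ I, Polynomial.C (normSq d k)⁻¹ * jacobiPoly d k with hK
  have hKev : ∀ x, K.eval x = ∑ k ∈ I, (normSq d k)⁻¹ * (jacobiPoly d k).eval x := fun x => by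
    simp [hK, Polynomial.eval_finsetSum]
  have hint : ∀ j k, Integrable (fun z : E => (normSq d j)⁻¹ * (jacobiPoly d j).eval (z : ℝ) *
      ((normSq d k)⁻¹ * (jacobiPoly d k).eval (z : ℝ))) (jacobiMeasure d) := fun j k =>
    integrable_of_continuous (by fun_prop)
  have hKint : ∫ z : E, K.eval (z : ℝ) ^ 2 ∂(jacobiMeasure d) = S := by
    simp only [hKev, sq, Finset.sum_mul_sum]
    rw [integral_finsetSum _ fun j _ => integrable_finsetSum _ fun k _ => hint j k]
    refine Finset.sum_congr rfl fun j hj => ?_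
    rw [integral_finsetSum _ fun k _ => hint j k, Finset.sum_eq_single j]
    · have : ∀ z : E, (normSq d j)⁻¹ * (jacobiPoly d j).eval (z : ℝ) *
          ((normSq d j)⁻¹ * (jacobiPoly d j).eval (z : ℝ)) =
          ((normSq d j)⁻¹ * (normSq d j)⁻¹) * (jacobiPoly d j).eval (z : ℝ) ^ 2 := fun z => by ring
      simp only [this]
      rw [integral_const_mul, ← normSq, mul_assoc, inv_mul_cancel₀ (normSq_pos j).ne', mul_one]
    · intro k _ hkj
      have : ∀ z : E, (normSq d j)⁻¹ * (jacobiPoly d j).eval (z : ℝ) *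
          ((normSq d k)⁻¹ * (jacobiPoly d k).eval (z : ℝ)) =
          ((normSq d j)⁻¹ * (normSq d k)⁻¹) *
            ((jacobiPoly d j).eval (z : ℝ) * (jacobiPoly d k).eval (z : ℝ)) := fun z => by ring
      simp only [this]
      rw [integral_const_mul, integral_jacobiPoly_mul_of_ne hkj.symm, mul_zero]
    · exact fun h => absurd hj h
  have hS0 : 0 ≤ S := Finset.sum_nonneg fun k _ => inv_nonneg.2 (normSq_pos k).le
  set r := 1 / (2 * √s) with hr
  have hr0 : 0 < r := by positivity
  have hr1 : r ≤ 1 := by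
    rw [hr, div_le_one (by positivity)]; linarith
  have hKlow : ∀ z ∈ {z : E | Real.arccos z ≤ r}, S / 2 ≤ K.eval (z : ℝ) := by
    intro z hz
    have hz' : Real.arccos z ≤ r := hz
    have hterm : ∀ k ∈ I, (normSq d k)⁻¹ * (1 / 2) ≤
        (normSq d k)⁻¹ * (jacobiPoly d k).eval (z : ℝ) := by
      intro k hk
      refine mul_le_mul_of_nonneg_left ?_ (inv_nonneg.2 (normSq_pos k).le)
      have h := abs_jacobiPoly_sub_le (d := d) k ⟨1, by norm_num, le_rfl⟩ z
      simp only [jacobiPoly_eval_one, rho, Real.arccos_one, zero_sub, abs_neg,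
        abs_of_nonneg (Real.arccos_nonneg _)] at h
      have h1 : √(eigenvalue d k) * Real.arccos z ≤ √s * r :=
        mul_le_mul (Real.sqrt_le_sqrt (hI k hk)) hz' (Real.arccos_nonneg _) hs0.le
      have h2 : √s * r = 1 / 2 := by rw [hr]; field_simp
      have := le_abs_self (1 - (jacobiPoly d k).eval (z : ℝ))
      linarith
    rw [hKev]
    calc S / 2 = ∑ k ∈ I, (normSq d k)⁻¹ * (1 / 2) := by rw [← Finset.sum_mul, ← hS]; ring
      _ ≤ _ := Finset.sum_le_sum hterm
  have hmeas : MeasurableSet {z : E | Real.arccos z ≤ r} :=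
    measurableSet_le (by fun_prop) measurable_const
  have hlow : (S / 2) ^ 2 * (c * r ^ d) ≤ S := by
    have hKi : Integrable (fun z : E => K.eval (z : ℝ) ^ 2) (jacobiMeasure d) :=
      integrable_of_continuous ((K.continuous.comp continuous_subtype_val).pow 2)
    calc (S / 2) ^ 2 * (c * r ^ d)
        ≤ (S / 2) ^ 2 * (jacobiMeasure d).real {z : E | Real.arccos z ≤ r} :=
          mul_le_mul_of_nonneg_left (hball r hr0 hr1) (sq_nonneg _)
      _ ≤ ∫ z in {z : E | Real.arccos z ≤ r}, K.eval (z : ℝ) ^ 2 ∂(jacobiMeasure d) :=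
          setIntegral_ge_of_const_le_real hmeas (measure_ne_top _ _)
            (fun z hz => pow_le_pow_left₀ (by linarith) (hKlow z hz) 2) hKi.integrableOn
      _ ≤ ∫ z : E, K.eval (z : ℝ) ^ 2 ∂(jacobiMeasure d) :=
          setIntegral_le_integral hKi (ae_of_all _ fun z => sq_nonneg _)
      _ = S := hKint
  have hrd : r ^ d * (2 ^ d * s ^ (d / 2)) = 1 := by
    have h1 : s ^ (d / 2) = √s ^ d := by
      rw [Real.sqrt_eq_rpow, ← Real.rpow_mul (by linarith)]; congr 1; ring
    rw [h1, ← Real.mul_rpow (by norm_num) hs0.le, ← Real.mul_rpow hr0.le (by positivity), hr,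
      one_div_mul_cancel (by positivity), Real.one_rpow]
  have hrd0 : 0 < r ^ d := by positivity
  rcases hS0.eq_or_lt with h0 | h0
  · rw [← h0]; positivity
  · have h1 : S * (c * r ^ d) ≤ 4 := by
      by_contra hcon
      push Not at hcon
      nlinarith
    have h2 : S = S * (c * r ^ d) * (1 / c * (2 ^ d * s ^ (d / 2))) := by
      calc S = S * (r ^ d * (2 ^ d * s ^ (d / 2))) := by rw [hrd, mul_one]
        _ = _ := by field_simp
    rw [h2]
    calc _ ≤ 4 * (1 / c * (2 ^ d * s ^ (d / 2))) :=
          mul_le_mul_of_nonneg_right h1 (by positivity)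
      _ = _ := by ring

/-- The `k`-th coefficient `e^{-λ_k t} / ‖q_k‖²` of the heat kernel in terms of the products
`q_k(x) q_k(y)`. -/
def heatCoeff (d t : ℝ) (k : ℕ) : ℝ := Real.exp (-(eigenvalue d k * t)) * (normSq d k)⁻¹

/-- The value `∑_k e^{-λ_k t} / ‖q_k‖²` of the heat kernel at the endpoint, its largest value. -/
def heatTrace (d t : ℝ) : ℝ := ∑' k, heatCoeff d t k

lemma heatCoeff_pos [Fact (1 ≤ d)] (t : ℝ) (k : ℕ) : 0 < heatCoeff d t k :=
  mul_pos (Real.exp_pos _) (inv_pos.2 (normSq_pos k))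

lemma summable_rpow_mul_exp_neg (a : ℝ) :
    Summable fun j : ℕ => ((j : ℝ) + 1) ^ a * Real.exp (-j) := by
  have h := (summable_nat_add_iff 1).2
    (Real.summable_pow_mul_exp_neg_nat_mul ⌈a⌉₊ (zero_lt_one (α := ℝ)))
  refine Summable.of_nonneg_of_le (fun j => by positivity) (fun j => ?_) (h.mul_left (Real.exp 1))
  have h1 : ((j : ℝ) + 1) ^ a ≤ ((j : ℝ) + 1) ^ ⌈a⌉₊ := by
    rw [← Real.rpow_natCast]
    exact Real.rpow_le_rpow_of_exponent_le (by linarith [(j.cast_nonneg : (0 : ℝ) ≤ j)])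
      (Nat.le_ceil a)
  calc _ ≤ ((j : ℝ) + 1) ^ ⌈a⌉₊ * Real.exp (-j) :=
        mul_le_mul_of_nonneg_right h1 (Real.exp_pos _).le
    _ = _ := by
      push_cast
      rw [mul_left_comm, ← Real.exp_add]
      congr 2
      ring

lemma exists_sum_heatCoeff_le (d : ℝ) [Fact (1 ≤ d)] : ∃ C : ℝ, 0 < C ∧
    ∀ (t : ℝ) (I : Finset ℕ), 0 < t → t < 1 → ∑ k ∈ I, heatCoeff d t k ≤ C * t ^ (-(d / 2)) := by
  have hd : 1 ≤ d := Fact.out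
  obtain ⟨C, hC, hsum⟩ := exists_sum_inv_normSq_le d
  have hs := summable_rpow_mul_exp_neg (d / 2)
  set A := ∑' j : ℕ, ((j : ℝ) + 1) ^ (d / 2) * Real.exp (-j) with hA
  have hA0 : 0 < A := hs.tsum_pos (fun j => by positivity) 0 (by positivity)
  refine ⟨C * A, by positivity, fun t I ht ht1 => ?_⟩
  -- group the eigenvalues according to the integer part of `λ_k t`
  have hfib := Finset.sum_fiberwise_of_maps_to (s := I)
    (t := I.image fun k => ⌊eigenvalue d k * t⌋₊) (g := fun k => ⌊eigenvalue d k * t⌋₊)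
    (fun k hk => Finset.mem_image_of_mem _ hk) (heatCoeff d t)
  rw [← hfib]
  have hj : ∀ j : ℕ, ∑ k ∈ I with ⌊eigenvalue d k * t⌋₊ = j, heatCoeff d t k ≤
      C * t ^ (-(d / 2)) * (((j : ℝ) + 1) ^ (d / 2) * Real.exp (-j)) := by
    intro j
    have h1 : ∑ k ∈ I with ⌊eigenvalue d k * t⌋₊ = j, heatCoeff d t k ≤
        ∑ k ∈ I with ⌊eigenvalue d k * t⌋₊ = j, Real.exp (-j) * (normSq d k)⁻¹ := by
      refine Finset.sum_le_sum fun k hk => mul_le_mul_of_nonneg_right ?_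
        (inv_nonneg.2 (normSq_pos k).le)
      have h2 := (Finset.mem_filter.1 hk).2
      have h3 := Nat.floor_le (mul_nonneg (eigenvalue_nonneg (d := d) k) ht.le)
      rw [h2] at h3
      exact Real.exp_le_exp.2 (by linarith)
    have h4 := hsum ((j + 1) / t) {k ∈ I | ⌊eigenvalue d k * t⌋₊ = j}
      (by rw [le_div_iff₀ ht]; linarith [(j.cast_nonneg : (0 : ℝ) ≤ j)]) (by
        intro k hk
        have h2 := (Finset.mem_filter.1 hk).2
        have h3 := Nat.lt_floor_add_one (eigenvalue d k * t)
        rw [h2] at h3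
        rw [le_div_iff₀ ht]
        exact h3.le)
    refine h1.trans ?_
    rw [← Finset.mul_sum]
    refine (mul_le_mul_of_nonneg_left h4 (Real.exp_pos _).le).trans_eq ?_
    rw [Real.div_rpow (by positivity) ht.le, Real.rpow_neg ht.le]
    ring
  refine (Finset.sum_le_sum fun j _ => hj j).trans ?_
  rw [← Finset.mul_sum]
  have h5 : C * A * t ^ (-(d / 2)) = C * t ^ (-(d / 2)) * A := by ring
  rw [h5]
  exact mul_le_mul_of_nonneg_left (hs.sum_le_tsum _ fun j _ => by positivity) (by positivity)

lemma summable_heatCoeff [Fact (1 ≤ d)] {t : ℝ} (ht : 0 < t) (ht1 : t < 1) :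
    Summable (heatCoeff d t) := by
  obtain ⟨C, -, h⟩ := exists_sum_heatCoeff_le d
  exact summable_of_sum_le (fun k => (heatCoeff_pos t k).le) fun I => h t I ht ht1

/-- Ultracontractivity: the heat trace is of order `t^{-d/2}`. -/
lemma exists_heatTrace_le (d : ℝ) [Fact (1 ≤ d)] : ∃ C : ℝ, 0 < C ∧
    ∀ t : ℝ, 0 < t → t < 1 → heatTrace d t ≤ C * t ^ (-(d / 2)) := by
  obtain ⟨C, hC, h⟩ := exists_sum_heatCoeff_le d
  exact ⟨C, hC, fun t ht ht1 => (summable_heatCoeff ht ht1).tsum_le_of_sum_le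
    fun I => h t I ht ht1⟩

lemma one_le_heatTrace [Fact (1 ≤ d)] {t : ℝ} (ht : 0 < t) (ht1 : t < 1) : 1 ≤ heatTrace d t := by
  have h := (summable_heatCoeff (d := d) ht ht1).le_tsum 0 fun k _ => (heatCoeff_pos t k).le
  simpa [heatTrace, heatCoeff, eigenvalue_zero, normSq_zero] using h

lemma heatCoeff_mul_sqrt_le [Fact (1 ≤ d)] {t : ℝ} (ht : 0 < t) (k : ℕ) :
    heatCoeff d t k * √(eigenvalue d k) ≤ 2 / t * heatCoeff d (t / 2) k := by
  have hl := eigenvalue_nonneg (d := d) k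
  have h1 : √(eigenvalue d k) ≤ eigenvalue d k := by
    rcases Nat.eq_zero_or_pos k with rfl | hk
    · simp [eigenvalue_zero]
    · have h2 : (1 : ℝ) ≤ k := by exact_mod_cast hk
      have h3 := sq_le_eigenvalue (d := d) k
      rw [Real.sqrt_le_left hl]
      have h4 : 1 ≤ eigenvalue d k := by nlinarith
      nlinarith
  have h2 := Real.add_one_le_exp (eigenvalue d k * (t / 2))
  have h3 : √(eigenvalue d k) ≤ 2 / t * Real.exp (eigenvalue d k * (t / 2)) := by
    rw [div_mul_eq_mul_div, le_div_iff₀ ht]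
    nlinarith
  have h4 : Real.exp (-(eigenvalue d k * (t / 2))) =
      Real.exp (-(eigenvalue d k * t)) * Real.exp (eigenvalue d k * (t / 2)) := by
    rw [← Real.exp_add]; congr 1; ring
  unfold heatCoeff
  rw [h4]
  have h5 : 0 ≤ Real.exp (-(eigenvalue d k * t)) * (normSq d k)⁻¹ := (heatCoeff_pos t k).le
  calc _ ≤ Real.exp (-(eigenvalue d k * t)) * (normSq d k)⁻¹ *
        (2 / t * Real.exp (eigenvalue d k * (t / 2))) := mul_le_mul_of_nonneg_left h3 h5
    _ = _ := by ring

/-! ### The heat kernel: convergence, continuity, Lipschitz bound -/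

lemma J_eq (k : ℕ) (x : E) : J d k x = (jacobiPoly d k).eval (x : ℝ) / √(normSq d k) := rfl

lemma J_mul_J [Fact (1 ≤ d)] (k : ℕ) (x y : E) : J d k x * J d k y =
    (normSq d k)⁻¹ * ((jacobiPoly d k).eval (x : ℝ) * (jacobiPoly d k).eval (y : ℝ)) := by
  rw [J_eq, J_eq, div_mul_div_comm, Real.mul_self_sqrt (normSq_pos k).le, div_eq_inv_mul]

lemma exp_mul_J_mul_J [Fact (1 ≤ d)] (t : ℝ) (k : ℕ) (x y : E) :
    Real.exp (-(eigenvalue d k * t)) * J d k x * J d k y =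
    heatCoeff d t k * ((jacobiPoly d k).eval (x : ℝ) * (jacobiPoly d k).eval (y : ℝ)) := by
  rw [mul_assoc, J_mul_J, heatCoeff, mul_assoc]

lemma heatKernel_eq [Fact (1 ≤ d)] (t : ℝ) (x y : E) : heatKernel d t x y =
    ∑' k, heatCoeff d t k * ((jacobiPoly d k).eval (x : ℝ) * (jacobiPoly d k).eval (y : ℝ)) := by
  simp only [heatKernel, exp_mul_J_mul_J]

lemma heatKernel_comm (t : ℝ) (x y : E) : heatKernel d t x y = heatKernel d t y x := by
  simp only [heatKernel, mul_right_comm]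

lemma continuous_J (k : ℕ) : Continuous (J d k) := by
  unfold J
  fun_prop

lemma abs_jacobiPoly_mul_le_one [Fact (1 ≤ d)] (k : ℕ) (x y : E) :
    |(jacobiPoly d k).eval (x : ℝ) * (jacobiPoly d k).eval (y : ℝ)| ≤ 1 := by
  rw [abs_mul]
  exact mul_le_one₀ (abs_jacobiPoly_le_one k x.2) (abs_nonneg _) (abs_jacobiPoly_le_one k y.2)

lemma norm_heat_term_le [Fact (1 ≤ d)] (t : ℝ) (k : ℕ) (x y : E) :
    ‖heatCoeff d t k * ((jacobiPoly d k).eval (x : ℝ) * (jacobiPoly d k).eval (y : ℝ))‖ ≤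
      heatCoeff d t k := by
  rw [norm_mul, Real.norm_of_nonneg (heatCoeff_pos t k).le, Real.norm_eq_abs]
  exact mul_le_of_le_one_right (heatCoeff_pos t k).le (abs_jacobiPoly_mul_le_one k x y)

lemma summable_heat_term [Fact (1 ≤ d)] {t : ℝ} (ht : 0 < t) (ht1 : t < 1) (x y : E) :
    Summable fun k => heatCoeff d t k *
      ((jacobiPoly d k).eval (x : ℝ) * (jacobiPoly d k).eval (y : ℝ)) :=
  Summable.of_norm_bounded (summable_heatCoeff ht ht1) fun k => norm_heat_term_le t k x y

lemma abs_heatKernel_le [Fact (1 ≤ d)] {t : ℝ} (ht : 0 < t) (ht1 : t < 1) (x y : E) :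
    |heatKernel d t x y| ≤ heatTrace d t := by
  rw [heatKernel_eq]
  exact tsum_of_norm_bounded (summable_heatCoeff ht ht1).hasSum fun k => norm_heat_term_le t k x y

lemma continuous_heatKernel [Fact (1 ≤ d)] {t : ℝ} (ht : 0 < t) (ht1 : t < 1) :
    Continuous fun p : E × E => heatKernel d t p.1 p.2 := by
  simp only [heatKernel_eq]
  exact continuous_tsum (fun k => by fun_prop) (summable_heatCoeff ht ht1)
    fun k p => norm_heat_term_le t k p.1 p.2

lemma continuous_heatKernel_right [Fact (1 ≤ d)] {t : ℝ} (ht : 0 < t) (ht1 : t < 1) (x : E) :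
    Continuous fun y : E => heatKernel d t x y :=
  (continuous_heatKernel ht ht1).comp (Continuous.prodMk_right x)

lemma continuous_heatKernel_left [Fact (1 ≤ d)] {t : ℝ} (ht : 0 < t) (ht1 : t < 1) (y : E) :
    Continuous fun x : E => heatKernel d t x y :=
  (continuous_heatKernel ht ht1).comp (Continuous.prodMk_left y)

lemma abs_heatKernel_sub_le [Fact (1 ≤ d)] {t : ℝ} (ht : 0 < t) (ht1 : t < 1) (x y z : E) :
    |heatKernel d t x y - heatKernel d t x z| ≤ 2 / t * heatTrace d (t / 2) * rho y z := by
  rw [heatKernel_eq, heatKernel_eq, ← (summable_heat_term ht ht1 x y).tsum_sub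
    (summable_heat_term ht ht1 x z), ← Real.norm_eq_abs]
  have hs := (summable_heatCoeff (d := d) (half_pos ht) (by linarith)).hasSum
  refine tsum_of_norm_bounded ((hs.mul_left (2 / t)).mul_right (rho y z)) fun k => ?_
  rw [← mul_sub, ← mul_sub, norm_mul, norm_mul, Real.norm_of_nonneg (heatCoeff_pos t k).le,
    Real.norm_eq_abs, Real.norm_eq_abs]
  have h1 := abs_jacobiPoly_le_one (d := d) k x.2
  have h2 := abs_jacobiPoly_sub_le (d := d) k y z
  calc _ ≤ heatCoeff d t k * (1 * (√(eigenvalue d k) * rho y z)) := by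
        have := (heatCoeff_pos (d := d) t k).le
        gcongr
    _ = heatCoeff d t k * √(eigenvalue d k) * rho y z := by ring
    _ ≤ _ := mul_le_mul_of_nonneg_right (heatCoeff_mul_sqrt_le ht k) (rho_nonneg _ _)

/-- Termwise integration of the heat kernel. -/
lemma hasSum_integral_heatKernel_mul [Fact (1 ≤ d)] {t : ℝ} (ht : 0 < t) (ht1 : t < 1) (x : E)
    {f : E → ℝ} (hf : Integrable f (jacobiMeasure d)) :
    HasSum (fun k => heatCoeff d t k * (jacobiPoly d k).eval (x : ℝ) *
        ∫ y : E, (jacobiPoly d k).eval (y : ℝ) * f y ∂(jacobiMeasure d))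
      (∫ y, heatKernel d t x y * f y ∂(jacobiMeasure d)) := by
  set F : ℕ → E → ℝ := fun k y => heatCoeff d t k *
    ((jacobiPoly d k).eval (x : ℝ) * (jacobiPoly d k).eval (y : ℝ)) * f y with hF
  have hFle : ∀ k y, ‖F k y‖ ≤ heatCoeff d t k * ‖f y‖ := fun k y => by
    simp only [hF]
    rw [norm_mul]
    exact mul_le_mul_of_nonneg_right (norm_heat_term_le t k x y) (norm_nonneg _)
  have hFi : ∀ k, Integrable (F k) (jacobiMeasure d) := fun k => by
    refine (hf.norm.const_mul (heatCoeff d t k)).mono' ?_ (ae_of_all _ (hFle k))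
    exact (Continuous.aestronglyMeasurable (by fun_prop)).mul hf.1
  have hs := hasSum_integral_of_summable_integral_norm hFi (by
    refine Summable.of_nonneg_of_le (fun k => integral_nonneg fun y => norm_nonneg (F k y))
      (fun k => (integral_mono (hFi k).norm (hf.norm.const_mul _) (hFle k)).trans_eq
        (integral_const_mul _ _)) ((summable_heatCoeff ht ht1).mul_right _))
  have h1 : ∀ k, ∫ y, F k y ∂(jacobiMeasure d) = heatCoeff d t k * (jacobiPoly d k).eval (x : ℝ) *
      ∫ y : E, (jacobiPoly d k).eval (y : ℝ) * f y ∂(jacobiMeasure d) := fun k => by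
    rw [← integral_const_mul]
    simp only [hF]
    congr 1
    ext y
    ring
  have h2 : ∀ y, ∑' k, F k y = heatKernel d t x y * f y := fun y => by
    rw [heatKernel_eq, hF, tsum_mul_right]
  simp only [h1, h2] at hs
  exact hs

lemma integral_jacobiPoly_eq_zero [Fact (1 ≤ d)] {k : ℕ} (hk : k ≠ 0) :
    ∫ y : E, (jacobiPoly d k).eval (y : ℝ) ∂(jacobiMeasure d) = 0 := by
  simpa [jacobiPoly_zero] using integral_jacobiPoly_mul_of_ne (d := d) hk

lemma integral_heatKernel_right [Fact (1 ≤ d)] {t : ℝ} (ht : 0 < t) (ht1 : t < 1) (x : E) :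
    ∫ y, heatKernel d t x y ∂(jacobiMeasure d) = 1 := by
  have h := hasSum_integral_heatKernel_mul (d := d) ht ht1 x (integrable_const (1 : ℝ))
  simp only [mul_one] at h
  refine h.unique ?_
  convert! hasSum_single (f := fun k => heatCoeff d t k * (jacobiPoly d k).eval (x : ℝ) *
        ∫ y : E, (jacobiPoly d k).eval (y : ℝ) ∂(jacobiMeasure d)) 0 ?_ using 1
  · simp [heatCoeff, jacobiPoly_zero, eigenvalue_zero, normSq_zero]
  · intro k hk
    rw [integral_jacobiPoly_eq_zero hk, mul_zero]

lemma integral_heatKernel_left [Fact (1 ≤ d)] {t : ℝ} (ht : 0 < t) (ht1 : t < 1) (y : E) :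
    ∫ x, heatKernel d t x y ∂(jacobiMeasure d) = 1 := by
  simp only [heatKernel_comm t _ y, integral_heatKernel_right ht ht1]

/-! ### The minimum principle and positivity of the heat kernel -/

lemma nonneg_of_nonneg_on_Ioo {f : ℝ → ℝ} (hf : Continuous f) {a b : ℝ} (hab : a < b)
    (h : ∀ x ∈ Set.Ioo a b, 0 ≤ f x) : ∀ x ∈ Set.Icc a b, 0 ≤ f x := by
  intro x hx
  rw [← closure_Ioo hab.ne] at hx
  exact closure_minimal h (isClosed_le continuous_const hf) hx

/-- The Jacobi operator is nonnegative at a minimum over `[-1, 1]`, endpoints included. -/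
lemma polyOperator_nonneg_of_isMin (hd : 0 < d) (p : Polynomial ℝ) {a : ℝ}
    (ha : a ∈ Set.Icc (-1 : ℝ) 1) (hmin : ∀ x ∈ Set.Icc (-1 : ℝ) 1, p.eval a ≤ p.eval x) :
    0 ≤ (polyOperator d p).eval a := by
  obtain ⟨r, hr⟩ : Polynomial.X - Polynomial.C a ∣ p - Polynomial.C (p.eval a) :=
    Polynomial.dvd_iff_isRoot.2 (by simp)
  have hp : p = (Polynomial.X - Polynomial.C a) * r + Polynomial.C (p.eval a) := by
    rw [← hr]; ring
  have hrx : ∀ x, p.eval x - p.eval a = (x - a) * r.eval x := fun x => by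
    have := congrArg (Polynomial.eval x) hr
    simpa using this
  have h1 : p.derivative.eval a = r.eval a := by
    rw [hp]; simp
  have h2 : p.derivative.derivative.eval a = 2 * r.derivative.eval a := by
    rw [hp]; simp; ring
  rw [eval_polyOperator, h1, h2]
  have hright : a < 1 → 0 ≤ r.eval a := fun h =>
    nonneg_of_nonneg_on_Ioo r.continuous h (fun x hx => by
      have h3 := hmin x ⟨ha.1.trans hx.1.le, hx.2.le⟩
      have h4 := hrx x
      exact nonneg_of_mul_nonneg_right (by linarith) (sub_pos.2 hx.1)) a ⟨le_rfl, h.le⟩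
  have hleft : -1 < a → r.eval a ≤ 0 := fun h => by
    have := nonneg_of_nonneg_on_Ioo (f := fun x => -r.eval x) (by fun_prop) h (fun x hx => by
      have h3 := hmin x ⟨hx.1.le, hx.2.le.trans ha.2⟩
      have h4 := hrx x
      have h5 : 0 ≤ (a - x) * -r.eval x := by linarith
      exact nonneg_of_mul_nonneg_right h5 (sub_pos.2 hx.2)) a ⟨h.le, le_rfl⟩
    linarith
  rcases ha.1.eq_or_lt with h | h
  · have := hright (by linarith)
    rw [← h] at this ⊢
    nlinarith
  rcases ha.2.eq_or_lt with h' | h'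
  · have := hleft h
    rw [h'] at this ⊢
    nlinarith
  have hr0 : r.eval a = 0 := le_antisymm (hleft h) (hright h')
  obtain ⟨s, hs⟩ : Polynomial.X - Polynomial.C a ∣ r := Polynomial.dvd_iff_isRoot.2 hr0
  have h3 : r.derivative.eval a = s.eval a := by rw [hs]; simp
  have h4 : 0 ≤ s.eval a :=
    nonneg_of_nonneg_on_Ioo s.continuous h' (fun x hx => by
      have h3 := hmin x ⟨ha.1.trans hx.1.le, hx.2.le⟩
      have h4 := hrx x
      have h5 : r.eval x = (x - a) * s.eval x := by
        have := congrArg (Polynomial.eval x) hs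
        simpa using this
      have h6 := sub_pos.2 hx.1
      rw [h5, ← mul_assoc] at h4
      exact nonneg_of_mul_nonneg_right (by linarith) (mul_pos h6 h6)) a ⟨le_rfl, h'.le⟩
  rw [hr0, h3]
  have := mul_nonneg (one_sub_sq_nonneg ha) h4
  linarith

/-- The resolvent `(1 - ε L)⁻¹` preserves positivity. -/
lemma nonneg_of_sub_polyOperator_nonneg (hd : 0 < d) {ε : ℝ} (hε : 0 ≤ ε) (p : Polynomial ℝ)
    (h : ∀ x ∈ Set.Icc (-1 : ℝ) 1, 0 ≤ p.eval x - ε * (polyOperator d p).eval x) :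
    ∀ x ∈ Set.Icc (-1 : ℝ) 1, 0 ≤ p.eval x := by
  obtain ⟨a, ha, hmin⟩ := isCompact_Icc.exists_isMinOn (Set.nonempty_Icc.2 (by norm_num))
    (p.continuous.continuousOn (s := Set.Icc (-1 : ℝ) 1))
  intro x hx
  have h1 := polyOperator_nonneg_of_isMin hd p ha fun x hx => hmin hx
  have h2 := h a ha
  have h3 : p.eval a ≤ p.eval x := hmin hx
  nlinarith

lemma eval_polyOperator_sum [Fact (1 ≤ d)] (s : Finset ℕ) (c : ℕ → ℝ) (x : ℝ) :
    (polyOperator d (∑ k ∈ s, Polynomial.C (c k) * jacobiPoly d k)).eval x =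
      ∑ k ∈ s, -eigenvalue d k * c k * (jacobiPoly d k).eval x := by
  classical
  induction s using Finset.induction_on with
  | empty => simp [polyOperator]
  | insert k s hk ih =>
    rw [Finset.sum_insert hk, Finset.sum_insert hk, ← ih]
    have h := congrArg (Polynomial.eval x) (polyOperator_jacobiPoly (d := d) k)
    simp only [Polynomial.eval_mul, Polynomial.eval_C] at h
    simp only [eval_polyOperator, Polynomial.derivative_add, Polynomial.derivative_C_mul,
      Polynomial.eval_add, Polynomial.eval_mul, Polynomial.eval_C] at h ⊢
    linear_combination c k * h

/-- The semigroup `e^{tL} = lim (1 - (t/n) L)^{-n}` preserves positivity of polynomials. -/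
lemma sum_exp_mul_nonneg [Fact (1 ≤ d)] (s : Finset ℕ) (c : ℕ → ℝ) {t : ℝ} (ht : 0 ≤ t)
    (h : ∀ x ∈ Set.Icc (-1 : ℝ) 1, 0 ≤ ∑ k ∈ s, c k * (jacobiPoly d k).eval x) {x : ℝ}
    (hx : x ∈ Set.Icc (-1 : ℝ) 1) :
    0 ≤ ∑ k ∈ s, Real.exp (-(eigenvalue d k * t)) * (c k * (jacobiPoly d k).eval x) := by
  have hd : 1 ≤ d := Fact.out
  have hiter : ∀ ε : ℝ, 0 ≤ ε → ∀ n : ℕ, ∀ x ∈ Set.Icc (-1 : ℝ) 1,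
      0 ≤ ∑ k ∈ s, ((1 + eigenvalue d k * ε) ^ n)⁻¹ * (c k * (jacobiPoly d k).eval x) := by
    intro ε hε n
    induction n with
    | zero => simpa using h
    | succ n ih =>
      have key := nonneg_of_sub_polyOperator_nonneg (d := d) (by linarith) hε
        (∑ k ∈ s, Polynomial.C (((1 + eigenvalue d k * ε) ^ (n + 1))⁻¹ * c k) * jacobiPoly d k)
        (fun x hx => by
          rw [eval_polyOperator_sum, Polynomial.eval_finsetSum, Finset.mul_sum,
            ← Finset.sum_sub_distrib]
          refine (ih x hx).trans_eq (Finset.sum_congr rfl fun k _ => ?_)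
          have h1 : 1 + eigenvalue d k * ε ≠ 0 := by
            have := mul_nonneg (eigenvalue_nonneg (d := d) k) hε
            positivity
          simp only [Polynomial.eval_mul, Polynomial.eval_C]
          rw [pow_succ]
          field_simp
          ring)
      intro x hx
      refine (key x hx).trans_eq ?_
      simp only [Polynomial.eval_finsetSum, Polynomial.eval_mul, Polynomial.eval_C, mul_assoc]
  have hlim : Tendsto (fun n : ℕ => ∑ k ∈ s, ((1 + eigenvalue d k * (t / n)) ^ n)⁻¹ *
      (c k * (jacobiPoly d k).eval x)) atTop
      (𝓝 (∑ k ∈ s, Real.exp (-(eigenvalue d k * t)) * (c k * (jacobiPoly d k).eval x))) := by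
    refine tendsto_finsetSum _ fun k _ => Tendsto.mul_const _ ?_
    rw [Real.exp_neg]
    refine Tendsto.inv₀ ?_ (Real.exp_pos _).ne'
    simpa only [mul_div_assoc] using Real.tendsto_one_add_div_pow_exp (eigenvalue d k * t)
  exact ge_of_tendsto' hlim fun n => hiter (t / n) (by positivity) n x hx

lemma exists_sum_eq_poly [Fact (1 ≤ d)] (p : Polynomial ℝ) :
    ∃ (s : Finset ℕ) (c : ℕ → ℝ), ∀ x, p.eval x = ∑ k ∈ s, c k * (jacobiPoly d k).eval x := by
  have hp : p ∈ Submodule.span ℝ (Set.range (jacobiPoly d)) := by rw [span_jacobiPoly]; trivial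
  obtain ⟨c, rfl⟩ := Finsupp.mem_span_range_iff_exists_finsupp.1 hp
  exact ⟨c.support, c, fun x => by
    simp [Finsupp.sum, Polynomial.eval_finsetSum]⟩

lemma integral_heatKernel_mul_poly_nonneg [Fact (1 ≤ d)] {t : ℝ} (ht : 0 < t) (ht1 : t < 1)
    (x : E) (p : Polynomial ℝ) (hp : ∀ x ∈ Set.Icc (-1 : ℝ) 1, 0 ≤ p.eval x) :
    0 ≤ ∫ y, heatKernel d t x y * p.eval (y : ℝ) ∂(jacobiMeasure d) := by
  obtain ⟨s, c, hc⟩ := exists_sum_eq_poly (d := d) p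
  have h := hasSum_integral_heatKernel_mul (d := d) ht ht1 x (integrable_poly p)
  have hcoef : ∀ k, ∫ y : E, (jacobiPoly d k).eval (y : ℝ) * p.eval (y : ℝ) ∂(jacobiMeasure d) =
      if k ∈ s then c k * normSq d k else 0 := by
    intro k
    simp only [hc, Finset.mul_sum, mul_left_comm _ (c _)]
    rw [integral_finsetSum _ fun j _ => integrable_of_continuous (by fun_prop)]
    simp only [integral_const_mul]
    rw [← Finset.sum_ite_eq' s k fun k => c k * normSq d k]
    refine Finset.sum_congr rfl fun j _ => ?_
    split_ifs with hj
    · subst hj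
      simp only [normSq, sq]
    · rw [integral_jacobiPoly_mul_of_ne (Ne.symm hj), mul_zero]
  have hs : HasSum (fun k => heatCoeff d t k * (jacobiPoly d k).eval (x : ℝ) *
      ∫ y : E, (jacobiPoly d k).eval (y : ℝ) * p.eval (y : ℝ) ∂(jacobiMeasure d))
      (∑ k ∈ s, Real.exp (-(eigenvalue d k * t)) * (c k * (jacobiPoly d k).eval (x : ℝ))) := by
    have h1 := hasSum_sum_of_ne_finset_zero (L := .unconditional ℕ) (s := s)
      (f := fun k => heatCoeff d t k *
      (jacobiPoly d k).eval (x : ℝ) *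
      ∫ y : E, (jacobiPoly d k).eval (y : ℝ) * p.eval (y : ℝ) ∂(jacobiMeasure d))
      (fun k hk => by rw [hcoef, if_neg hk, mul_zero])
    convert! h1 using 1
    refine Finset.sum_congr rfl fun k hk => ?_
    rw [hcoef, if_pos hk, heatCoeff]
    have := (normSq_pos (d := d) k).ne'
    field_simp
  rw [h.unique hs]
  exact sum_exp_mul_nonneg s c ht.le (fun x hx => by rw [← hc]; exact hp x hx) x.2

/-- The heat kernel is nonnegative: test it against polynomial approximations of its negative
part. -/
lemma heatKernel_nonneg_ae [Fact (1 ≤ d)] {t : ℝ} (ht : 0 < t) (ht1 : t < 1) (x : E) :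
    ∀ᵐ y ∂(jacobiMeasure d), 0 ≤ heatKernel d t x y := by
  set M := heatTrace d t with hM
  have hM1 : 1 ≤ M := one_le_heatTrace ht ht1
  set p : E → ℝ := fun y => heatKernel d t x y with hp
  have hpc : Continuous p := continuous_heatKernel_right ht ht1 x
  set g : C(E, ℝ) := ⟨fun y => max (-p y) 0, by fun_prop⟩ with hg
  have hgv : ∀ y, g y = max (-p y) 0 := fun y => rfl
  have hpg : ∀ y, p y * g y = -g y ^ 2 := fun y => by
    rw [hgv]
    rcases le_total (-p y) 0 with h | h
    · simp [max_eq_right h]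
    · simp only [max_eq_left h]; ring
  have hgi : Integrable (fun y => g y ^ 2) (jacobiMeasure d) :=
    integrable_of_continuous (by fun_prop)
  have hle : ∀ δ : ℝ, 0 < δ → ∫ y, g y ^ 2 ∂(jacobiMeasure d) ≤ 2 * δ * M := by
    intro δ hδ
    obtain ⟨q, hq⟩ := exists_polynomial_near_continuousMap (-1) 1 g δ hδ
    rw [ContinuousMap.norm_lt_iff _ hδ] at hq
    have hq' : ∀ y : E, |q.eval (y : ℝ) - g y| < δ := fun y => by
      have := hq y
      simpa using this
    set f := q + Polynomial.C δ with hf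
    have hfg : ∀ y : E, 0 ≤ f.eval (y : ℝ) - g y ∧ f.eval (y : ℝ) - g y ≤ 2 * δ := fun y => by
      have := abs_lt.1 (hq' y)
      simp only [hf, Polynomial.eval_add, Polynomial.eval_C]
      constructor <;> linarith
    have h0 := integral_heatKernel_mul_poly_nonneg (d := d) ht ht1 x f (fun y hy => by
      have h1 := (hfg ⟨y, hy⟩).1
      have h2 : 0 ≤ g ⟨y, hy⟩ := le_max_right _ _
      simp only at h1
      linarith)
    have h3 : ∫ y, p y * f.eval (y : ℝ) ∂(jacobiMeasure d) ≤
        ∫ y, (-g y ^ 2 + 2 * δ * M) ∂(jacobiMeasure d) := by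
      refine integral_mono (integrable_of_continuous (hpc.mul (by fun_prop)))
        (hgi.neg.add (integrable_const _)) fun y => ?_
      have h4 := hfg y
      have h5 : |p y| ≤ M := abs_heatKernel_le ht ht1 x y
      have h6 : p y * (f.eval (y : ℝ) - g y) ≤ M * (2 * δ) :=
        (mul_le_mul_of_nonneg_right ((le_abs_self _).trans h5) h4.1).trans
          (mul_le_mul_of_nonneg_left h4.2 (by linarith))
      have := hpg y
      simp only
      linarith
    have h7 : ∫ y, (-g y ^ 2 + 2 * δ * M) ∂(jacobiMeasure d) =
        -(∫ y, g y ^ 2 ∂(jacobiMeasure d)) + ∫ _, 2 * δ * M ∂(jacobiMeasure d) := by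
      rw [← integral_neg]
      exact integral_add hgi.neg (integrable_const _)
    rw [h7] at h3
    simp only [integral_const, probReal_univ, one_smul] at h3
    linarith
  have hzero : ∫ y, g y ^ 2 ∂(jacobiMeasure d) = 0 := by
    refine le_antisymm (le_of_forall_pos_le_add fun ε hε => ?_)
      (integral_nonneg fun y => sq_nonneg _)
    have := hle (ε / (2 * M)) (by positivity)
    refine this.trans_eq ?_
    field_simp
    ring
  rw [integral_eq_zero_iff_of_nonneg (fun y => sq_nonneg _) hgi] at hzero
  filter_upwards [hzero] with y hy
  have h1 : g y = 0 := by simpa using hy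
  rw [hgv] at h1
  have := le_max_left (-p y) 0
  linarith

/-! ### Parseval's identity -/

lemma integral_J_mul_J [Fact (1 ≤ d)] (j k : ℕ) :
    ∫ z, J d j z * J d k z ∂(jacobiMeasure d) = if j = k then 1 else 0 := by
  have h : ∀ z, J d j z * J d k z = (√(normSq d j))⁻¹ * (√(normSq d k))⁻¹ *
      ((jacobiPoly d j).eval (z : ℝ) * (jacobiPoly d k).eval (z : ℝ)) := fun z => by
    rw [J_eq, J_eq]; ring
  simp only [h]
  rw [integral_const_mul]
  split_ifs with hjk
  · subst hjk
    simp only [← sq]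
    have h1 := normSq_pos (d := d) j
    rw [← normSq, inv_pow, Real.sq_sqrt h1.le, inv_mul_cancel₀ h1.ne']
  · rw [integral_jacobiPoly_mul_of_ne hjk, mul_zero]

/-- The normalized Jacobi polynomials are complete in `L²(μ)`. -/
lemma hasSum_sq_integral_mul_J [Fact (1 ≤ d)] {φ : E → ℝ} (hφ : MemLp φ 2 (jacobiMeasure d)) :
    HasSum (fun k => (∫ z, J d k z * φ z ∂(jacobiMeasure d)) ^ 2)
      (∫ z, φ z ^ 2 ∂(jacobiMeasure d)) := by
  set μ := jacobiMeasure d with hμ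
  set v : ℕ → Lp ℝ 2 μ := fun k => ContinuousMap.toLp 2 μ ℝ ⟨J d k, continuous_J k⟩ with hv
  have hvae : ∀ k, v k =ᵐ[μ] J d k := fun k => ContinuousMap.coeFn_toLp (p := 2) (𝕜 := ℝ) μ _
  have hinner : ∀ k (f : Lp ℝ 2 μ), inner ℝ (v k) f = ∫ z, J d k z * f z ∂μ := fun k f => by
    rw [L2.inner_def]
    refine integral_congr_ae ?_
    filter_upwards [hvae k] with z hz
    simp [hz, mul_comm]
  have hon : Orthonormal ℝ v := by
    rw [orthonormal_iff_ite]
    intro j k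
    rw [hinner, ← integral_J_mul_J (d := d) j k]
    refine integral_congr_ae ?_
    filter_upwards [hvae k] with z hz
    rw [hz]
  have hT : ∀ p : Polynomial ℝ, ContinuousMap.toLp 2 μ ℝ (p.toContinuousMapOn (Set.Icc (-1) 1)) ∈
      Submodule.span ℝ (Set.range v) := by
    intro p
    let T : Polynomial ℝ →ₗ[ℝ] Lp ℝ 2 μ := (ContinuousMap.toLp 2 μ ℝ).toLinearMap ∘ₗ
      (Polynomial.toContinuousMapOnAlgHom (Set.Icc (-1 : ℝ) 1)).toLinearMap
    have hp : p ∈ Submodule.span ℝ (Set.range (jacobiPoly d)) := by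
      rw [span_jacobiPoly]; trivial
    have hmap : Submodule.span ℝ (Set.range (jacobiPoly d)) ≤
        (Submodule.span ℝ (Set.range v)).comap T := by
      rw [Submodule.span_le]
      rintro _ ⟨k, rfl⟩
      have h1 : (jacobiPoly d k).toContinuousMapOn (Set.Icc (-1) 1) =
          √(normSq d k) • (⟨J d k, continuous_J k⟩ : C(E, ℝ)) := by
        ext z
        have := (Real.sqrt_pos.2 (normSq_pos (d := d) k)).ne'
        simp [J_eq, mul_div_cancel₀, this]
      change ContinuousMap.toLp 2 μ ℝ ((jacobiPoly d k).toContinuousMapOn _) ∈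
        Submodule.span ℝ (Set.range v)
      rw [h1, map_smul]
      exact Submodule.smul_mem _ _ (Submodule.subset_span ⟨k, rfl⟩)
    exact hmap hp
  have hsp : ⊤ ≤ (Submodule.span ℝ (Set.range v)).topologicalClosure := by
    intro f _
    have hcont : ∀ g : C(E, ℝ), ContinuousMap.toLp 2 μ ℝ g ∈
        closure (Submodule.span ℝ (Set.range v) : Set (Lp ℝ 2 μ)) := fun g => by
      have hg := continuousMap_mem_polynomialFunctions_closure (-1) 1 g
      refine map_mem_closure (ContinuousMap.toLp 2 μ ℝ).continuous hg ?_
      rintro _ ⟨p, -, rfl⟩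
      exact hT p
    have hdense := ContinuousMap.toLp_denseRange (E := ℝ) (μ := μ) ℝ
      (by simp : (2 : ℝ≥0∞) ≠ ∞)
    have : f ∈ closure (Set.range (ContinuousMap.toLp 2 μ ℝ : C(E, ℝ) → Lp ℝ 2 μ)) := hdense f
    refine closure_minimal ?_ isClosed_closure this
    rintro _ ⟨g, rfl⟩
    exact hcont g
  have hsum := (HilbertBasis.mk hon hsp).hasSum_inner_mul_inner (hφ.toLp φ) (hφ.toLp φ)
  have hφae := hφ.coeFn_toLp
  have h1 : ∀ k, inner ℝ (v k) (hφ.toLp φ) = ∫ z, J d k z * φ z ∂μ := fun k => by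
    rw [hinner]
    refine integral_congr_ae ?_
    filter_upwards [hφae] with z hz
    rw [hz]
  have h2 : inner ℝ (hφ.toLp φ) (hφ.toLp φ) = ∫ z, φ z ^ 2 ∂μ := by
    rw [L2.inner_def]
    refine integral_congr_ae ?_
    filter_upwards [hφae] with z hz
    simp only [hz, sq]
    rfl
  have h3 : ∀ k, inner ℝ (hφ.toLp φ) (v k) = ∫ z, J d k z * φ z ∂μ := fun k => by
    rw [real_inner_comm, h1]
  simpa only [HilbertBasis.coe_mk, h2, h1, h3, ← sq] using hsum

/-! ### Monotone transport -/

lemma le_measure_Iic_of_forall_gt {ν : Measure E} [IsProbabilityMeasure ν] {u : ℝ≥0∞} {a : E}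
    (hu : u ≤ 1) (h : ∀ r, a < r → u ≤ ν (Set.Iic r)) : u ≤ ν (Set.Iic a) := by
  rcases a.2.2.eq_or_lt with h1 | h1
  · have : Set.Iic a = Set.univ := Set.eq_univ_of_forall fun z =>
      Subtype.coe_le_coe.1 (z.2.2.trans h1.ge)
    rwa [this, measure_univ]
  · have ha : a < (⟨1, by norm_num, le_rfl⟩ : E) := Subtype.coe_lt_coe.1 h1
    obtain ⟨s, hs, hsm, hlim⟩ := exists_seq_strictAnti_tendsto' ha
    have hI : Set.Iic a = ⋂ n, Set.Iic (s n) := by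
      ext z
      simp only [Set.mem_Iic, Set.mem_iInter]
      exact ⟨fun hz n => hz.trans (hsm n).1.le, fun hz => ge_of_tendsto' hlim hz⟩
    rw [hI, Antitone.measure_iInter (fun m n hmn => Set.Iic_subset_Iic.2 (hs.antitone hmn))
      (fun _ => measurableSet_Iic.nullMeasurableSet) ⟨0, measure_ne_top _ _⟩]
    exact le_iInf fun n => h _ (hsm n).1

lemma measure_Iio_le_of_forall_lt {ν : Measure E} {u : ℝ≥0∞} {b : E}
    (h : ∀ r, r < b → ν (Set.Iic r) ≤ u) : ν (Set.Iio b) ≤ u := by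
  rcases b.2.1.eq_or_lt with h1 | h1
  · have : Set.Iio b = ∅ := Set.eq_empty_of_forall_notMem fun z hz =>
      absurd (Set.mem_Iio.1 hz) (not_lt.2 (Subtype.coe_le_coe.1 (h1.ge.trans z.2.1)))
    simp [this]
  · have hb : (⟨-1, le_rfl, by norm_num⟩ : E) < b := Subtype.coe_lt_coe.1 h1
    obtain ⟨s, hs, hsm, hlim⟩ := exists_seq_strictMono_tendsto' hb
    have hI : Set.Iio b = ⋃ n, Set.Iic (s n) := by
      ext z
      simp only [Set.mem_Iio, Set.mem_iUnion, Set.mem_Iic]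
      exact ⟨fun hz => ((hlim.eventually (lt_mem_nhds hz)).exists).imp fun n hn => hn.le,
        fun ⟨n, hn⟩ => hn.trans_lt (hsm n).2⟩
    rw [hI, Monotone.measure_iUnion fun m n hmn => Set.Iic_subset_Iic.2 (hs.monotone hmn)]
    exact iSup_le fun n => h _ (hsm n).2

/-- The distribution function of an atomless law is uniformly distributed under that law. -/
lemma measure_setOf_Iic_le {κ : Measure E} [IsProbabilityMeasure κ] [NullSingletonClass κ]
    {u : ℝ≥0∞} (hu : u ≤ 1) : κ {s | κ (Set.Iic s) ≤ u} = u := by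
  set B := {s | κ (Set.Iic s) ≤ u} with hB
  set B' : Set ℝ := (↑) '' B with hB'
  have hbot : (⟨-1, le_rfl, by norm_num⟩ : E) ∈ B := by
    have : Set.Iic (⟨-1, le_rfl, by norm_num⟩ : E) = {⟨-1, le_rfl, by norm_num⟩} := by
      ext z
      simp only [Set.mem_Iic, Set.mem_singleton_iff]
      exact ⟨fun h => le_antisymm h (Subtype.coe_le_coe.1 z.2.1), fun h => h.le⟩
    simp [hB, this]
  have hne : B'.Nonempty := ⟨_, _, hbot, rfl⟩
  have hbdd : BddAbove B' := ⟨1, by rintro _ ⟨z, -, rfl⟩; exact z.2.2⟩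
  have hlub := isLUB_csSup hne hbdd
  set b : E := ⟨sSup B', hlub.1 ⟨_, hbot, rfl⟩, hlub.2 (by rintro _ ⟨z, -, rfl⟩; exact z.2.2)⟩
    with hb
  have hsub : B ⊆ Set.Iic b := fun z hz =>
    Set.mem_Iic.2 (Subtype.coe_le_coe.1 (hlub.1 ⟨z, hz, rfl⟩))
  have hsub' : Set.Iio b ⊆ B := by
    intro z hz
    obtain ⟨_, ⟨w, hw, rfl⟩, hzw⟩ := exists_lt_of_lt_csSup hne
      (show (z : ℝ) < sSup B' from hz)
    exact (measure_mono (Set.Iic_subset_Iic.2 (Subtype.coe_lt_coe.1 hzw).le)).trans hw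
  have hIio : κ (Set.Iio b) ≤ u := measure_Iio_le_of_forall_lt fun r hr => hsub' hr
  have hIic : u ≤ κ (Set.Iic b) := le_measure_Iic_of_forall_gt hu fun r hr => by
    by_contra hcon
    exact absurd (hsub (not_le.1 hcon).le) (not_le.2 hr)
  have heq : κ (Set.Iio b) = κ (Set.Iic b) := measure_congr Iio_ae_eq_Iic
  exact le_antisymm ((measure_mono hsub).trans (heq ▸ hIio))
    ((heq ▸ hIic).trans (measure_mono hsub'))

/-- The monotone rearrangement: an atomless law is mapped to any other by a monotone map. -/
lemma exists_monotone_map_eq (κ ν : Measure E) [IsProbabilityMeasure κ] [NullSingletonClass κ]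
    [IsProbabilityMeasure ν] : ∃ T : E → E, Monotone T ∧ κ.map T = ν := by
  have hex : ∀ s : E, ∃ a : E, ∀ t, a ≤ t ↔ κ (Set.Iic s) ≤ ν (Set.Iic t) := by
    intro s
    set A := {t : E | κ (Set.Iic s) ≤ ν (Set.Iic t)} with hA
    set A' : Set ℝ := (↑) '' A with hA'
    have htop : (⟨1, by norm_num, le_rfl⟩ : E) ∈ A := by
      have : Set.Iic (⟨1, by norm_num, le_rfl⟩ : E) = Set.univ :=
        Set.eq_univ_of_forall fun z => Set.mem_Iic.2 (Subtype.coe_le_coe.1 z.2.2)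
      simp [hA, this, prob_le_one]
    have hne : A'.Nonempty := ⟨_, _, htop, rfl⟩
    have hbdd : BddBelow A' := ⟨-1, by rintro _ ⟨z, -, rfl⟩; exact z.2.1⟩
    have hglb := isGLB_csInf hne hbdd
    set a : E := ⟨sInf A', hglb.2 (by rintro _ ⟨z, -, rfl⟩; exact z.2.1),
      hglb.1 ⟨_, htop, rfl⟩⟩ with ha
    have hmem : κ (Set.Iic s) ≤ ν (Set.Iic a) :=
      le_measure_Iic_of_forall_gt prob_le_one fun r hr => by
        obtain ⟨_, ⟨w, hw, rfl⟩, hzw⟩ := exists_lt_of_csInf_lt hne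
          (show sInf A' < (r : ℝ) from hr)
        exact hw.trans (measure_mono (Set.Iic_subset_Iic.2 (Subtype.coe_lt_coe.1 hzw).le))
    exact ⟨a, fun t => ⟨fun h => hmem.trans (measure_mono (Set.Iic_subset_Iic.2 h)),
      fun h => Subtype.coe_le_coe.1 (hglb.1 ⟨t, h, rfl⟩)⟩⟩
  choose T hT using hex
  have hmono : Monotone T := fun s s' hss => (hT s _).2
    ((measure_mono (Set.Iic_subset_Iic.2 hss)).trans ((hT s' _).1 le_rfl))
  refine ⟨T, hmono, ?_⟩
  have : IsProbabilityMeasure (κ.map T) := Measure.isProbabilityMeasure_map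
    hmono.measurable.aemeasurable
  refine Measure.ext_of_Iic _ _ fun t => ?_
  rw [Measure.map_apply hmono.measurable measurableSet_Iic]
  have : T ⁻¹' Set.Iic t = {s | κ (Set.Iic s) ≤ ν (Set.Iic t)} := by
    ext s; exact hT s t
  rw [this, measure_setOf_Iic_le prob_le_one]

/-! ### A weighted `H⁻¹` bound for the Kantorovich distance -/

/-- Lebesgue measure on `[-1, 1]`. -/
def lebE : Measure E := Measure.comap ((↑) : E → ℝ) volume

lemma W2_sq_le {ν₁ ν₂ : Measure E} (π : Measure (E × E)) (h₁ : π.map Prod.fst = ν₁)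
    (h₂ : π.map Prod.snd = ν₂) :
    W2 ν₁ ν₂ ^ 2 ≤ ∫⁻ z, ENNReal.ofReal (rho z.1 z.2 ^ 2) ∂π := by
  have h : W2 ν₁ ν₂ ≤ (∫⁻ z, ENNReal.ofReal (rho z.1 z.2 ^ 2) ∂π) ^ (1 / 2 : ℝ) :=
    iInf₂_le π ⟨h₁, h₂⟩
  refine (pow_le_pow_left' h 2).trans_eq ?_
  rw [← ENNReal.rpow_natCast, ← ENNReal.rpow_mul]
  norm_num

lemma measurable_rho {α : Type*} [MeasurableSpace α] {f g : α → E} (hf : Measurable f)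
    (hg : Measurable g) : Measurable fun a => rho (f a) (g a) := by
  have hm : Measurable fun x : E => Real.arccos x :=
    Real.measurable_arccos.comp measurable_subtype_coe
  exact continuous_abs.measurable.comp ((hm.comp hf).sub (hm.comp hg))

lemma rho_le_pi (x y : E) : rho x y ≤ Real.pi := by
  have h1 := Real.arccos_nonneg x
  have h2 := Real.arccos_nonneg y
  have h3 := Real.arccos_le_pi x
  have h4 := Real.arccos_le_pi y
  exact abs_le.2 ⟨by linarith, by linarith⟩

lemma lintegral_rho_sq_le {α : Type*} [MeasurableSpace α] (P : Measure α) [IsProbabilityMeasure P]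
    (f g : α → E) : ∫⁻ a, ENNReal.ofReal (rho (f a) (g a) ^ 2) ∂P ≤ ENNReal.ofReal (Real.pi ^ 2) :=
  (lintegral_mono fun a => ENNReal.ofReal_le_ofReal
    (pow_le_pow_left₀ (rho_nonneg _ _) (rho_le_pi _ _) 2)).trans_eq (by simp)

lemma W2_sq_le_pi_sq (ν₁ ν₂ : Measure E) [IsProbabilityMeasure ν₁] [IsProbabilityMeasure ν₂] :
    W2 ν₁ ν₂ ^ 2 ≤ ENNReal.ofReal (Real.pi ^ 2) :=
  (W2_sq_le (ν₁.prod ν₂) (by simp) (by simp)).trans (lintegral_rho_sq_le _ _ _)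

/-- The region between a point and its image, in which a transported mass crosses `t`. -/
def crossing (T : E → E) : Set (E × E) :=
  {p | (p.1 < p.2 ∧ p.2 < T p.1) ∨ (T p.1 < p.2 ∧ p.2 < p.1)}

/-- The squared distance as an integral over the segment travelled: in the variable
`θ = arccos t`, this is `(θ₁ - θ₀)² = ∫ 2 |θ - θ₁| dθ`. -/
lemma ofReal_rho_sq_le (s b : E) :
    ENNReal.ofReal (rho s b ^ 2) ≤
      ∫⁻ t in {t | (s < t ∧ t < b) ∨ (b < t ∧ t < s)},
        ENNReal.ofReal (2 * rho t b * (1 / √(1 - (t : ℝ) ^ 2))) ∂lebE := by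
  have key : ∀ (x y : E) (g g' : ℝ → ℝ), x ≤ y → Continuous g →
      (∀ t ∈ Set.Ioo (x : ℝ) y, HasDerivAt g (g' t) t) → (∀ t ∈ Set.Ioo (x : ℝ) y, 0 ≤ g' t) →
      ENNReal.ofReal (g y - g x) ≤ ∫⁻ t in Set.Ioo x y, ENNReal.ofReal (g' t) ∂lebE := by
    intro x y g g' hxy hg hder hpos
    have hint := intervalIntegral.integrableOn_deriv_of_nonneg hg.continuousOn hder hpos
    have h1 := intervalIntegral.integral_eq_sub_of_hasDerivAt_of_le
      (Subtype.coe_le_coe.2 hxy) hg.continuousOn hder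
      ((intervalIntegrable_iff_integrableOn_Ioc_of_le (Subtype.coe_le_coe.2 hxy)).2 hint)
    rw [intervalIntegral.integral_of_le (Subtype.coe_le_coe.2 hxy), integral_Ioc_eq_integral_Ioo]
      at h1
    rw [← h1, ofReal_integral_eq_lintegral_ofReal (hint.mono_set Set.Ioo_subset_Ioc_self)
      (by filter_upwards [ae_restrict_mem measurableSet_Ioo] with t ht using hpos t ht)]
    rw [← lintegral_indicator measurableSet_Ioo, ← lintegral_indicator measurableSet_Ioo]
    have h2 := lintegral_comap_coe
      (Set.indicator (Set.Ioo (x : ℝ) y) fun t => ENNReal.ofReal (g' t))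
    have h3 : ∀ z : E, Set.indicator (Set.Ioo (x : ℝ) y) (fun t => ENNReal.ofReal (g' t)) z =
        Set.indicator (Set.Ioo x y) (fun z : E => ENNReal.ofReal (g' z)) z := fun z => by
      by_cases hz : z ∈ Set.Ioo x y
      · have hz' : (z : ℝ) ∈ Set.Ioo (x : ℝ) y := hz
        rw [Set.indicator_of_mem hz, Set.indicator_of_mem hz']
      · have hz' : (z : ℝ) ∉ Set.Ioo (x : ℝ) y := hz
        rw [Set.indicator_of_notMem hz, Set.indicator_of_notMem hz']
    simp only [h3] at h2
    rw [lebE, h2, ← lintegral_indicator measurableSet_Icc]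
    refine (lintegral_mono fun t => ?_)
    by_cases ht : t ∈ Set.Ioo (x : ℝ) y
    · have ht' : t ∈ Set.Icc (-1 : ℝ) 1 := ⟨x.2.1.trans ht.1.le, ht.2.le.trans y.2.2⟩
      rw [Set.indicator_of_mem ht']
    · rw [Set.indicator_of_notMem ht]; exact zero_le
  have hder : ∀ t : ℝ, t ∈ Set.Ioo (-1 : ℝ) 1 →
      HasDerivAt Real.arccos (-(1 / √(1 - t ^ 2))) t := fun t ht =>
    Real.hasDerivAt_arccos ht.1.ne' ht.2.ne
  rcases le_total s b with hsb | hsb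
  · have h := key s b (fun t => -(Real.arccos t - Real.arccos b) ^ 2)
      (fun t => 2 * (Real.arccos t - Real.arccos b) * (1 / √(1 - t ^ 2))) hsb
      (by fun_prop) (fun t ht => by
        refine (((hder t ⟨s.2.1.trans_lt ht.1, ht.2.trans_le b.2.2⟩).sub_const
          (Real.arccos b)).pow 2).neg.congr_deriv ?_
        push_cast; ring)
      (fun t ht => mul_nonneg (mul_nonneg zero_le_two
        (sub_nonneg.2 (Real.arccos_le_arccos ht.2.le))) (by positivity))
    have h0 : -(Real.arccos b - Real.arccos b) ^ 2 - -(Real.arccos s - Real.arccos b) ^ 2 =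
        rho s b ^ 2 := by rw [rho, sq_abs]; ring
    rw [h0] at h
    refine h.trans ((setLIntegral_mono' measurableSet_Ioo fun t ht => ?_).trans
      (lintegral_mono_set fun t ht => Or.inl ht))
    rw [rho, abs_of_nonneg (sub_nonneg.2 (Real.arccos_le_arccos (Subtype.coe_le_coe.2 ht.2.le)))]
  · have h := key b s (fun t => (Real.arccos b - Real.arccos t) ^ 2)
      (fun t => 2 * (Real.arccos b - Real.arccos t) * (1 / √(1 - t ^ 2))) hsb
      (by fun_prop) (fun t ht => by
        refine (((hder t ⟨b.2.1.trans_lt ht.1, ht.2.trans_le s.2.2⟩).const_sub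
          (Real.arccos b)).pow 2).congr_deriv ?_
        push_cast; ring)
      (fun t ht => mul_nonneg (mul_nonneg zero_le_two
        (sub_nonneg.2 (Real.arccos_le_arccos ht.1.le))) (by positivity))
    have h0 : (Real.arccos b - Real.arccos s) ^ 2 - (Real.arccos b - Real.arccos b) ^ 2 =
        rho s b ^ 2 := by rw [rho, sq_abs]; ring
    rw [h0] at h
    refine h.trans ((setLIntegral_mono' measurableSet_Ioo fun t ht => ?_).trans
      (lintegral_mono_set fun t ht => Or.inr ht))
    rw [rho, abs_sub_comm,
      abs_of_nonneg (sub_nonneg.2 (Real.arccos_le_arccos (Subtype.coe_le_coe.2 ht.1.le)))]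

lemma rho_le_rho_of_between {s b c : E} (h : (s ≤ b ∧ b ≤ c) ∨ (c ≤ b ∧ b ≤ s)) :
    rho s b ≤ rho s c := by
  have hm : ∀ x y : E, x ≤ y → Real.arccos y ≤ Real.arccos x := fun x y hxy =>
    Real.arccos_le_arccos (Subtype.coe_le_coe.2 hxy)
  unfold rho
  rcases h with ⟨h1, h2⟩ | ⟨h1, h2⟩
  · have := hm _ _ h1
    have := hm _ _ h2
    rw [abs_of_nonneg (by linarith), abs_of_nonneg (by linarith)]
    linarith
  · have := hm _ _ h1
    have := hm _ _ h2
    rw [abs_of_nonpos (by linarith), abs_of_nonpos (by linarith)]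
    linarith

/-- The mass transported across `t` is the difference of the distribution functions at `t`. -/
lemma measure_crossing_le {κ ν : Measure E} [IsProbabilityMeasure κ] {T : E → E}
    (hT : Monotone T) (hmap : κ.map T = ν) (t : E) :
    κ {s | (s, t) ∈ crossing T} ≤
      ENNReal.ofReal |κ.real (Set.Iic t) - ν.real (Set.Iic t)| := by
  have hν : ν.real (Set.Iic t) = κ.real (T ⁻¹' Set.Iic t) := by
    rw [← hmap, map_measureReal_apply hT.measurable measurableSet_Iic]
  have hm : MeasurableSet (T ⁻¹' Set.Iic t) := hT.measurable measurableSet_Iic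
  rw [hν, ← ofReal_measureReal]
  refine ENNReal.ofReal_le_ofReal ?_
  rcases lt_or_ge t (T t) with h | h
  · have hsub : T ⁻¹' Set.Iic t ⊆ Set.Iic t := fun s hs => by
      by_contra hc
      exact absurd (hT (not_le.1 hc).le) (not_le.2 (lt_of_le_of_lt hs h))
    rw [← measureReal_sdiff hsub hm]
    refine (measureReal_mono ?_).trans (le_abs_self _)
    rintro s (⟨h1, h2⟩ | ⟨h1, h2⟩)
    · exact ⟨h1.le, not_le.2 h2⟩
    · exact absurd (hT h2.le) (not_le.2 (h1.trans h))
  · have hsub : Set.Iic t ⊆ T ⁻¹' Set.Iic t := fun s hs => (hT hs).trans h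
    rw [abs_sub_comm, ← measureReal_sdiff hsub measurableSet_Iic]
    refine (measureReal_mono ?_).trans (le_abs_self _)
    rintro s (⟨h1, h2⟩ | ⟨h1, h2⟩)
    · exact absurd ((hT h1.le).trans h) (not_le.2 h2)
    · exact ⟨h1.le, not_le.2 h2⟩

instance isFiniteMeasure_lebE : IsFiniteMeasure lebE := by
  constructor
  rw [lebE, (MeasurableEmbedding.subtype_coe measurableSet_Icc).comap_apply]
  exact (measure_mono (by rintro _ ⟨z, -, rfl⟩; exact z.2)).trans_lt
    (measure_Icc_lt_top (a := (-1 : ℝ)) (b := 1))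

/-- By Tonelli's theorem, the transport cost is an integral over the points crossed; the distance left
to travel at `t` is bounded by `rho t (T t)`, by monotonicity. -/
lemma lintegral_rho_sq_map_le {κ ν : Measure E} [IsProbabilityMeasure κ] {T : E → E}
    (hT : Monotone T) (hmap : κ.map T = ν) :
    ∫⁻ s, ENNReal.ofReal (rho s (T s) ^ 2) ∂κ ≤
      ∫⁻ t, ENNReal.ofReal (2 * rho t (T t) * (1 / √(1 - (t : ℝ) ^ 2)) *
        |κ.real (Set.Iic t) - ν.real (Set.Iic t)|) ∂lebE := by
  have hTm := (hT.measurable : Measurable T)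
  have h1 : Measurable fun p : E × E => p.1 := measurable_fst
  have h2 : Measurable fun p : E × E => p.2 := measurable_snd
  have h3 : Measurable fun p : E × E => T p.1 := hTm.comp measurable_fst
  have m1 := measurableSet_lt h1 h2
  have m2 := measurableSet_lt h2 h3
  have m3 := measurableSet_lt h3 h2
  have m4 := measurableSet_lt h2 h1
  have hcm : MeasurableSet (crossing T) := (m1.inter m2).union (m3.inter m4)
  set F : E × E → ℝ≥0∞ := (crossing T).indicator fun p =>
    ENNReal.ofReal (2 * rho p.2 (T p.1) * (1 / √(1 - (p.2 : ℝ) ^ 2))) with hF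
  have hFm : Measurable F := by
    refine Measurable.indicator ?_ hcm
    have h4 : Measurable fun p : E × E => rho p.2 (T p.1) := measurable_rho h2 h3
    have h5 : Measurable fun x : ℝ => 1 / √(1 - x ^ 2) := by fun_prop
    exact ((h4.const_mul 2).mul (h5.comp (measurable_subtype_coe.comp h2))).ennreal_ofReal
  calc ∫⁻ s, ENNReal.ofReal (rho s (T s) ^ 2) ∂κ
      ≤ ∫⁻ s, ∫⁻ t, F (s, t) ∂lebE ∂κ := by
        refine lintegral_mono fun s => (ofReal_rho_sq_le s (T s)).trans_eq ?_
        have hs : MeasurableSet {t | (s < t ∧ t < T s) ∨ (T s < t ∧ t < s)} :=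
          measurable_prodMk_left hcm
        rw [← lintegral_indicator hs]
        rfl
    _ = ∫⁻ t, ∫⁻ s, F (s, t) ∂κ ∂lebE := lintegral_lintegral_swap hFm.aemeasurable
    _ ≤ _ := by
        refine lintegral_mono fun t => ?_
        have hpt : ∀ s, F (s, t) ≤ {s | (s, t) ∈ crossing T}.indicator (fun _ =>
            ENNReal.ofReal (2 * rho t (T t) * (1 / √(1 - (t : ℝ) ^ 2)))) s := by
          intro s
          by_cases hs : (s, t) ∈ crossing T
          · rw [hF, Set.indicator_of_mem hs, Set.indicator_of_mem (by exact hs)]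
            refine ENNReal.ofReal_le_ofReal ?_
            have : rho t (T s) ≤ rho t (T t) := by
              refine rho_le_rho_of_between ?_
              rcases hs with ⟨h1, h2⟩ | ⟨h1, h2⟩
              · exact Or.inl ⟨le_of_lt h2, hT (le_of_lt h1)⟩
              · exact Or.inr ⟨hT (le_of_lt h2), le_of_lt h1⟩
            gcongr
          · rw [hF, Set.indicator_of_notMem hs]; exact zero_le
        refine (lintegral_mono hpt).trans ?_
        have hct : MeasurableSet {s | (s, t) ∈ crossing T} := measurable_prodMk_right hcm
        rw [lintegral_indicator_const hct]
        rw [ENNReal.ofReal_mul (p := 2 * rho t (T t) * (1 / √(1 - (t : ℝ) ^ 2)))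
          (by have := rho_nonneg t (T t); positivity)]
        exact mul_le_mul_right (measure_crossing_le hT hmap t) _

lemma ae_mem_Ioo_lebE : ∀ᵐ z : E ∂lebE, (z : ℝ) ∈ Set.Ioo (-1 : ℝ) 1 := by
  have h1 : ∀ᵐ z ∂lebE, z ≠ (⟨-1, le_rfl, by norm_num⟩ : E) := by
    unfold lebE; exact Measure.ae_ne _ _
  have h2 : ∀ᵐ z ∂lebE, z ≠ (⟨1, by norm_num, le_rfl⟩ : E) := by
    unfold lebE; exact Measure.ae_ne _ _
  filter_upwards [h1, h2] with z hz1 hz2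
  exact ⟨lt_of_le_of_ne z.2.1 fun h => hz1 (Subtype.ext h.symm),
    lt_of_le_of_ne z.2.2 fun h => hz2 (Subtype.ext h)⟩

/-- Young's inequality, with the weight for which the first term can be absorbed. -/
lemma two_mul_mul_le_of_pos {m v : ℝ} (hm : 0 < m) (hv : 0 < v) (r a : ℝ) :
    2 * r * (1 / v) * a ≤ 1 / 4 * (m * r ^ 2) + 4 * (a ^ 2 / (v ^ 2 * m)) := by
  have hsq : 0 ≤ (m * r * v / 2 - 2 * a) ^ 2 / (m * v ^ 2) := by positivity
  have hexp : (m * r * v / 2 - 2 * a) ^ 2 / (m * v ^ 2) =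
      1 / 4 * (m * r ^ 2) + 4 * (a ^ 2 / (v ^ 2 * m)) - 2 * r * (1 / v) * a := by
    field_simp
    ring
  linarith

/-- In dimension one, `W₂²` is bounded by a weighted `L²` norm of the difference of the
distribution functions, as soon as one of the two laws dominates `μ / 2`. -/
lemma W2_sq_le_lintegral {d : ℝ} [Fact (1 ≤ d)] {κ ν : Measure E} [IsProbabilityMeasure κ]
    [NullSingletonClass κ] [IsProbabilityMeasure ν] (hκ : jacobiMeasure d ≤ (2 : ℝ≥0∞) • κ) :
    W2 ν κ ^ 2 ≤ 8 * ∫⁻ t : E, ENNReal.ofReal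
      ((κ.real (Set.Iic t) - ν.real (Set.Iic t)) ^ 2 / energyDensity d t) ∂lebE := by
  obtain ⟨T, hT, hmap⟩ := exists_monotone_map_eq κ ν
  set I := ∫⁻ s, ENNReal.ofReal (rho s (T s) ^ 2) ∂κ with hI
  set Q := ∫⁻ t : E, ENNReal.ofReal
      ((κ.real (Set.Iic t) - ν.real (Set.Iic t)) ^ 2 / energyDensity d t) ∂lebE with hQ
  have hrm : Measurable fun s => ENNReal.ofReal (rho s (T s) ^ 2) :=
    ((measurable_rho measurable_id hT.measurable).pow_const 2).ennreal_ofReal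
  have hW : W2 ν κ ^ 2 ≤ I := by
    have hp : Measurable fun s => (T s, s) := hT.measurable.prodMk measurable_id
    refine (W2_sq_le (κ.map fun s => (T s, s)) ?_ ?_).trans_eq ?_
    · rw [Measure.map_map measurable_fst hp]; exact hmap
    · rw [Measure.map_map measurable_snd hp]; exact Measure.map_id
    · rw [lintegral_map ((measurable_rho measurable_fst measurable_snd).pow_const 2).ennreal_ofReal hp]
      refine lintegral_congr fun s => ?_
      simp only [rho, sq_abs]
      congr 1
      ring
  have hle : I ≤ 1 / 4 * ∫⁻ s, ENNReal.ofReal (rho s (T s) ^ 2) ∂(jacobiMeasure d) + 4 * Q := by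
    have hdm : Measurable fun t : E => ENNReal.ofReal (density d t) :=
      ((measurable_density d).comp measurable_subtype_coe).ennreal_ofReal
    have h1 : ∫⁻ s, ENNReal.ofReal (rho s (T s) ^ 2) ∂(jacobiMeasure d) =
        ∫⁻ s : E, ENNReal.ofReal (density d s) * ENNReal.ofReal (rho s (T s) ^ 2) ∂lebE :=
      lintegral_withDensity_eq_lintegral_mul _ hdm hrm
    have hprod := hdm.mul hrm
    simp only [Pi.mul_def] at hprod
    rw [h1, ← lintegral_const_mul _ hprod, hQ,
      ← lintegral_const_mul' _ _ (by norm_num : (4 : ℝ≥0∞) ≠ ∞),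
      ← lintegral_add_left (hprod.const_mul _)]
    refine (lintegral_rho_sq_map_le hT hmap).trans (lintegral_mono_ae ?_)
    filter_upwards [ae_mem_Ioo_lebE] with t ht
    have hm := density_pos (d := d) ht
    have hs := one_sub_sq_pos ht
    set Δ := κ.real (Set.Iic t) - ν.real (Set.Iic t) with hΔ
    have h4 : (1 / 4 : ℝ≥0∞) = ENNReal.ofReal (1 / 4) := by
      rw [ENNReal.ofReal_div_of_pos (by norm_num)]; norm_num
    have h4' : (4 : ℝ≥0∞) = ENNReal.ofReal 4 := by norm_num
    rw [h4, h4', ← ENNReal.ofReal_mul hm.le, ← ENNReal.ofReal_mul (by norm_num),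
      ← ENNReal.ofReal_mul (by norm_num), ← ENNReal.ofReal_add (by positivity)
      (mul_nonneg (by norm_num) (div_nonneg (sq_nonneg _) (energyDensity_pos ht).le))]
    refine ENNReal.ofReal_le_ofReal ?_
    rw [← one_sub_sq_mul_density ht]
    set r := rho t (T t)
    set m := density d t
    set w := 1 - (t : ℝ) ^ 2
    have hw : √w ^ 2 = w := Real.sq_sqrt hs.le
    have h := two_mul_mul_le_of_pos hm (Real.sqrt_pos.2 hs) r |Δ|
    rwa [hw, sq_abs] at h
  have hμκ : ∫⁻ s, ENNReal.ofReal (rho s (T s) ^ 2) ∂(jacobiMeasure d) ≤ 2 * I := by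
    refine (lintegral_mono' hκ le_rfl).trans_eq ?_
    rw [lintegral_smul_measure, smul_eq_mul]
  -- The cost is finite, so that `I / 2` can be absorbed.
  have hIfin : I ≠ ∞ := ne_top_of_le_ne_top ENNReal.ofReal_ne_top (lintegral_rho_sq_le κ _ _)
  refine hW.trans ?_
  rcases eq_or_ne Q ∞ with hQt | hQt
  · simp [hQt]
  have hfin : I ≤ 1 / 4 * (2 * I) + 4 * Q := hle.trans (by gcongr)
  clear_value I Q
  lift I to NNReal using hIfin
  lift Q to NNReal using hQt
  have h14 : (1 / 4 : ℝ≥0∞) = ((1 / 4 : NNReal) : ℝ≥0∞) := by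
    rw [ENNReal.coe_div (by norm_num)]; norm_num
  rw [h14] at hfin
  norm_cast at hfin ⊢
  rw [← NNReal.coe_le_coe] at hfin ⊢
  push_cast at hfin ⊢
  linarith

/-! ### The regularization error of the distribution function -/

/-- The difference `(1 - P_t) 1_{[-1, x]}` at the point `z`. Its average over a sample is the
difference between the distribution functions of the empirical measure and of its
regularization. -/
def smoothingError (d t : ℝ) (x z : E) : ℝ :=
  (Set.Iic x).indicator (fun _ => 1) z - ∫ y in Set.Iic x, heatKernel d t z y ∂(jacobiMeasure d)

lemma measurable_smoothingError [Fact (1 ≤ d)] {t : ℝ} (ht : 0 < t) (ht1 : t < 1) :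
    Measurable fun p : E × E => smoothingError d t p.1 p.2 := by
  have h1 : Measurable fun p : E × E => (Set.Iic p.1).indicator (fun _ => (1 : ℝ)) p.2 := by
    have hs : MeasurableSet {p : E × E | p.2 ≤ p.1} :=
      measurableSet_le measurable_snd measurable_fst
    exact (measurable_const (a := (1 : ℝ))).indicator hs
  have h2 : Measurable fun q : (E × E) × E => (Set.Iic q.1.1).indicator
      (fun y => heatKernel d t q.1.2 y) q.2 := by
    have hs : MeasurableSet {q : (E × E) × E | q.2 ≤ q.1.1} :=
      measurableSet_le measurable_snd (measurable_fst.comp measurable_fst)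
    have hk : Measurable fun q : (E × E) × E => heatKernel d t q.1.2 q.2 :=
      (continuous_heatKernel ht ht1).measurable.comp
        ((measurable_snd.comp measurable_fst).prodMk measurable_snd)
    exact hk.indicator hs
  have h3 := (h2.stronglyMeasurable.integral_prod_right' (ν := jacobiMeasure d)).measurable
  simp only [integral_indicator measurableSet_Iic] at h3
  exact h1.sub h3

lemma abs_smoothingError_le [Fact (1 ≤ d)] {t : ℝ} (ht : 0 < t) (ht1 : t < 1) (x z : E) :
    |smoothingError d t x z| ≤ 1 + heatTrace d t := by
  refine (abs_sub _ _).trans (add_le_add ?_ ?_)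
  · by_cases h : z ∈ Set.Iic x <;> simp [h]
  · have h := norm_setIntegral_le_of_norm_le_const (μ := jacobiMeasure d) (s := Set.Iic x)
      (f := fun y => heatKernel d t z y) (measure_lt_top _ _)
      (fun y _ => abs_heatKernel_le ht ht1 z y)
    refine h.trans (mul_le_of_le_one_right ?_ measureReal_le_one)
    linarith [one_le_heatTrace (d := d) ht ht1]

lemma memLp_smoothingError [Fact (1 ≤ d)] {t : ℝ} (ht : 0 < t) (ht1 : t < 1) (x : E)
    {α : Type*} [MeasurableSpace α] (P : Measure α) [IsFiniteMeasure P] {f : α → E}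
    (hf : Measurable f) : MemLp (fun a => smoothingError d t x (f a)) 2 P :=
  MemLp.of_bound ((measurable_smoothingError ht ht1).comp
    (measurable_const.prodMk hf)).aestronglyMeasurable (1 + heatTrace d t)
    (ae_of_all _ fun a => abs_smoothingError_le ht ht1 x (f a))

lemma integral_heatKernel_mul_J [Fact (1 ≤ d)] {t : ℝ} (ht : 0 < t) (ht1 : t < 1) (k : ℕ)
    (y : E) : ∫ z, J d k z * heatKernel d t z y ∂(jacobiMeasure d) =
      Real.exp (-(eigenvalue d k * t)) * J d k y := by
  have h := hasSum_integral_heatKernel_mul (d := d) ht ht1 y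
    (integrable_of_continuous (continuous_J (d := d) k))
  have hJ : ∀ j, ∫ z : E, (jacobiPoly d j).eval (z : ℝ) * J d k z ∂(jacobiMeasure d) =
      if j = k then √(normSq d k) else 0 := by
    intro j
    have hj := Real.sqrt_pos.2 (normSq_pos (d := d) j)
    have h1 : ∀ z : E, (jacobiPoly d j).eval (z : ℝ) * J d k z =
        √(normSq d j) * (J d j z * J d k z) := fun z => by
      rw [J_eq j]; field_simp
    simp only [h1]
    rw [integral_const_mul, integral_J_mul_J]
    split_ifs with hjk
    · rw [hjk, mul_one]
    · rw [mul_zero]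
  simp only [hJ] at h
  have h2 := h.unique (hasSum_single k fun j hj => by rw [if_neg hj, mul_zero])
  simp only [mul_comm (J d k _), heatKernel_comm t _ y, h2, if_true]
  rw [J_eq, heatCoeff]
  have hk := normSq_pos (d := d) k
  have hk' := Real.sqrt_pos.2 hk
  have h3 : (normSq d k)⁻¹ * √(normSq d k) = (√(normSq d k))⁻¹ := by
    nth_rewrite 1 [← Real.mul_self_sqrt hk.le]
    field_simp
  rw [div_eq_mul_inv, ← h3]
  ring

lemma integral_J_mul_smoothingError [Fact (1 ≤ d)] {t : ℝ} (ht : 0 < t) (ht1 : t < 1) (k : ℕ)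
    (x : E) : ∫ z, J d k z * smoothingError d t x z ∂(jacobiMeasure d) =
      (1 - Real.exp (-(eigenvalue d k * t))) * ∫ z in Set.Iic x, J d k z ∂(jacobiMeasure d) := by
  have hcont : Continuous fun p : E × E => J d k p.1 * heatKernel d t p.1 p.2 :=
    ((continuous_J k).comp continuous_fst).mul (continuous_heatKernel ht ht1)
  have hint : Integrable (fun p : E × E => J d k p.1 * heatKernel d t p.1 p.2)
      ((jacobiMeasure d).prod ((jacobiMeasure d).restrict (Set.Iic x))) :=
    hcont.integrable_of_hasCompactSupport (HasCompactSupport.of_compactSpace _)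
  have hswap := integral_integral_swap (f := fun z y => J d k z * heatKernel d t z y) hint
  simp only [integral_heatKernel_mul_J ht ht1, integral_const_mul] at hswap
  have h1 : ∀ z, J d k z * smoothingError d t x z = (Set.Iic x).indicator (J d k) z -
      J d k z * ∫ y in Set.Iic x, heatKernel d t z y ∂(jacobiMeasure d) := fun z => by
    rw [smoothingError, mul_sub]
    by_cases hz : z ∈ Set.Iic x <;> simp [hz]
  simp only [h1]
  have hi : Integrable (fun z => J d k z * ∫ y in Set.Iic x, heatKernel d t z y ∂(jacobiMeasure d))
      (jacobiMeasure d) := by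
    have := hint.integral_prod_left
    simpa only [integral_const_mul] using this
  rw [integral_sub ((integrable_of_continuous (continuous_J k)).indicator measurableSet_Iic) hi,
    integral_indicator measurableSet_Iic, hswap]
  ring

lemma integral_smoothingError [Fact (1 ≤ d)] {t : ℝ} (ht : 0 < t) (ht1 : t < 1) (x : E) :
    ∫ z, smoothingError d t x z ∂(jacobiMeasure d) = 0 := by
  have h := integral_J_mul_smoothingError (d := d) ht ht1 0 x
  have h0 : ∀ z, J d 0 z = 1 := fun z => by simp [J_eq, jacobiPoly_zero, normSq_zero]
  simpa [h0, eigenvalue_zero] using h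

lemma setIntegral_J_sq [Fact (1 ≤ d)] {k : ℕ} (hk : k ≠ 0) {x : E}
    (hx : (x : ℝ) ∈ Set.Ioo (-1 : ℝ) 1) :
    (∫ z in Set.Iic x, J d k z ∂(jacobiMeasure d)) ^ 2 / energyDensity d x =
      (eigenvalue d k ^ 2 * normSq d k)⁻¹ *
        ((1 - (x : ℝ) ^ 2) * (jacobiPoly d k).derivative.eval (x : ℝ) ^ 2) * density d x := by
  have h := eigenvalue_mul_setIntegral_jacobiPoly (d := d) k x
  have hl := eigenvalue_pos (d := d) hk
  have hN := normSq_pos (d := d) k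
  have hs := energyDensity_pos (d := d) hx
  have h1 : ∫ z in Set.Iic x, J d k z ∂(jacobiMeasure d) =
      (∫ z in Set.Iic x, (jacobiPoly d k).eval (z : ℝ) ∂(jacobiMeasure d)) / √(normSq d k) := by
    simp only [J_eq]
    rw [integral_div]
  have h2 : (∫ z in Set.Iic x, (jacobiPoly d k).eval (z : ℝ) ∂(jacobiMeasure d)) =
      -(energyDensity d x * (jacobiPoly d k).derivative.eval (x : ℝ)) / eigenvalue d k := by
    rw [← h]; field_simp
  rw [h1, h2, div_pow, Real.sq_sqrt hN.le, mul_assoc, mul_right_comm (1 - (x : ℝ) ^ 2),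
    one_sub_sq_mul_density hx]
  field_simp

lemma one_sub_exp_neg_sq_div_le [Fact (1 ≤ d)] {t : ℝ} (ht : 0 < t) (k : ℕ) :
    (1 - Real.exp (-(eigenvalue d (k + 1) * t))) ^ 2 / eigenvalue d (k + 1) ≤
      4 * d * √t * (1 / (1 + k * √t) - 1 / (1 + (k + 1 : ℕ) * √t)) := by
  have hd : 1 ≤ d := Fact.out
  set s := √t with hs
  have hs0 : 0 < s := Real.sqrt_pos.2 ht
  have hst : s ^ 2 = t := Real.sq_sqrt ht.le
  set l := eigenvalue d (k + 1) with hl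
  have hl0 : 0 < l := eigenvalue_pos (Nat.succ_ne_zero k)
  have hl1 := sq_le_eigenvalue (d := d) (k + 1)
  have hl2 := eigenvalue_le (d := d) (k + 1)
  rw [← hl] at hl1 hl2
  set e := Real.exp (-(l * t)) with he
  have he0 : 0 < e := Real.exp_pos _
  have he1 : e ≤ 1 := Real.exp_le_one_iff.2 (by have := mul_pos hl0 ht; linarith)
  have he2 : 1 - e ≤ l * t := by
    have := Real.add_one_le_exp (-(l * t)); linarith
  push_cast at hl1 hl2 ⊢
  have hk0 : (0 : ℝ) ≤ k := k.cast_nonneg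
  set m : ℝ := (k : ℝ) + 1 with hm
  have hm0 : 0 < m := by linarith
  -- both regimes `m² t ≤ 1` and `m² t ≥ 1` are compared with the same telescoping term
  have key : (1 - e) ^ 2 / l ≤ 4 * d * (s ^ 2 / (1 + m * s) ^ 2) := by
    rw [div_le_iff₀ hl0, ← mul_div_assoc, div_mul_eq_mul_div, le_div_iff₀ (by positivity)]
    rcases le_total (m * s) 1 with h | h
    · have h1 : (1 - e) ^ 2 ≤ (l * t) ^ 2 := pow_le_pow_left₀ (by linarith) he2 2
      have h2 : (1 + m * s) ^ 2 ≤ 4 := by nlinarith [mul_pos hm0 hs0]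
      have h3 : l * s ^ 2 ≤ d := by
        have : m ^ 2 * s ^ 2 ≤ 1 := by nlinarith [mul_pos hm0 hs0]
        nlinarith [mul_le_mul_of_nonneg_right hl2 (sq_nonneg s)]
      calc (1 - e) ^ 2 * (1 + m * s) ^ 2 ≤ (l * t) ^ 2 * 4 :=
            mul_le_mul h1 h2 (sq_nonneg _) (sq_nonneg _)
        _ = 4 * (l * s ^ 2) * s ^ 2 * l := by rw [← hst]; ring
        _ ≤ 4 * d * s ^ 2 * l := by gcongr
    · have h1 : (1 - e) ^ 2 ≤ 1 := by
        rw [sq_le_one_iff_abs_le_one, abs_of_nonneg (by linarith)]; linarith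
      have h2 : (1 + m * s) ^ 2 ≤ 4 * (m * s) ^ 2 := by nlinarith
      calc (1 - e) ^ 2 * (1 + m * s) ^ 2 ≤ 1 * (4 * (m * s) ^ 2) :=
            mul_le_mul h1 h2 (sq_nonneg _) zero_le_one
        _ = 4 * 1 * s ^ 2 * m ^ 2 := by ring
        _ ≤ 4 * d * s ^ 2 * l := by gcongr
  have hms : 0 ≤ (k : ℝ) * s := by positivity
  have h4 : s ^ 2 / (1 + m * s) ^ 2 ≤ s * (1 / (1 + k * s) - 1 / (1 + m * s)) := by
    have h5 : 1 / (1 + k * s) - 1 / (1 + m * s) = s / ((1 + k * s) * (1 + m * s)) := by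
      rw [hm]; field_simp; ring
    rw [h5, ← mul_div_assoc, ← sq, sq (1 + m * s)]
    refine div_le_div_of_nonneg_left (sq_nonneg s) (by positivity) ?_
    refine mul_le_mul_of_nonneg_right ?_ (by positivity)
    rw [hm]; nlinarith
  calc _ ≤ _ := key
    _ ≤ 4 * d * (s * (1 / (1 + k * s) - 1 / (1 + m * s))) := by gcongr
    _ = _ := by ring

/-- `∑_k (1 - e^{-λ_k t})² / λ_k` is of order `√t`. -/
lemma tsum_one_sub_exp_sq_div_le [Fact (1 ≤ d)] {t : ℝ} (ht : 0 < t) :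
    ∑' k, ENNReal.ofReal ((1 - Real.exp (-(eigenvalue d k * t))) ^ 2 / eigenvalue d k) ≤
      ENNReal.ofReal (4 * d * √t) := by
  have hd : 1 ≤ d := Fact.out
  have hnn : ∀ k, 0 ≤ (1 - Real.exp (-(eigenvalue d k * t))) ^ 2 / eigenvalue d k := fun k =>
    div_nonneg (sq_nonneg _) (eigenvalue_nonneg k)
  rw [ENNReal.tsum_eq_iSup_nat' (tendsto_add_atTop_nat 1)]
  refine iSup_le fun N => ?_
  rw [← ENNReal.ofReal_sum_of_nonneg fun k _ => hnn k]
  refine ENNReal.ofReal_le_ofReal ?_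
  rw [Finset.sum_range_succ']
  simp only [eigenvalue_zero, div_zero, add_zero]
  refine (Finset.sum_le_sum fun k _ => one_sub_exp_neg_sq_div_le ht k).trans ?_
  rw [← Finset.mul_sum, Finset.sum_range_sub' fun k : ℕ => 1 / (1 + (k : ℝ) * √t)]
  refine mul_le_of_le_one_right (by positivity) ?_
  have : 0 ≤ 1 / (1 + (N : ℝ) * √t) := by positivity
  simp only [Nat.cast_zero, zero_mul, add_zero, div_one]
  linarith

/-- The `H⁻¹` estimate for the regularization error. By Parseval, and since the primitive of `J_k`
is `-energyDensity * J_k' / λ_k`, the left-hand side is `∑_k (1 - e^{-λ_k t})² / λ_k`. -/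
lemma lintegral_smoothingError_le [Fact (1 ≤ d)] {t : ℝ} (ht : 0 < t) (ht1 : t < 1) :
    ∫⁻ x : E, ENNReal.ofReal
      ((∫ z, smoothingError d t x z ^ 2 ∂(jacobiMeasure d)) / energyDensity d x) ∂lebE ≤
      ENNReal.ofReal (4 * d * √t) := by
  refine le_trans ?_ (tsum_one_sub_exp_sq_div_le (d := d) ht)
  set a : ℕ → ℝ := fun k => (1 - Real.exp (-(eigenvalue d k * t))) ^ 2 with ha
  set f : ℕ → E → ℝ := fun k x => a k * (eigenvalue d k ^ 2 * normSq d k)⁻¹ *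
    ((1 - (x : ℝ) ^ 2) * (jacobiPoly d k).derivative.eval (x : ℝ) ^ 2) with hf
  have hfc : ∀ k, Continuous (f k) := fun k => by
    have : Continuous fun x : E => (jacobiPoly d k).derivative.eval (x : ℝ) :=
      (Polynomial.continuous _).comp continuous_subtype_val
    fun_prop
  have hfnn : ∀ k x, 0 ≤ f k x := fun k x => by
    have := (normSq_pos (d := d) k).le
    have := one_sub_sq_nonneg x.2
    positivity
  have hdm : Measurable fun x : E => ENNReal.ofReal (density d x) :=
    ((measurable_density d).comp measurable_subtype_coe).ennreal_ofReal
  have hpt : ∀ᵐ x : E ∂lebE, ENNReal.ofReal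
      ((∫ z, smoothingError d t x z ^ 2 ∂(jacobiMeasure d)) / energyDensity d x) =
      ∑' k, ENNReal.ofReal (density d x) * ENNReal.ofReal (f k x) := by
    filter_upwards [ae_mem_Ioo_lebE] with x hx
    have hs := energyDensity_pos (d := d) hx
    have hpars := hasSum_sq_integral_mul_J (d := d)
      (memLp_smoothingError (d := d) ht ht1 x (jacobiMeasure d) measurable_id)
    simp only [id, integral_J_mul_smoothingError ht ht1] at hpars
    have hpars' := hpars.div_const (energyDensity d x)
    have hterm : ∀ k, ((1 - Real.exp (-(eigenvalue d k * t))) *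
        ∫ z in Set.Iic x, J d k z ∂(jacobiMeasure d)) ^ 2 / energyDensity d x =
        density d x * f k x := by
      intro k
      rcases eq_or_ne k 0 with rfl | hk
      · simp [hf, ha, eigenvalue_zero]
      · rw [mul_pow, mul_div_assoc, setIntegral_J_sq hk hx]
        simp only [hf, ha]
        ring
    simp only [hterm] at hpars'
    rw [← hpars'.tsum_eq, ENNReal.ofReal_tsum_of_nonneg
      (fun k => mul_nonneg (density_nonneg (d := d) x.2) (hfnn k x)) hpars'.summable]
    exact tsum_congr fun k => ENNReal.ofReal_mul (density_nonneg (d := d) x.2)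
  have hterm_meas : ∀ k, Measurable fun x : E =>
      ENNReal.ofReal (density d x) * ENNReal.ofReal (f k x) := fun k =>
    hdm.mul (hfc k).measurable.ennreal_ofReal
  rw [lintegral_congr_ae hpt, lintegral_tsum fun k => (hterm_meas k).aemeasurable]
  refine ENNReal.tsum_le_tsum fun k => ?_
  have h1 : ∫⁻ x, ENNReal.ofReal (f k x) ∂(jacobiMeasure d) =
      ∫⁻ x : E, ENNReal.ofReal (density d x) * ENNReal.ofReal (f k x) ∂lebE :=
    lintegral_withDensity_eq_lintegral_mul _ hdm (hfc k).measurable.ennreal_ofReal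
  rw [← h1, ← ofReal_integral_eq_lintegral_ofReal (integrable_of_continuous (hfc k))
    (ae_of_all _ (hfnn k))]
  refine ENNReal.ofReal_le_ofReal (le_of_eq ?_)
  simp only [hf]
  rw [integral_const_mul, integral_derivative_sq]
  rcases eq_or_ne k 0 with rfl | hk
  · simp [eigenvalue_zero]
  · have hl := eigenvalue_pos (d := d) hk
    have hN := normSq_pos (d := d) k
    simp only [ha]
    field_simp

/-! ### The regularized empirical measure -/

/-- The density `n⁻¹ ∑_i p_t(x_i, ·)` of the regularized empirical measure. -/
def empiricalDensity (d t : ℝ) (n : ℕ) (x : ℕ → E) (y : E) : ℝ :=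
  (n : ℝ)⁻¹ * ∑ i ∈ Finset.range n, heatKernel d t (x i) y

lemma integral_empirical (n : ℕ) (x : ℕ → E) (f : E → ℝ) :
    ∫ z, f z ∂(empirical n x) = (n : ℝ)⁻¹ * ∑ i ∈ Finset.range n, f (x i) := by
  rw [empirical, integral_smul_measure, integral_finsetSum_measure fun i _ =>
    integrable_dirac (by simp)]
  simp

lemma isProbabilityMeasure_empirical {n : ℕ} (hn : n ≠ 0) (x : ℕ → E) :
    IsProbabilityMeasure (empirical n x) := by
  constructor
  simp only [empirical, Measure.smul_apply, Measure.finsetSum_apply, measure_univ, Finset.sum_const,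
    Finset.card_range, smul_eq_mul, nsmul_eq_mul, mul_one]
  exact ENNReal.inv_mul_cancel (by simpa using hn) (by simp)

lemma heatFlow_empirical (t : ℝ) (n : ℕ) (x : ℕ → E) : heatFlow d t (empirical n x) =
    (jacobiMeasure d).withDensity fun y => ENNReal.ofReal (empiricalDensity d t n x y) := by
  simp only [heatFlow, integral_empirical, empiricalDensity]

lemma continuous_empiricalDensity [Fact (1 ≤ d)] {t : ℝ} (ht : 0 < t) (ht1 : t < 1) (n : ℕ)
    (x : ℕ → E) : Continuous (empiricalDensity d t n x) :=
  continuous_const.mul (continuous_finsetSum _ fun i _ => continuous_heatKernel_right ht ht1 (x i))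

lemma empiricalDensity_nonneg_ae [Fact (1 ≤ d)] {t : ℝ} (ht : 0 < t) (ht1 : t < 1) (n : ℕ)
    (x : ℕ → E) : ∀ᵐ y ∂(jacobiMeasure d), 0 ≤ empiricalDensity d t n x y := by
  filter_upwards [ae_all_iff.2 fun i => heatKernel_nonneg_ae ht ht1 (x i)] with y hy
  exact mul_nonneg (by positivity) (Finset.sum_nonneg fun i _ => hy i)

lemma heatFlow_empirical_apply [Fact (1 ≤ d)] {t : ℝ} (ht : 0 < t) (ht1 : t < 1) (n : ℕ)
    (x : ℕ → E) {s : Set E} (hs : MeasurableSet s) : heatFlow d t (empirical n x) s =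
      ENNReal.ofReal (∫ y in s, empiricalDensity d t n x y ∂(jacobiMeasure d)) := by
  rw [heatFlow_empirical, withDensity_apply _ hs, ofReal_integral_eq_lintegral_ofReal
    (integrable_of_continuous (continuous_empiricalDensity ht ht1 n x)).integrableOn
    (ae_restrict_of_ae (empiricalDensity_nonneg_ae ht ht1 n x))]

lemma isProbabilityMeasure_heatFlow_empirical [Fact (1 ≤ d)] {t : ℝ} (ht : 0 < t) (ht1 : t < 1)
    {n : ℕ} (hn : n ≠ 0) (x : ℕ → E) : IsProbabilityMeasure (heatFlow d t (empirical n x)) := by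
  constructor
  have hn' : (n : ℝ) ≠ 0 := by exact_mod_cast hn
  rw [heatFlow_empirical_apply ht ht1 n x MeasurableSet.univ, setIntegral_univ]
  simp only [empiricalDensity]
  rw [integral_const_mul, integral_finsetSum _ fun i _ =>
    integrable_of_continuous (continuous_heatKernel_right ht ht1 (x i))]
  simp [integral_heatKernel_right ht ht1, hn']

lemma nullSingletonClass_heatFlow (t : ℝ) (ν : Measure E) :
    NullSingletonClass (heatFlow d t ν) :=
  ⟨fun _ => withDensity_absolutelyContinuous _ _ (measure_singleton _)⟩

lemma real_Iic_heatFlow_sub_empirical [Fact (1 ≤ d)] {t : ℝ} (ht : 0 < t) (ht1 : t < 1) (n : ℕ)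
    (x : ℕ → E) (a : E) :
    (heatFlow d t (empirical n x)).real (Set.Iic a) - (empirical n x).real (Set.Iic a) =
      -((n : ℝ)⁻¹ * ∑ i ∈ Finset.range n, smoothingError d t a (x i)) := by
  have h1 : (empirical n x).real (Set.Iic a) =
      (n : ℝ)⁻¹ * ∑ i ∈ Finset.range n, (Set.Iic a).indicator (fun _ => (1 : ℝ)) (x i) := by
    rw [← integral_empirical n x, integral_indicator measurableSet_Iic]
    simp
  have hi : ∀ i ∈ Finset.range n, IntegrableOn (fun y => heatKernel d t (x i) y) (Set.Iic a)
      (jacobiMeasure d) := fun i _ =>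
    (integrable_of_continuous (continuous_heatKernel_right ht ht1 (x i))).integrableOn
  have h2 : (heatFlow d t (empirical n x)).real (Set.Iic a) = (n : ℝ)⁻¹ *
      ∑ i ∈ Finset.range n, ∫ y in Set.Iic a, heatKernel d t (x i) y ∂(jacobiMeasure d) := by
    rw [Measure.real, heatFlow_empirical_apply ht ht1 n x measurableSet_Iic, ENNReal.toReal_ofReal
      (setIntegral_nonneg_of_ae (empiricalDensity_nonneg_ae ht ht1 n x))]
    simp only [empiricalDensity]
    rw [integral_const_mul, integral_finsetSum _ hi]
  rw [h1, h2, ← mul_sub, ← mul_neg, ← Finset.sum_sub_distrib, ← Finset.sum_neg_distrib]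
  simp only [smoothingError, neg_sub]

lemma fluctuation_div_sqrt [Fact (1 ≤ d)] {t : ℝ} (ht : 0 < t) (ht1 : t < 1) {n : ℕ}
    (hn : n ≠ 0) (x : ℕ → E) (y : E) :
    fluctuation d t n x y / √n = empiricalDensity d t n x y - 1 := by
  have hn' : (n : ℝ) ≠ 0 := by exact_mod_cast hn
  have hs : √(n : ℝ) ≠ 0 := Real.sqrt_ne_zero'.2 (by positivity)
  have h0 : ∫ z, (heatKernel d t z y - 1) ∂(jacobiMeasure d) = 0 := by
    rw [integral_sub (integrable_of_continuous (continuous_heatKernel_left ht ht1 y))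
      (integrable_const _), integral_heatKernel_left ht ht1]
    simp
  rw [fluctuation, h0, integral_empirical, mul_div_cancel_left₀ _ hs, sub_zero,
    Finset.sum_sub_distrib, mul_sub, empiricalDensity]
  simp [hn']

lemma mem_eventA_iff [Fact (1 ≤ d)] {t : ℝ} (ht : 0 < t) (ht1 : t < 1) {n : ℕ} (hn : n ≠ 0)
    {Ω : Type*} (X : ℕ → Ω → E) (ω : Ω) : ω ∈ eventA d t n X ↔
      ∀ y, |empiricalDensity d t n (fun i => X i ω) y - 1| ≤ 1 / 2 := by
  have h2 : (1 / 2 : ℝ≥0∞) = ENNReal.ofReal (1 / 2) := by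
    rw [ENNReal.ofReal_div_of_pos (by norm_num)]; norm_num
  rw [eventA, Set.mem_ofPred_eq, iSup_le_iff]
  refine forall_congr' fun y => ?_
  rw [h2, ENNReal.ofReal_le_ofReal_iff (by norm_num), ← fluctuation_div_sqrt ht ht1 hn, abs_div,
    abs_of_nonneg (Real.sqrt_nonneg _)]

/-- If the regularized density stays above `1/2`, then `μ ≤ 2 P_t^* μ^n`. -/
lemma jacobiMeasure_le_two_smul [Fact (1 ≤ d)] {t : ℝ} {n : ℕ} {x : ℕ → E}
    (h : ∀ y, |empiricalDensity d t n x y - 1| ≤ 1 / 2) :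
    jacobiMeasure d ≤ (2 : ℝ≥0∞) • heatFlow d t (empirical n x) := by
  rw [heatFlow_empirical]
  refine Measure.le_iff.2 fun s hs => ?_
  rw [Measure.smul_apply, withDensity_apply _ hs, smul_eq_mul,
    ← lintegral_const_mul' _ _ (by norm_num : (2 : ℝ≥0∞) ≠ ∞)]
  calc jacobiMeasure d s = ∫⁻ _ in s, 1 ∂(jacobiMeasure d) := by simp
    _ ≤ _ := by
      refine lintegral_mono fun y => ?_
      have h1 := (abs_le.1 (h y)).1
      have h2 : (2 : ℝ≥0∞) = ENNReal.ofReal 2 := by norm_num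
      rw [h2, ← ENNReal.ofReal_mul (by norm_num), ← ENNReal.ofReal_one]
      exact ENNReal.ofReal_le_ofReal (by linarith)

/-! ### The expected cost -/

/-- Second moment of the average of the regularization error over the sample. -/
lemma integral_average_smoothingError_sq [Fact (1 ≤ d)] {t : ℝ} (ht : 0 < t) (ht1 : t < 1)
    {Ω : Type*} [MeasurableSpace Ω] {P : Measure Ω} [IsProbabilityMeasure P] {X : ℕ → Ω → E}
    (hX : IsSample P d X) {n : ℕ} (hn : n ≠ 0) (a : E) :
    ∫ ω, ((n : ℝ)⁻¹ * ∑ i ∈ Finset.range n, smoothingError d t a (X i ω)) ^ 2 ∂P =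
      (n : ℝ)⁻¹ * ∫ z, smoothingError d t a z ^ 2 ∂(jacobiMeasure d) := by
  have hn' : (n : ℝ) ≠ 0 := by exact_mod_cast hn
  set Z : ℕ → Ω → ℝ := fun i ω => smoothingError d t a (X i ω) with hZ
  have hm : Measurable (smoothingError d t a) :=
    (measurable_smoothingError ht ht1).comp measurable_prodMk_left
  have hL : ∀ i, MemLp (Z i) 2 P := fun i => memLp_smoothingError ht ht1 a P (hX.measurable i)
  have hint : ∀ (i : ℕ) (f : E → ℝ), Measurable f →
      ∫ ω, f (X i ω) ∂P = ∫ z, f z ∂(jacobiMeasure d) := fun i f hf => by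
    rw [← hX.map_eq i, integral_map (hX.measurable i).aemeasurable hf.aestronglyMeasurable]
  have h0 : ∀ i, ∫ ω, Z i ω ∂P = 0 := fun i => by
    rw [hint i _ hm, integral_smoothingError ht ht1]
  have hvar : ∀ i, variance (Z i) P = ∫ z, smoothingError d t a z ^ 2 ∂(jacobiMeasure d) :=
    fun i => by
      rw [variance_of_integral_eq_zero (hL i).aemeasurable (h0 i)]
      exact hint i _ (hm.pow_const 2)
  have hsum := IndepFun.variance_sum (s := Finset.range n) (fun i _ => hL i)
    (fun i _ j _ hij => (hX.indep.indepFun hij).comp hm hm)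
  rw [variance_of_integral_eq_zero
    (Finset.aemeasurable_sum _ fun i _ => (hL i).aemeasurable) (by
      simp only [Finset.sum_apply]
      rw [integral_finsetSum _ fun i _ => (hL i).integrable one_le_two]
      simp [h0])] at hsum
  simp only [Finset.sum_apply, hvar, Finset.sum_const, Finset.card_range, nsmul_eq_mul] at hsum
  simp only [mul_pow]
  rw [integral_const_mul, hsum]
  field_simp

/-- The expected regularization cost, up to the event where the regularized density is small. -/
lemma expectedCost_le [Fact (1 ≤ d)] {t : ℝ} (ht : 0 < t) (ht1 : t < 1)
    {Ω : Type*} [MeasurableSpace Ω] {P : Measure Ω} [IsProbabilityMeasure P] {X : ℕ → Ω → E}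
    (hX : IsSample P d X) {n : ℕ} (hn : n ≠ 0) :
    expectedCost P d t n X ≤ ENNReal.ofReal (Real.pi ^ 2 + 32 * d) *
      (P (eventA d t n X)ᶜ + ENNReal.ofReal (√t / n)) := by
  have hd : 1 ≤ d := Fact.out
  have hn0 : (0 : ℝ) < n := by exact_mod_cast Nat.pos_of_ne_zero hn
  set avg : Ω → E → ℝ := fun ω a =>
    (n : ℝ)⁻¹ * ∑ i ∈ Finset.range n, smoothingError d t a (X i ω) with havg
  have havgm : Measurable fun p : Ω × E => avg p.1 p.2 := by
    refine measurable_const.mul (Finset.measurable_sum _ fun i _ => ?_)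
    exact (measurable_smoothingError ht ht1).comp
      (measurable_snd.prodMk ((hX.measurable i).comp measurable_fst))
  have hem : Measurable fun p : Ω × E => energyDensity d p.2 :=
    continuous_energyDensity.measurable.comp (measurable_subtype_coe.comp measurable_snd)
  have hGm : Measurable fun p : Ω × E =>
      ENNReal.ofReal (avg p.1 p.2 ^ 2 / energyDensity d p.2) :=
    ((havgm.pow_const 2).div hem).ennreal_ofReal
  set Q : Ω → ℝ≥0∞ := fun ω => ∫⁻ a : E, ENNReal.ofReal (avg ω a ^ 2 / energyDensity d a) ∂lebE
    with hQ
  have hQm : Measurable Q := hGm.lintegral_prod_right'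
  have hpt : ∀ ω, W2 (empirical n fun i => X i ω) (heatFlow d t (empirical n fun i => X i ω)) ^ 2 ≤
      (eventA d t n X)ᶜ.indicator (fun _ => ENNReal.ofReal (Real.pi ^ 2)) ω + 8 * Q ω := by
    intro ω
    have := isProbabilityMeasure_empirical hn fun i => X i ω
    have := isProbabilityMeasure_heatFlow_empirical (d := d) ht ht1 hn fun i => X i ω
    have := nullSingletonClass_heatFlow (d := d) t (empirical n fun i => X i ω)
    by_cases hω : ω ∈ eventA d t n X
    · refine le_add_left ?_
      have h := W2_sq_le_lintegral (ν := empirical n fun i => X i ω)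
        (jacobiMeasure_le_two_smul ((mem_eventA_iff ht ht1 hn X ω).1 hω))
      simpa only [real_Iic_heatFlow_sub_empirical ht ht1, neg_sq] using h
    · rw [Set.indicator_of_mem (by exact hω)]
      exact le_add_right (W2_sq_le_pi_sq _ _)
  have hEQ : ∫⁻ ω, Q ω ∂P ≤ ENNReal.ofReal (4 * d * (√t / n)) := by
    have hswap : ∫⁻ ω, Q ω ∂P =
        ∫⁻ a : E, ∫⁻ ω, ENNReal.ofReal (avg ω a ^ 2 / energyDensity d a) ∂P ∂lebE :=
      lintegral_lintegral_swap hGm.aemeasurable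
    have hin : ∀ᵐ a : E ∂lebE, ∫⁻ ω, ENNReal.ofReal (avg ω a ^ 2 / energyDensity d a) ∂P =
        ENNReal.ofReal (n : ℝ)⁻¹ * ENNReal.ofReal
          ((∫ z, smoothingError d t a z ^ 2 ∂(jacobiMeasure d)) / energyDensity d a) := by
      filter_upwards [ae_mem_Ioo_lebE] with a ha
      have hs := energyDensity_pos (d := d) ha
      have hL : MemLp (avg · a) 2 P := by
        have := memLp_finsetSum (Finset.range n) fun i _ =>
          memLp_smoothingError (d := d) ht ht1 a P (hX.measurable i)
        exact this.const_mul _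
      rw [← ofReal_integral_eq_lintegral_ofReal (hL.integrable_sq.div_const _)
        (ae_of_all _ fun ω => div_nonneg (sq_nonneg _) hs.le), integral_div,
        integral_average_smoothingError_sq ht ht1 hX hn, mul_div_assoc,
        ENNReal.ofReal_mul (by positivity)]
    rw [hswap, lintegral_congr_ae hin, lintegral_const_mul' _ _ ENNReal.ofReal_ne_top]
    refine (mul_le_mul_right (lintegral_smoothingError_le (d := d) ht ht1) _).trans_eq ?_
    rw [← ENNReal.ofReal_mul (by positivity)]
    congr 1
    field_simp
  calc expectedCost P d t n X
      ≤ ∫⁻ ω, ((eventA d t n X)ᶜ.indicator (fun _ => ENNReal.ofReal (Real.pi ^ 2)) ω + 8 * Q ω) ∂P :=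
        lintegral_mono hpt
    _ = ∫⁻ ω, (eventA d t n X)ᶜ.indicator (fun _ => ENNReal.ofReal (Real.pi ^ 2)) ω ∂P +
        8 * ∫⁻ ω, Q ω ∂P := by
        rw [lintegral_add_right _ (hQm.const_mul 8), lintegral_const_mul _ hQm]
    _ ≤ ENNReal.ofReal (Real.pi ^ 2) * P (eventA d t n X)ᶜ +
        8 * ENNReal.ofReal (4 * d * (√t / n)) :=
        add_le_add (lintegral_indicator_const_le _ _) (mul_le_mul_right hEQ 8)
    _ ≤ _ := by
        rw [mul_add]
        refine add_le_add (mul_le_mul_left (ENNReal.ofReal_le_ofReal (by linarith)) _) ?_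
        have h8 : (8 : ℝ≥0∞) = ENNReal.ofReal 8 := by norm_num
        rw [h8, ← ENNReal.ofReal_mul (by norm_num), ← ENNReal.ofReal_mul (by positivity)]
        refine ENNReal.ofReal_le_ofReal ?_
        have h1 : 0 ≤ √t / n := by positivity
        have h2 := mul_nonneg (sq_nonneg Real.pi) h1
        linarith

/-! ### Concentration of the regularized density -/

/-- Bernstein's inequality for centred variables bounded by `2K` with variance at most `K`, at
the deviation `1/4` of the average. -/
lemma measureReal_sum_ge_le {Ω : Type*} [MeasurableSpace Ω] {P : Measure Ω}
    [IsProbabilityMeasure P] {Z : ℕ → Ω → ℝ} (hZ : ∀ i, Measurable (Z i)) (hind : iIndepFun Z P)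
    {K : ℝ} (hK : 0 < K) (hb : ∀ i ω, |Z i ω| ≤ 2 * K) (h0 : ∀ i, ∫ ω, Z i ω ∂P = 0)
    (h2 : ∀ i, ∫ ω, Z i ω ^ 2 ∂P ≤ K) (n : ℕ) :
    P.real {ω | (n : ℝ) / 4 ≤ ∑ i ∈ Finset.range n, Z i ω} ≤ Real.exp (-(n / (64 * K))) := by
  -- The exponential moment is optimized by `s = 1 / (8K)`, and then `|s Z| ≤ 1`.
  set s : ℝ := 1 / (8 * K) with hs
  have hs0 : 0 < s := by positivity
  have hsK : s * K = 1 / 8 := by rw [hs]; field_simp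
  have hsZ : ∀ i ω, |s * Z i ω| ≤ 1 := fun i ω => by
    rw [abs_mul, abs_of_pos hs0]
    nlinarith [mul_le_mul_of_nonneg_left (hb i ω) hs0.le]
  have hbd : ∀ {f : Ω → ℝ}, Measurable f → (∃ M, ∀ ω, |f ω| ≤ M) → Integrable f P :=
    fun hf ⟨M, hM⟩ => .of_bound hf.aestronglyMeasurable M (ae_of_all _ hM)
  have hint : ∀ i, Integrable (Z i) P := fun i => hbd (hZ i) ⟨_, hb i⟩
  have hint2 : ∀ i, Integrable (fun ω => Z i ω ^ 2) P := fun i =>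
    hbd ((hZ i).pow_const 2) ⟨(2 * K) ^ 2, fun ω => by
      rw [abs_pow]; exact pow_le_pow_left₀ (abs_nonneg _) (hb i ω) 2⟩
  have hmgf : ∀ i, mgf (Z i) P s ≤ Real.exp (s / 8) := by
    intro i
    calc mgf (Z i) P s ≤ ∫ ω, (1 + s * Z i ω + s ^ 2 * Z i ω ^ 2) ∂P := by
          refine integral_mono (hbd (by fun_prop) ⟨Real.exp 1, fun ω => ?_⟩)
            (((integrable_const _).add ((hint i).const_mul _)).add ((hint2 i).const_mul _))
            fun ω => ?_
          · rw [Real.abs_exp]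
            exact Real.exp_le_exp.2 ((le_abs_self _).trans (hsZ i ω))
          · have h := (abs_le.1 (Real.abs_exp_sub_one_sub_id_le (hsZ i ω))).2
            simp only
            linarith [mul_pow s (Z i ω) 2]
      _ = 1 + s ^ 2 * ∫ ω, Z i ω ^ 2 ∂P := by
          have hlin : Integrable (fun ω => 1 + s * Z i ω) P :=
            (integrable_const _).add ((hint i).const_mul _)
          rw [integral_add hlin ((hint2 i).const_mul _), integral_add (integrable_const _)
            ((hint i).const_mul _), integral_const_mul, integral_const_mul, h0]
          simp
      _ ≤ 1 + s / 8 := by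
          have := mul_le_mul_of_nonneg_left (h2 i) (sq_nonneg s)
          have e : s ^ 2 * K = s / 8 := by rw [sq, mul_assoc, hsK]; ring
          linarith
      _ ≤ _ := by linarith [Real.add_one_le_exp (s / 8)]
  have hsum : mgf (fun ω => ∑ i ∈ Finset.range n, Z i ω) P s ≤ Real.exp (s / 8) ^ n := by
    have h := hind.mgf_sum hZ (Finset.range n) (t := s)
    have e : (∑ i ∈ Finset.range n, Z i) = fun ω => ∑ i ∈ Finset.range n, Z i ω := by
      ext ω; simp
    rw [e] at h
    rw [h]
    refine (Finset.prod_le_prod (fun i _ => mgf_nonneg) fun i _ => hmgf i).trans_eq ?_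
    simp
  have hE : Integrable (fun ω => Real.exp (s * ∑ i ∈ Finset.range n, Z i ω)) P := by
    have hm : Measurable fun ω => ∑ i ∈ Finset.range n, Z i ω :=
      Finset.measurable_sum _ fun i _ => hZ i
    refine hbd (by fun_prop) ⟨Real.exp n, fun ω => ?_⟩
    rw [Real.abs_exp, Finset.mul_sum]
    refine Real.exp_le_exp.2 ((Finset.sum_le_card_nsmul _ _ 1 fun i _ =>
      (le_abs_self _).trans (hsZ i ω)).trans_eq ?_)
    simp
  refine (measure_ge_le_exp_mul_mgf _ hs0.le hE).trans
    ((mul_le_mul_of_nonneg_left hsum (Real.exp_pos _).le).trans_eq ?_)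
  rw [← Real.exp_nat_mul, ← Real.exp_add]
  congr 1
  rw [hs]
  field_simp
  ring

/-- The variance of `p_t(X, y)` is at most the supremum of the kernel, since `p_t ≥ 0` and
`∫ p_t dμ = 1`. -/
lemma integral_heatKernel_sub_one_sq_le [Fact (1 ≤ d)] {t : ℝ} (ht : 0 < t) (ht1 : t < 1) (y : E) :
    ∫ z, (heatKernel d t z y - 1) ^ 2 ∂(jacobiMeasure d) ≤ heatTrace d t := by
  have hc := continuous_heatKernel_left (d := d) ht ht1 y
  have h1 := integral_heatKernel_left (d := d) ht ht1 y
  have hi : Integrable (fun z => heatKernel d t z y) (jacobiMeasure d) :=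
    integrable_of_continuous hc
  calc ∫ z, (heatKernel d t z y - 1) ^ 2 ∂(jacobiMeasure d)
      ≤ ∫ z, ((heatTrace d t - 2) * heatKernel d t z y + 1) ∂(jacobiMeasure d) := by
        refine integral_mono_ae (integrable_of_continuous ((hc.sub continuous_const).pow 2))
          ((hi.const_mul _).add (integrable_const _)) ?_
        filter_upwards [heatKernel_nonneg_ae (d := d) ht ht1 y] with z hz
        rw [heatKernel_comm] at hz
        have := (le_abs_self _).trans (abs_heatKernel_le (d := d) ht ht1 z y)
        nlinarith [mul_le_mul_of_nonneg_left this hz]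
    _ = heatTrace d t - 1 := by
        rw [integral_add (hi.const_mul _) (integrable_const _), integral_const_mul, h1]
        simp; ring
    _ ≤ _ := by linarith

/-- Bernstein's inequality for the regularized density at a fixed point. -/
lemma measureReal_quarter_le [Fact (1 ≤ d)] {t : ℝ} (ht : 0 < t) (ht1 : t < 1)
    {Ω : Type*} [MeasurableSpace Ω] {P : Measure Ω} [IsProbabilityMeasure P] {X : ℕ → Ω → E}
    (hX : IsSample P d X) {n : ℕ} (hn : n ≠ 0) (y : E) :
    P.real {ω | 1 / 4 ≤ |empiricalDensity d t n (fun i => X i ω) y - 1|} ≤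
      2 * Real.exp (-(n / (64 * heatTrace d t))) := by
  have hn0 : (0 : ℝ) < n := by exact_mod_cast Nat.pos_of_ne_zero hn
  have hK := one_le_heatTrace (d := d) ht ht1
  have hc : Measurable fun z => heatKernel d t z y :=
    (continuous_heatKernel_left (d := d) ht ht1 y).measurable
  have key : ∀ ε : ℝ, ε ^ 2 = 1 →
      P.real {ω | (n : ℝ) / 4 ≤ ∑ i ∈ Finset.range n, ε * (heatKernel d t (X i ω) y - 1)} ≤
        Real.exp (-(n / (64 * heatTrace d t))) := by
    intro ε hε
    have habs : |ε| = 1 := by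
      rw [← abs_one]; exact (sq_eq_sq_iff_abs_eq_abs _ _).1 (by rw [hε, one_pow])
    have hfm : Measurable fun z => ε * (heatKernel d t z y - 1) := by fun_prop
    have hmap : ∀ (i : ℕ) (f : E → ℝ), Measurable f →
        ∫ ω, f (X i ω) ∂P = ∫ z, f z ∂(jacobiMeasure d) := fun i f hf => by
      rw [← hX.map_eq i, integral_map (hX.measurable i).aemeasurable hf.aestronglyMeasurable]
    refine measureReal_sum_ge_le (fun i => hfm.comp (hX.measurable i))
      (hX.indep.comp (fun _ z => ε * (heatKernel d t z y - 1)) fun _ => hfm) (by linarith)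
      (fun i ω => ?_) (fun i => ?_) (fun i => ?_) n
    · rw [Function.comp_apply, abs_mul, habs, one_mul]
      refine (abs_sub _ _).trans ?_
      rw [abs_one]
      linarith [abs_heatKernel_le (d := d) ht ht1 (X i ω) y]
    · simp only [Function.comp_apply]
      rw [hmap i (fun z => ε * (heatKernel d t z y - 1)) hfm, integral_const_mul, integral_sub
        (integrable_of_continuous (continuous_heatKernel_left ht ht1 y)) (integrable_const _),
        integral_heatKernel_left ht ht1]
      simp
    · simp only [Function.comp_apply]
      rw [hmap i (fun z => (ε * (heatKernel d t z y - 1)) ^ 2) (hfm.pow_const 2)]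
      simp only [mul_pow, hε, one_mul]
      exact integral_heatKernel_sub_one_sq_le ht ht1 y
  have hsub : {ω | 1 / 4 ≤ |empiricalDensity d t n (fun i => X i ω) y - 1|} ⊆
      {ω | (n : ℝ) / 4 ≤ ∑ i ∈ Finset.range n, 1 * (heatKernel d t (X i ω) y - 1)} ∪
      {ω | (n : ℝ) / 4 ≤ ∑ i ∈ Finset.range n, (-1) * (heatKernel d t (X i ω) y - 1)} := by
    intro ω hω
    have e : (n : ℝ) * (empiricalDensity d t n (fun i => X i ω) y - 1) =
        ∑ i ∈ Finset.range n, (heatKernel d t (X i ω) y - 1) := by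
      rw [empiricalDensity, mul_sub, mul_inv_cancel_left₀ hn0.ne', Finset.sum_sub_distrib]
      simp
    simp only [Set.mem_union, Set.mem_ofPred_eq, ← Finset.mul_sum, ← e] at hω ⊢
    rcases le_abs'.1 hω with h | h
    · right; nlinarith
    · left; nlinarith
  refine (measureReal_mono hsub).trans ((measureReal_union_le _ _).trans ?_)
  rw [two_mul]
  exact add_le_add (key 1 (by norm_num)) (key (-1) (by norm_num))

/-- The points `cos (π j / m)`, `0 ≤ j ≤ m`, form a `π / m`-net for the intrinsic distance. -/
def netPoint (m j : ℕ) : E := ⟨Real.cos (Real.pi * j / m), Real.neg_one_le_cos _, Real.cos_le_one _⟩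

lemma exists_rho_netPoint_le {m : ℕ} (hm : m ≠ 0) (y : E) :
    ∃ j ∈ Finset.range (m + 1), rho (netPoint m j) y ≤ Real.pi / m := by
  have hm0 : (0 : ℝ) < m := by exact_mod_cast Nat.pos_of_ne_zero hm
  have hpi := Real.pi_pos
  set a : ℝ := Real.arccos y with ha
  have ha0 : 0 ≤ a := Real.arccos_nonneg _
  have hapi : a ≤ Real.pi := Real.arccos_le_pi _
  set u : ℝ := m * a / Real.pi with hu
  have hu0 : 0 ≤ u := by positivity
  have hau : a = Real.pi * u / m := by rw [hu]; field_simp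
  have hum : u ≤ m := by
    rw [hu, div_le_iff₀ hpi]; exact mul_le_mul_of_nonneg_left hapi hm0.le
  have h1 := Nat.floor_le hu0
  have h2 := Nat.lt_floor_add_one u
  refine ⟨⌊u⌋₊, ?_, ?_⟩
  · rw [Finset.mem_range, Nat.lt_succ_iff]
    exact Nat.floor_le_of_le hum
  · have h3 : Real.arccos (netPoint m ⌊u⌋₊ : ℝ) = Real.pi * ⌊u⌋₊ / m := by
      refine Real.arccos_cos (by positivity) ?_
      rw [div_le_iff₀ hm0]
      exact mul_le_mul_of_nonneg_left (h1.trans hum) hpi.le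
    rw [rho, h3, ← ha, hau, ← sub_div, ← mul_sub, abs_div, abs_mul, abs_of_pos hpi,
      abs_of_pos hm0]
    refine div_le_div_of_nonneg_right ?_ hm0.le
    exact mul_le_of_le_one_right hpi.le (abs_le.2 ⟨by linarith, by linarith⟩)

lemma abs_empiricalDensity_sub_le [Fact (1 ≤ d)] {t : ℝ} (ht : 0 < t) (ht1 : t < 1) {n : ℕ}
    (hn : n ≠ 0) (x : ℕ → E) (y z : E) :
    |empiricalDensity d t n x y - empiricalDensity d t n x z| ≤
      2 / t * heatTrace d (t / 2) * rho y z := by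
  have hn0 : (0 : ℝ) < n := by exact_mod_cast Nat.pos_of_ne_zero hn
  rw [empiricalDensity, empiricalDensity, ← mul_sub, ← Finset.sum_sub_distrib, abs_mul,
    abs_of_pos (inv_pos.2 hn0), inv_mul_le_iff₀ hn0]
  refine (Finset.abs_sum_le_sum_abs _ _).trans ((Finset.sum_le_card_nsmul _ _ _ fun i _ =>
    abs_heatKernel_sub_le ht ht1 (x i) y z).trans_eq ?_)
  simp

/-- Union bound over a net fine enough for the Lipschitz constant of the kernel. -/
lemma measureReal_compl_eventA_le [Fact (1 ≤ d)] {t : ℝ} (ht : 0 < t) (ht1 : t < 1)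
    {Ω : Type*} [MeasurableSpace Ω] {P : Measure Ω} [IsProbabilityMeasure P] {X : ℕ → Ω → E}
    (hX : IsSample P d X) {n : ℕ} (hn : n ≠ 0) :
    P.real (eventA d t n X)ᶜ ≤ (4 * Real.pi * (2 / t * heatTrace d (t / 2)) + 2) *
      (2 * Real.exp (-(n / (64 * heatTrace d t)))) := by
  have hpi := Real.pi_pos
  have hL0 : 0 < 2 / t * heatTrace d (t / 2) := mul_pos (by positivity)
    (zero_lt_one.trans_le (one_le_heatTrace (d := d) (by linarith) (by linarith)))
  set L : ℝ := 2 / t * heatTrace d (t / 2) with hL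
  set m : ℕ := ⌈4 * Real.pi * L⌉₊ with hm
  have hm0 : 0 < m := Nat.ceil_pos.2 (by positivity)
  have hmr : (0 : ℝ) < m := by exact_mod_cast hm0
  have hLm : L * (Real.pi / m) ≤ 1 / 4 := by
    have := Nat.le_ceil (4 * Real.pi * L)
    rw [← mul_div_assoc, div_le_iff₀ hmr]
    linarith
  have hm1 : (m : ℝ) ≤ 4 * Real.pi * L + 1 := (Nat.ceil_lt_add_one (by positivity)).le
  have hsub : (eventA d t n X)ᶜ ⊆ ⋃ j ∈ Finset.range (m + 1),
      {ω | 1 / 4 ≤ |empiricalDensity d t n (fun i => X i ω) (netPoint m j) - 1|} := by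
    intro ω hω
    rw [Set.mem_compl_iff, mem_eventA_iff ht ht1 hn] at hω
    push Not at hω
    obtain ⟨y, hy⟩ := hω
    obtain ⟨j, hj, hjy⟩ := exists_rho_netPoint_le hm0.ne' y
    refine Set.mem_biUnion hj ?_
    have h1 := (abs_empiricalDensity_sub_le (d := d) ht ht1 hn (fun i => X i ω)
      (netPoint m j) y).trans ((mul_le_mul_of_nonneg_left hjy hL0.le).trans hLm)
    have h2 := abs_sub_le (empiricalDensity d t n (fun i => X i ω) y)
      (empiricalDensity d t n (fun i => X i ω) (netPoint m j)) 1
    rw [abs_sub_comm] at h1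
    simp only [Set.mem_ofPred_eq]
    linarith
  calc P.real (eventA d t n X)ᶜ
      ≤ ∑ j ∈ Finset.range (m + 1),
        P.real {ω | 1 / 4 ≤ |empiricalDensity d t n (fun i => X i ω) (netPoint m j) - 1|} :=
        (measureReal_mono hsub (measure_ne_top _ _)).trans (measureReal_biUnion_finset_le _ _)
    _ ≤ (m + 1) * (2 * Real.exp (-(n / (64 * heatTrace d t)))) := by
        refine (Finset.sum_le_card_nsmul _ _ _ fun j _ =>
          measureReal_quarter_le ht ht1 hX hn (netPoint m j)).trans_eq ?_
        simp
    _ ≤ _ := mul_le_mul_of_nonneg_right (by linarith) (by positivity)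

lemma exists_measureReal_compl_eventA_le (d : ℝ) [Fact (1 ≤ d)] : ∃ C : ℝ, 0 < C ∧
    ∀ {Ω : Type*} [MeasurableSpace Ω] (P : Measure Ω) [IsProbabilityMeasure P] (X : ℕ → Ω → E),
      IsSample P d X → ∀ n : ℕ, n ≠ 0 → ∀ t : ℝ, 0 < t → t < 1 →
        P.real (eventA d t n X)ᶜ ≤
          C * t ^ (-(1 + d / 2)) * Real.exp (-(n * t ^ (d / 2) / C)) := by
  have hd : 1 ≤ d := Fact.out
  obtain ⟨C, hC, h⟩ := exists_heatTrace_le d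
  have hpi := Real.pi_pos
  set B : ℝ := 16 * Real.pi * C * 2 ^ (d / 2) + 4 with hB
  have hB0 : 0 < B := by positivity
  refine ⟨max B (64 * C), lt_max_of_lt_left hB0, ?_⟩
  intro Ω _ P _ X hX n hn t ht ht1
  have htd : 0 < t ^ (d / 2) := Real.rpow_pos_of_pos ht _
  refine (measureReal_compl_eventA_le ht ht1 hX hn).trans ?_
  have h1 : (4 * Real.pi * (2 / t * heatTrace d (t / 2)) + 2) * 2 ≤
      B * t ^ (-(1 + d / 2)) := by
    have h2 := h (t / 2) (by linarith) (by linarith)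
    have h3 : (t / 2) ^ (-(d / 2)) = 2 ^ (d / 2) * t ^ (-(d / 2)) := by
      rw [Real.div_rpow ht.le zero_le_two, Real.rpow_neg zero_le_two (d / 2), div_inv_eq_mul,
        mul_comm]
    have h4 : t ^ (-(1 + d / 2)) = t⁻¹ * t ^ (-(d / 2)) := by
      rw [neg_add, Real.rpow_add ht, Real.rpow_neg_one]
    have h5 : 1 ≤ t ^ (-(1 + d / 2)) :=
      Real.one_le_rpow_of_pos_of_le_one_of_nonpos ht ht1.le (by linarith)
    rw [h3] at h2
    have h6 := mul_le_mul_of_nonneg_left h2 (by positivity : 0 ≤ 16 * Real.pi * t⁻¹)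
    have e1 : (4 * Real.pi * (2 / t * heatTrace d (t / 2)) + 2) * 2 =
        16 * Real.pi * t⁻¹ * heatTrace d (t / 2) + 4 := by ring
    have e2 : 16 * Real.pi * t⁻¹ * (C * (2 ^ (d / 2) * t ^ (-(d / 2)))) =
        16 * Real.pi * C * 2 ^ (d / 2) * t ^ (-(1 + d / 2)) := by rw [h4]; ring
    rw [e1, hB, add_mul]
    linarith
  have h7 : Real.exp (-(n / (64 * heatTrace d t))) ≤
      Real.exp (-(n * t ^ (d / 2) / max B (64 * C))) := by
    refine Real.exp_le_exp.2 (neg_le_neg ?_)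
    have hK := zero_lt_one.trans_le (one_le_heatTrace (d := d) ht ht1)
    have h8 := h t ht ht1
    rw [Real.rpow_neg ht.le] at h8
    have h9 : heatTrace d t * t ^ (d / 2) ≤ C := by
      calc heatTrace d t * t ^ (d / 2) ≤ C * (t ^ (d / 2))⁻¹ * t ^ (d / 2) :=
            mul_le_mul_of_nonneg_right h8 htd.le
        _ = C := by field_simp
    rw [div_le_div_iff₀ (lt_max_of_lt_left hB0) (by positivity)]
    have h10 : t ^ (d / 2) * (64 * heatTrace d t) ≤ max B (64 * C) :=
      le_max_of_le_right (by linarith)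
    calc (n : ℝ) * t ^ (d / 2) * (64 * heatTrace d t)
        = n * (t ^ (d / 2) * (64 * heatTrace d t)) := by ring
      _ ≤ _ := mul_le_mul_of_nonneg_left h10 (by positivity)
  rw [← mul_assoc]
  exact mul_le_mul (h1.trans (mul_le_mul_of_nonneg_right (le_max_left _ _) (by positivity))) h7
    (Real.exp_pos _).le (by positivity)

/-- `n^a exp (-b n^δ) → 0`. -/
lemma tendsto_natCast_rpow_mul_exp_neg (a : ℝ) {b δ : ℝ} (hb : 0 < b) (hδ : 0 < δ) :
    Tendsto (fun n : ℕ => (n : ℝ) ^ a * Real.exp (-b * (n : ℝ) ^ δ)) atTop (𝓝 0) := by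
  have h := (tendsto_rpow_mul_exp_neg_mul_atTop_nhds_zero (a / δ) b hb).comp
    ((tendsto_rpow_atTop hδ).comp tendsto_natCast_atTop_atTop)
  refine h.congr fun n => ?_
  simp only [Function.comp]
  rw [← Real.rpow_mul (Nat.cast_nonneg n), mul_div_cancel₀ _ hδ.ne']

lemma tendsto_mul_measure_compl_eventA [Fact (1 ≤ d)]
    {Ω : Type*} [MeasurableSpace Ω] {P : Measure Ω} [IsProbabilityMeasure P] {X : ℕ → Ω → E}
    (hX : IsSample P d X) {t : ℕ → ℝ} {c γ : ℝ} (hc : 0 < c) (hγ : γ < 2 / d)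
    (ht : Tendsto t atTop (𝓝 0)) (hct : ∀ᶠ n : ℕ in atTop, c / (n : ℝ) ^ γ ≤ t n) :
    Tendsto (fun n : ℕ => (n : ℝ≥0∞) * P (eventA d (t n) n X)ᶜ) atTop (𝓝 0) := by
  have hd : 1 ≤ d := Fact.out
  obtain ⟨C, hC, h⟩ := exists_measureReal_compl_eventA_le d
  set δ : ℝ := 1 - γ * (d / 2) with hδ
  have hδ0 : 0 < δ := by
    rw [lt_div_iff₀ (by linarith)] at hγ
    rw [hδ]; linarith
  set D : ℝ := C * c ^ (-(1 + d / 2)) with hD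
  set b : ℝ := c ^ (d / 2) / C with hb
  have hb0 : 0 < b := by positivity
  have hlim : Tendsto (fun n : ℕ => ENNReal.ofReal (D * ((n : ℝ) ^ (1 + γ * (1 + d / 2)) *
      Real.exp (-b * (n : ℝ) ^ δ)))) atTop (𝓝 0) := by
    have := ((tendsto_natCast_rpow_mul_exp_neg (1 + γ * (1 + d / 2)) hb0 hδ0).const_mul D)
    rw [mul_zero] at this
    simpa using ENNReal.tendsto_ofReal this
  refine tendsto_of_tendsto_of_tendsto_of_le_of_le' tendsto_const_nhds hlim
    (Eventually.of_forall fun _ => zero_le) ?_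
  filter_upwards [hct, ht.eventually (gt_mem_nhds one_pos), eventually_ne_atTop 0]
    with n hn hn1 hn0
  have hnr : (0 : ℝ) < n := by exact_mod_cast Nat.pos_of_ne_zero hn0
  have hq : 0 < c / (n : ℝ) ^ γ := by positivity
  have htn : 0 < t n := hq.trans_le hn
  rw [← ENNReal.ofReal_natCast, ← ofReal_measureReal, ← ENNReal.ofReal_mul hnr.le]
  refine ENNReal.ofReal_le_ofReal ?_
  have h1 : t n ^ (-(1 + d / 2)) ≤ c ^ (-(1 + d / 2)) * (n : ℝ) ^ (γ * (1 + d / 2)) := by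
    refine (Real.rpow_le_rpow_of_nonpos hq hn (by linarith)).trans_eq ?_
    rw [Real.div_rpow hc.le (by positivity), ← Real.rpow_mul hnr.le, div_eq_mul_inv,
      ← Real.rpow_neg hnr.le]
    congr 2; ring
  have h2 : b * (n : ℝ) ^ δ ≤ n * t n ^ (d / 2) / C := by
    have h3 := Real.rpow_le_rpow hq.le hn (by linarith : 0 ≤ d / 2)
    rw [Real.div_rpow hc.le (by positivity), ← Real.rpow_mul hnr.le] at h3
    rw [hb, hδ, Real.rpow_sub hnr, Real.rpow_one, div_mul_eq_mul_div]
    refine div_le_div_of_nonneg_right ?_ hC.le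
    calc c ^ (d / 2) * ((n : ℝ) / (n : ℝ) ^ (γ * (d / 2)))
        = n * (c ^ (d / 2) / (n : ℝ) ^ (γ * (d / 2))) := by ring
      _ ≤ _ := mul_le_mul_of_nonneg_left h3 hnr.le
  calc (n : ℝ) * P.real (eventA d (t n) n X)ᶜ
      ≤ n * (C * t n ^ (-(1 + d / 2)) * Real.exp (-(n * t n ^ (d / 2) / C))) :=
        mul_le_mul_of_nonneg_left (h P X hX n hn0 _ htn hn1) hnr.le
    _ ≤ n * (C * (c ^ (-(1 + d / 2)) * (n : ℝ) ^ (γ * (1 + d / 2))) *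
        Real.exp (-b * (n : ℝ) ^ δ)) := by
        refine mul_le_mul_of_nonneg_left (mul_le_mul (mul_le_mul_of_nonneg_left h1 hC.le)
          (Real.exp_le_exp.2 ?_) (Real.exp_pos _).le (by positivity)) hnr.le
        linarith
    _ = _ := by
        rw [Real.rpow_add hnr, Real.rpow_one, hD]; ring

lemma tendsto_mul_expectedCost [Fact (1 ≤ d)]
    {Ω : Type*} [MeasurableSpace Ω] {P : Measure Ω} [IsProbabilityMeasure P] {X : ℕ → Ω → E}
    (hX : IsSample P d X) {t : ℕ → ℝ} {c γ : ℝ} (hc : 0 < c) (hγ : γ < 2 / d)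
    (ht : Tendsto t atTop (𝓝 0)) (hct : ∀ᶠ n : ℕ in atTop, c / (n : ℝ) ^ γ ≤ t n) :
    Tendsto (fun n : ℕ => (n : ℝ≥0∞) * expectedCost P d (t n) n X) atTop (𝓝 0) := by
  have h1 := tendsto_mul_measure_compl_eventA hX hc hγ ht hct
  have h2 : Tendsto (fun n => ENNReal.ofReal √(t n)) atTop (𝓝 0) := by
    have := ENNReal.tendsto_ofReal ((Real.continuous_sqrt.tendsto 0).comp ht)
    simpa [Function.comp_def] using this
  have h3 := ENNReal.Tendsto.const_mul (a := ENNReal.ofReal (Real.pi ^ 2 + 32 * d)) (h1.add h2)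
    (Or.inr ENNReal.ofReal_ne_top)
  rw [add_zero, mul_zero] at h3
  refine tendsto_of_tendsto_of_tendsto_of_le_of_le' tendsto_const_nhds h3
    (Eventually.of_forall fun _ => zero_le) ?_
  filter_upwards [hct, ht.eventually (gt_mem_nhds one_pos), eventually_ne_atTop 0]
    with n hn hn1 hn0
  have hnr : (0 : ℝ) < n := by exact_mod_cast Nat.pos_of_ne_zero hn0
  have htn : 0 < t n := (by positivity : 0 < c / (n : ℝ) ^ γ).trans_le hn
  calc (n : ℝ≥0∞) * expectedCost P d (t n) n X
      ≤ n * (ENNReal.ofReal (Real.pi ^ 2 + 32 * d) *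
        (P (eventA d (t n) n X)ᶜ + ENNReal.ofReal (√(t n) / n))) :=
        mul_le_mul_right (expectedCost_le htn hn1 hX hn0) _
    _ = ENNReal.ofReal (Real.pi ^ 2 + 32 * d) *
        (n * P (eventA d (t n) n X)ᶜ + n * ENNReal.ofReal (√(t n) / n)) := by ring
    _ = _ := by
        rw [← ENNReal.ofReal_natCast n, ← ENNReal.ofReal_mul hnr.le, mul_div_cancel₀ _ hnr.ne']

end JacobiModel

end

theorem theorem5p1 (d : ℝ) (hd : 1 ≤ d) :
    (∃ C : ℝ, 0 < C ∧
      ∀ (Ω : Type*) [MeasurableSpace Ω] (P : Measure Ω) [IsProbabilityMeasure P]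
        (X : ℕ → Ω → JacobiModel.E), JacobiModel.IsSample P d X →
        ∀ n : ℕ, 1 ≤ n → ∀ t : ℝ, 0 < t → t < 1 →
          JacobiModel.expectedCost P d t n X ≤
            ENNReal.ofReal C *
              (P (JacobiModel.eventA d t n X)ᶜ + ENNReal.ofReal (Real.sqrt t / n))) ∧
    (∀ (Ω : Type*) [MeasurableSpace Ω] (P : Measure Ω) [IsProbabilityMeasure P]
        (X : ℕ → Ω → JacobiModel.E), JacobiModel.IsSample P d X →
        ∀ (t : ℕ → ℝ) (c γ : ℝ), 0 < c → 0 < γ → γ < 2 / d →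
          Tendsto t atTop (𝓝 0) → (∀ᶠ n : ℕ in atTop, c / (n : ℝ) ^ γ ≤ t n) →
          Tendsto (fun n : ℕ => (n : ℝ≥0∞) * JacobiModel.expectedCost P d (t n) n X)
            atTop (𝓝 0)) := by
  have : Fact (1 ≤ d) := ⟨hd⟩
  refine ⟨⟨Real.pi ^ 2 + 32 * d, by positivity, ?_⟩, ?_⟩
  · intro Ω _ P _ X hX n hn t ht ht1
    exact JacobiModel.expectedCost_le ht ht1 hX (Nat.one_le_iff_ne_zero.1 hn)
  · intro Ω _ P _ X hX t c γ hc _ hγ ht hct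
    exact JacobiModel.tendsto_mul_expectedCost hX hc hγ ht hct
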